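/- **Model.** Let $(Y,X)$, with $Y\in\{+1,-1\}$ and $X\in\mathbb R^p$, follow the semiparametric LDA model: $\Pr(Y=+1)=\pi_+\in(0,1)$, $\pi_-=1-\pi_+$, and, for strictly increasing univariate transformations $h_1,\dots,h_p$, the vector $h(X)=(h_1(X_1),\dots,h_p(X_p))$ given $Y=\pm1$ is $N(\mu_\pm,\Sigma)$ with $\Sigma$ positive definite, $\Sigma_{jj}=1$ and $\mu_+=0$. Let $\Omega=\mathrm{Cov}\{h(X)\}$, $\beta=\Omega^{-1}(\mu_+-\mu_-)$, $A=\{j:\beta_j\ne0\}$, $s=|A|$, and, with $\|M\|_\infty=\max_i\sum_j|M_{ij}|$ for matrices and the maximum norm for vectors, $$\kappa=\|\Omega_{A^cA}\Omega_{AA}^{-1}\|_\infty,\quad \varphi=\|\Omega_{AA}^{-1}\|_\infty,\quad \Delta=\|\mu_{+A}-\mu_{-A}\|_\infty,\quad \nu=\frac{\min_{j\in A}|\beta_j|}{\Delta\varphi}.$$ **Estimators.** From $n$ i.i.d. copies $(Y^i,X^i)$ with $n_\pm$ observations in the two classes, let $\hat F_{+j}$ be the empirical distribution function of the $j$-th predictor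 in class $+1$, Winsorized at $1/n_+^2$ and $1-1/n_+^2$, and $\hat h_j=\Phi^{-1}\circ\hat F_{+j}$. Code the response numerically as $y^i=n/n_+$ if $Y^i=+1$ and $y^i=-n/n_-$ if $Y^i=-1$. The SSDA estimate $\hat\beta$ with the lasso penalty is the coefficient part of a minimiser of $n^{-1}\sum_i\{y^i-\beta_0-\sum_{j}\hat h_j(X^i_j)\beta_j\}^2+\lambda\sum_{j}|\beta_j|$; the hypothetical estimate $\hat\beta^{\rm hyp}_A$ is obtained in the same way using only the predictors $j\in A$. **Bounds.** For constants $c,C>0$ and $0<\rho<1/3$ let $$\zeta_1^*(t)=2e^{-cnt^2}+4e^{-cn^{1-2\rho}t^2/\rho}+4e^{-cn^{1/2-\rho}},$$ $$\zeta_2^*(t)=Ce^{-cnt^2}+Ce^{-cn^{1/3-\rho}}+Ce^{-cn^{1-\rho}}+Ce^{-c(\log n)^2n^{1-2\rho}t^2/\rho^2},$$ $$\zeta_1(t)=\zeta_1^*(\pi_+^{1/2}t/2)+\zeta_1^*(\pi_-^{1/2}t/2)+4e^{-cn},$$ $$\zeta_2(t)=\zeta_2^*(\pi_+^{1/2}t/2)+\zeta_2^*(\pi_-^{1/2}t/2)+4e^{-cn}+2\zeta_1(t).$$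 **Theorem 2.** Given $\rho\in(0,1/3)$, $\pi_+\in(0,1)$ and $B$, there are positive constants $c,C,K,\epsilon_0$, depending on $(\rho,\pi_+,B)$ only (so not on $n,p,s$), such that the following holds for all $n\ge1$, $p$ and all models as above with $\max_j|\mu_{-j}|\le B$. Let $0<\lambda<\min\{\min_{j\in A}|\beta_j|/(2\varphi),\Delta\}$. 1. Suppose $\kappa<1$. If $\epsilon>0$, $\epsilon>Ksn^{-\rho/2}$ and $\epsilon<\min\big(\epsilon_0,\lambda(1-\kappa)/[4\varphi\{\lambda/2+(1+\kappa)\}\Delta]\big)$, then with probability at least $1-\psi_1(\epsilon)$ minimisers exist in both problems, and every choice of them satisfies $\hat\beta_A=\hat\beta_A^{\rm hyp}$ and $\hat\beta_{A^c}=0$, where $$\psi_1(\epsilon)=2ps\,\zeta_2(\epsilon/s)+2p\,\zeta_1\!\left[\frac{\lambda(1-\kappa-2\epsilon\varphi)}{4(1+\kappa)}\right].$$ 2. If $\epsilon>0$, $\epsilon>Ksn^{-\rho/2}$ and $\epsilon<\min\{\epsilon_0,\nu/\{(3+\nu)\varphi\},\Delta\nu/(6+2\nu)\}$, then with probability at least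 $1-\psi_2(\epsilon)$ the hypothetical estimate exists and none of its elements (for any choice of the minimiser) is zero, where $\psi_2(\epsilon)=2s^2\zeta_2(\epsilon/s)+2s\,\zeta_1(\epsilon)$. 3. If $\epsilon>0$, $\epsilon>Ksn^{-\rho/2}$ and $\epsilon<\min\{\epsilon_0,\lambda/(2\varphi\Delta),\lambda\}$, then with probability at least $1-2s^2\zeta_2(\epsilon/s)-2s\,\zeta_1(\epsilon)$ the hypothetical estimate exists and (for any choice of the minimiser) $\|\hat\beta_A^{\rm hyp}-\beta_A\|_\infty\le4\varphi\lambda$. Moreover, if $\kappa<1$ and $\epsilon_1$ is admissible in part 1, the conclusions of parts 2 and 3 hold with $\hat\beta_A$ in place of $\hat\beta_A^{\rm hyp}$ with probability at least $1-\psi_1(\epsilon_1)-\psi_2(\epsilon)$ each. -/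

import Mathlib

open MeasureTheory ProbabilityTheory

namespace SSDA

noncomputable section

/-! Class labels are encoded as `Bool`: `true` is the class `Y = +1`, `false` the class `Y = -1`.
An observation is a pair `(Y, X)` with `X` a vector of `p` predictors. -/

/-- A labelled observation `(Y, X)`. -/
abbrev Obs (p : ℕ) : Type := Bool × (Fin p → ℝ)

/-! ### The population model -/

/-- The semiparametric LDA model: `(h₁(X₁), …, h_p(X_p)) | Y ~ N(μ_Y, Σ)`, with univariate strictly
increasing transformations `h j` and the identifiability normalisation `μ₊ = 0`, `Σ_jj = 1`.
Each `h j` has to be strictly increasing only on a set that carries `X j` (for instance the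
logarithm on `(0, ∞)`). -/
structure SeLDAModel (p : ℕ) where
  /-- joint law of `(Y, X)` -/
  law : Measure (Obs p)
  isProb : IsProbabilityMeasure law
  /-- `π₊ = Pr(Y = +1)` -/
  posProb : ℝ
  posProb_pos : 0 < posProb
  posProb_lt_one : posProb < 1
  law_pos : law.real {z | z.1 = true} = posProb
  /-- the transformations -/
  h : Fin p → ℝ → ℝ
  h_measurable : ∀ j, Measurable (h j)
  h_strictMono : ∀ j, ∃ D : Set ℝ, StrictMonoOn (h j) D ∧ ∀ᵐ z ∂law, z.2 j ∈ D
  /-- `μ₋`, the mean of `h(X)` in the class `-1` -/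
  muNeg : Fin p → ℝ
  /-- `Σ`, the common within-class covariance matrix of `h(X)` -/
  sigma : Matrix (Fin p) (Fin p) ℝ
  sigma_posDef : sigma.PosDef
  sigma_diag : ∀ j, sigma j j = 1
  /-- `h(X) | Y = +1` is `N(0, Σ)` -/
  law_h_pos :
    (ProbabilityTheory.cond law {z | z.1 = true}).map (fun z => WithLp.toLp 2 (fun j => h j (z.2 j)))
      = multivariateGaussian 0 sigma
  /-- `h(X) | Y = -1` is `N(μ₋, Σ)` -/
  law_h_neg :
    (ProbabilityTheory.cond law {z | z.1 = false}).map (fun z => WithLp.toLp 2 (fun j => h j (z.2 j)))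
      = multivariateGaussian (WithLp.toLp 2 muNeg) sigma

/-- `‖M‖_∞ = max_i ∑_j |M_ij|` (zero for a matrix without rows). -/
def matInfNorm {ι κ : Type} [Fintype ι] [Fintype κ] (M : Matrix ι κ ℝ) : ℝ :=
  ⨆ i, ∑ j, |M i j|

/-- `‖u‖_∞ = max_j |u_j|` (zero for the empty vector). -/
def vecInfNorm {ι : Type} [Fintype ι] (u : ι → ℝ) : ℝ := ⨆ j, |u j|

namespace SeLDAModel

variable {p : ℕ} (m : SeLDAModel p)

/-- `μ₊ - μ₋`, where `μ₊ = 0`. -/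
def meanDiff : Fin p → ℝ := fun j => 0 - m.muNeg j

/-- `Ω = Cov{h(X)}`, the covariance matrix of `h(X)` (not conditional on `Y`). -/
def omega : Matrix (Fin p) (Fin p) ℝ :=
  Matrix.of fun j k => covariance (fun z : Obs p => m.h j (z.2 j)) (fun z => m.h k (z.2 k)) m.law

/-- `β = Ω⁻¹ (μ₊ - μ₋)`. -/
def beta : Fin p → ℝ := Matrix.mulVec (m.omega)⁻¹ m.meanDiff

open Classical in
/-- `A = {j : β_j ≠ 0}`. -/
def active : Finset (Fin p) := Finset.univ.filter fun j => m.beta j ≠ 0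

/-- `s = |A|`. -/
def s : ℕ := m.active.card

/-- `Ω_AA`. -/
def omegaAA : Matrix {j // j ∈ m.active} {j // j ∈ m.active} ℝ :=
  m.omega.submatrix Subtype.val Subtype.val

/-- `Ω_{AᶜA}`. -/
def omegaAcA : Matrix {j // j ∈ m.activeᶜ} {j // j ∈ m.active} ℝ :=
  m.omega.submatrix Subtype.val Subtype.val

/-- `κ = ‖Ω_{AᶜA} Ω_AA⁻¹‖_∞`. -/
def kappa : ℝ := matInfNorm (m.omegaAcA * (m.omegaAA)⁻¹)

/-- `φ = ‖Ω_AA⁻¹‖_∞`. -/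
def phi : ℝ := matInfNorm (m.omegaAA)⁻¹

/-- `Δ = ‖μ₊A - μ₋A‖_∞`. -/
def Delta : ℝ := vecInfNorm fun j : {j // j ∈ m.active} => m.meanDiff j

/-- `min_{j ∈ A} |β_j|`. -/
def betaMin : ℝ := ⨅ j : {j // j ∈ m.active}, |m.beta j|

/-- `ν = min_{j ∈ A} |β_j| / (Δ φ)`. -/
def nu : ℝ := m.betaMin / (m.Delta * m.phi)

end SeLDAModel

/-! ### The estimators, as functions of the data set `D = (Y^i, X^i)_{i ≤ n}` -/

section Estimators

variable {n p : ℕ} (D : Fin n → Obs p)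

/-- `n₊` (for `y = true`) and `n₋` (for `y = false`). -/
def classSize (y : Bool) : ℕ := (Finset.univ.filter fun i => (D i).1 = y).card

/-- `F̃₊j`, the empirical distribution function of the `j`-th predictor in the class `+1`. -/
def empCDF (j : Fin p) (x : ℝ) : ℝ :=
  (∑ i, if (D i).1 = true ∧ (D i).2 j ≤ x then (1 : ℝ) else 0) / classSize D true

/-- Winsorization at `(a, b)`. -/
def winsorize (a b u : ℝ) : ℝ := if b < u then b else if u < a then a else u

/-- `F̂₊j`, the empirical distribution function Winsorized at `(1/n₊², 1 - 1/n₊²)`. -/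
def winCDF (j : Fin p) (x : ℝ) : ℝ :=
  winsorize (1 / (classSize D true : ℝ) ^ 2) (1 - 1 / (classSize D true : ℝ) ^ 2) (empCDF D j x)

/-- `Φ⁻¹`, the quantile function of the standard normal distribution. -/
def probit (u : ℝ) : ℝ := sInf {x : ℝ | u ≤ cdf (gaussianReal 0 1) x}

/-- The naive transformation estimator `ĥ_j = Φ⁻¹ ∘ F̂₊j`. -/
def hHat (j : Fin p) (x : ℝ) : ℝ := probit (winCDF D j x)

/-- The pseudo data `ĥ_j(X^i_j)`. -/
def pseudo (i : Fin n) (j : Fin p) : ℝ := hHat D j ((D i).2 j)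

/-- The numerical response of direct sparse discriminant analysis:
`n / n₊` for the class `+1` and `-n / n₋` for the class `-1`. -/
def response (i : Fin n) : ℝ :=
  if (D i).1 = true then (n : ℝ) / classSize D true else -((n : ℝ) / classSize D false)

end Estimators

/-- The lasso objective `n⁻¹ ∑_i (y_i - b₀ - ∑_j H_ij b_j)² + ∑_j λ |b_j|`. -/
def lassoObj {n : ℕ} {ι : Type} [Fintype ι] (lam : ℝ) (y : Fin n → ℝ) (H : Fin n → ι → ℝ)
    (b₀ : ℝ) (b : ι → ℝ) : ℝ :=
  (n : ℝ)⁻¹ * ∑ i, (y i - b₀ - ∑ j, H i j * b j) ^ 2 + ∑ j, lam * |b j|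

/-- `b` is the coefficient part of a minimiser `(b₀, b)` of the lasso objective. -/
def IsLasso {n : ℕ} {ι : Type} [Fintype ι] (lam : ℝ) (y : Fin n → ℝ) (H : Fin n → ι → ℝ)
    (b : ι → ℝ) : Prop :=
  ∃ b₀ : ℝ, ∀ (b₀' : ℝ) (b' : ι → ℝ), lassoObj lam y H b₀ b ≤ lassoObj lam y H b₀' b'

/-- `b` is an SSDA estimate `β̂`, computed from the data set `D` with the lasso penalty `λ`. -/
def IsSSDA {n p : ℕ} (lam : ℝ) (D : Fin n → Obs p) (b : Fin p → ℝ) : Prop :=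
  IsLasso lam (response D) (pseudo D) b

/-- `b` is a hypothetical estimate `β̂_A^hyp`: the lasso that only uses the predictors in `A`. -/
def IsHyp {n p : ℕ} (lam : ℝ) (D : Fin n → Obs p) (A : Finset (Fin p))
    (b : {j // j ∈ A} → ℝ) : Prop :=
  IsLasso lam (response D) (fun i (j : {j // j ∈ A}) => pseudo D i j) b

/-! ### Probability bounds -/

/-- `ζ₁*(t)`. -/
def zeta1Star (c ρ : ℝ) (n : ℕ) (t : ℝ) : ℝ :=
  2 * Real.exp (-c * n * t ^ 2) + 4 * Real.exp (-c * (n : ℝ) ^ (1 - 2 * ρ) * t ^ 2 / ρ)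
    + 4 * Real.exp (-c * (n : ℝ) ^ (1 / 2 - ρ))

/-- `ζ₂*(t)`; the generic constant in front of the exponentials is `C`, those inside are `c`. -/
def zeta2Star (c C ρ : ℝ) (n : ℕ) (t : ℝ) : ℝ :=
  C * Real.exp (-c * n * t ^ 2) + C * Real.exp (-c * (n : ℝ) ^ (1 / 3 - ρ))
    + C * Real.exp (-c * (n : ℝ) ^ (1 - ρ))
    + C * Real.exp (-c * (Real.log n) ^ 2 * (n : ℝ) ^ (1 - 2 * ρ) * t ^ 2 / ρ ^ 2)

/-- `ζ₁(t)`, where `q = π₊` and `1 - q = π₋`. -/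
def zeta1 (c ρ q : ℝ) (n : ℕ) (t : ℝ) : ℝ :=
  zeta1Star c ρ n (√q * t / 2) + zeta1Star c ρ n (√(1 - q) * t / 2) + 4 * Real.exp (-c * n)

/-- `ζ₂(t)`. -/
def zeta2 (c C ρ q : ℝ) (n : ℕ) (t : ℝ) : ℝ :=
  zeta2Star c C ρ n (√q * t / 2) + zeta2Star c C ρ n (√(1 - q) * t / 2) + 4 * Real.exp (-c * n)
    + 2 * zeta1 c ρ q n t

/-- `ψ₁ = 2 p s ζ₂(ε/s) + 2 p ζ₁[λ (1 - κ - 2 ε φ) / {4 (1 + κ)}]`. -/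
def psi1 {p : ℕ} (m : SeLDAModel p) (c C ρ : ℝ) (n : ℕ) (lam ε : ℝ) : ℝ :=
  2 * p * m.s * zeta2 c C ρ m.posProb n (ε / m.s)
    + 2 * p * zeta1 c ρ m.posProb n
        (lam * (1 - m.kappa - 2 * ε * m.phi) / (4 * (1 + m.kappa)))

/-- `ψ₂ = 2 s² ζ₂(ε/s) + 2 s ζ₁(ε)`. -/
def psi2 {p : ℕ} (m : SeLDAModel p) (c C ρ : ℝ) (n : ℕ) (ε : ℝ) : ℝ :=
  2 * (m.s : ℝ) ^ 2 * zeta2 c C ρ m.posProb n (ε / m.s)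
    + 2 * m.s * zeta1 c ρ m.posProb n ε

/-- `E` holds with probability at least `q`: it contains a measurable event of probability at
least `q` (so that `E` need not be known to be measurable). -/
def WithProbAtLeast {Ω : Type*} [MeasurableSpace Ω] (Pr : Measure Ω) (q : ℝ) (E : Ω → Prop) : Prop :=
  ∃ G : Set Ω, MeasurableSet G ∧ q ≤ Pr.real G ∧ ∀ ω ∈ G, E ω

/-- `Z` is an i.i.d. sample from the model `m`. -/
def IsSample {p n : ℕ} (m : SeLDAModel p) {Ω : Type*} [MeasurableSpace Ω] (Pr : Measure Ω)
    (Z : Fin n → Ω → Obs p) : Prop :=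
  iIndepFun Z Pr ∧ ∀ i, HasLaw (Z i) m.law Pr

end

end SSDA

/-! The argument has a deterministic half and a probabilistic half, joined by the event `GoodData`.

Deterministic half. When both classes occur the coded responses sum to zero, so the intercept can be
minimised out exactly: the lasso becomes an ℓ₁-penalised quadratic form in the sample covariance of
the pseudo data and the difference of their class means (`isLasso_iff_isQuadMin`,
`crossMean_response`). Since β is supported on A, Ω_AA β_A = (μ₊ - μ₋)_A. The first-order conditions
of the hypothetical problem are a perturbation of this system, so applying Ω_AA⁻¹ bounds both its
solution g and g - β_A in the maximum norm. For j outside A the gradient is, up to small errors, a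
combination of the active gradients whose coefficients have absolute sum at most κ < 1; it therefore
stays strictly below λ. `IsQuadMin.extendZero_unique` then forces every minimiser of the full
problem to be the extension of g by zero, without invertibility of the full sample covariance.

Probabilistic half. Ranks are unchanged by increasing maps, so the pseudo data are normal scores of
U = h_j(X_j). They are compared with U clipped to [-M, M]. Since Φ⁻¹ is not Lipschitz near 0 and 1,
the distance is averaged rather than bounded pointwise: it is the integral over levels s of the
fraction of observations whose score and clipped value lie on opposite sides of s. For these Φ(U) is
close to Φ(s), and empirical frequencies on a grid count them
(`CoordGood.mean_abs_score_sub_clip_le`). In the class -1 the law N(μ, 1) is compared with N(0, 1)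
through the likelihood ratio, at most e^{BM} on [-M, M]. What remains are averages of bounded
variables, handled by Hoeffding's inequality.

Rates. With M = √(4 log n + 1) one has e^{-M²/2} < 1/n², so the Winsorized scores lie in [-M, M] and
the truncation bias is negligible, while all losses are of the form e^{(B+2)M} = n^{o(1)}. This is
paid for by a factor n^{-ρ/2} in the deviation for the means, and by the deviation n^{-1/3} for the
covariances. One exponential of each ζ already suffices as a bound. The condition ε > K s n^{-ρ/2}
absorbs the bias of the covariances and excludes small n. -/

namespace SSDA

set_option linter.unusedSectionVars false

/-! ### Lasso as a penalised quadratic form: existence, first-order conditions, support -/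

section Lasso

open Matrix

variable {n : ℕ} {ι : Type} [Fintype ι]

/-- Column means of a design matrix. -/
noncomputable def colMean (H : Fin n → ι → ℝ) (j : ι) : ℝ := (n : ℝ)⁻¹ * ∑ i, H i j

/-- The centred design matrix. -/
noncomputable def centered (H : Fin n → ι → ℝ) : Matrix (Fin n) ι ℝ :=
  Matrix.of fun i j => H i j - colMean H j

/-- The sample covariance matrix of a design matrix. -/
noncomputable def sampleCov (H : Fin n → ι → ℝ) : Matrix ι ι ℝ :=
  (n : ℝ)⁻¹ • ((centered H)ᵀ * centered H)

/-- The averages `n⁻¹ ∑ y_i H_ij`. -/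
noncomputable def crossMean (y : Fin n → ℝ) (H : Fin n → ι → ℝ) (j : ι) : ℝ :=
  (n : ℝ)⁻¹ * ∑ i, y i * H i j

/-- The `ℓ₁`-penalised quadratic form `b'Cb - 2d'b + ∑ λ|b_j|`. -/
noncomputable def quadLasso (lam : ℝ) (C : Matrix ι ι ℝ) (d : ι → ℝ) (b : ι → ℝ) : ℝ :=
  b ⬝ᵥ C *ᵥ b - 2 * (d ⬝ᵥ b) + ∑ j, lam * |b j|

/-- `b` minimises `quadLasso`. -/
def IsQuadMin (lam : ℝ) (C : Matrix ι ι ℝ) (d : ι → ℝ) (b : ι → ℝ) : Prop :=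
  ∀ b', quadLasso lam C d b ≤ quadLasso lam C d b'

theorem sampleCov_apply (H : Fin n → ι → ℝ) (j k : ι) :
    sampleCov H j k = (n : ℝ)⁻¹ * ∑ i, (H i j - colMean H j) * (H i k - colMean H k) := by
  simp [sampleCov, centered, Matrix.mul_apply]

theorem sampleCov_eq_mean_mul_sub (hn : n ≠ 0) (H : Fin n → ι → ℝ) (j k : ι) :
    sampleCov H j k = (n : ℝ)⁻¹ * ∑ i, H i j * H i k - colMean H j * colMean H k := by
  have hn' : (n : ℝ) ≠ 0 := by exact_mod_cast hn
  have h1 : ∑ i, H i j = n * colMean H j := by rw [colMean]; field_simp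
  have h2 : ∑ i, H i k = n * colMean H k := by rw [colMean]; field_simp
  rw [sampleCov_apply]
  simp only [sub_mul, mul_sub, Finset.sum_sub_distrib, ← Finset.sum_mul, ← Finset.mul_sum, h1, h2,
    Finset.sum_const, Finset.card_univ, Fintype.card_fin, nsmul_eq_mul]
  field_simp
  ring

theorem sampleCov_posSemidef (H : Fin n → ι → ℝ) : (sampleCov H).PosSemidef := by
  have h := Matrix.posSemidef_conjTranspose_mul_self (centered H)
  rw [Matrix.conjTranspose_eq_transpose_of_trivial] at h
  exact h.smul (by positivity)

theorem quadForm_sampleCov (H : Fin n → ι → ℝ) (b : ι → ℝ) :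
    b ⬝ᵥ sampleCov H *ᵥ b = (n : ℝ)⁻¹ * ∑ i, (∑ j, H i j * b j - ∑ j, colMean H j * b j) ^ 2 := by
  rw [sampleCov, Matrix.smul_mulVec, dotProduct_smul, ← Matrix.mulVec_mulVec,
    Matrix.dotProduct_mulVec, Matrix.vecMul_transpose, smul_eq_mul]
  congr 1
  simp only [dotProduct]
  refine Finset.sum_congr rfl fun i _ => ?_
  simp only [Matrix.mulVec, dotProduct, centered, Matrix.of_apply, sub_mul,
    Finset.sum_sub_distrib]
  ring

/-- Completing the square in the intercept. Because the responses are centred, the linear term needs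
no centring of the design; the square is the only place where the intercept enters, and it can be
made zero for every `b`. -/
theorem lassoObj_eq_quadLasso (hn : n ≠ 0) (lam : ℝ) (y : Fin n → ℝ) (H : Fin n → ι → ℝ)
    (hy : ∑ i, y i = 0) (b₀ : ℝ) (b : ι → ℝ) :
    lassoObj lam y H b₀ b = (n : ℝ)⁻¹ * ∑ i, y i ^ 2 + (b₀ + ∑ j, colMean H j * b j) ^ 2
      + quadLasso lam (sampleCov H) (crossMean y H) b := by
  have hn' : (n : ℝ) ≠ 0 := by exact_mod_cast hn
  set f : Fin n → ℝ := fun i => ∑ j, H i j * b j with hf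
  set m : ℝ := ∑ j, colMean H j * b j with hm
  have hfm : ∑ i, f i = n * m := by
    simp only [hf, hm, colMean, Finset.mul_sum, Finset.sum_mul]
    rw [Finset.sum_comm]
    refine Finset.sum_congr rfl fun j _ => Finset.sum_congr rfl fun i _ => ?_
    field_simp
  have hd : crossMean y H ⬝ᵥ b = (n : ℝ)⁻¹ * ∑ i, y i * f i := by
    simp only [hf, dotProduct, crossMean, Finset.mul_sum, Finset.sum_mul]
    rw [Finset.sum_comm]
    refine Finset.sum_congr rfl fun j _ => Finset.sum_congr rfl fun i _ => ?_
    ring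
  rw [lassoObj, quadLasso, quadForm_sampleCov, hd]
  have e1 : ∑ i, (y i - b₀ - f i) ^ 2
      = ∑ i, y i ^ 2 - 2 * ∑ i, y i * f i + (∑ i, (f i) ^ 2 + 2 * b₀ * ∑ i, f i + n * b₀ ^ 2) := by
    have : ∀ i, (y i - b₀ - f i) ^ 2
        = y i ^ 2 - 2 * (y i * f i) + (f i ^ 2 + 2 * b₀ * f i + b₀ ^ 2) - 2 * b₀ * y i := by
      intro i; ring
    simp only [this, Finset.sum_sub_distrib, Finset.sum_add_distrib, ← Finset.mul_sum, hy,
      Finset.sum_const, Finset.card_univ, Fintype.card_fin, nsmul_eq_mul]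
    ring
  have e2 : ∑ i, (f i - m) ^ 2 = ∑ i, (f i) ^ 2 - n * m ^ 2 := by
    have : ∀ i, (f i - m) ^ 2 = f i ^ 2 - 2 * m * f i + m ^ 2 := by intro i; ring
    simp only [this, Finset.sum_sub_distrib, Finset.sum_add_distrib, ← Finset.mul_sum, hfm,
      Finset.sum_const, Finset.card_univ, Fintype.card_fin, nsmul_eq_mul]
    ring
  rw [e1, e2, hfm]
  field_simp
  ring

theorem isLasso_iff_isQuadMin (hn : n ≠ 0) (lam : ℝ) (y : Fin n → ℝ) (H : Fin n → ι → ℝ)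
    (hy : ∑ i, y i = 0) (b : ι → ℝ) :
    IsLasso lam y H b ↔ IsQuadMin lam (sampleCov H) (crossMean y H) b := by
  constructor
  · rintro ⟨b₀, h⟩ b'
    have := h (-∑ j, colMean H j * b' j) b'
    rw [lassoObj_eq_quadLasso hn _ _ _ hy, lassoObj_eq_quadLasso hn _ _ _ hy] at this
    nlinarith [sq_nonneg (b₀ + ∑ j, colMean H j * b j)]
  · intro h
    refine ⟨-∑ j, colMean H j * b j, fun b₀' b' => ?_⟩
    have := h b'
    rw [lassoObj_eq_quadLasso hn _ _ _ hy, lassoObj_eq_quadLasso hn _ _ _ hy]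
    nlinarith [sq_nonneg (b₀' + ∑ j, colMean H j * b' j)]

/-- The penalty alone gives coercivity: the residual sum of squares is nonnegative, so the reduced
objective is at least λ‖b‖ minus a constant. Singular sample covariances are therefore allowed. -/
theorem exists_isLasso (hn : n ≠ 0) {lam : ℝ} (hl : 0 < lam) (y : Fin n → ℝ)
    (H : Fin n → ι → ℝ) (hy : ∑ i, y i = 0) : ∃ b, IsLasso lam y H b := by
  simp only [isLasso_iff_isQuadMin hn lam y H hy]
  set F := quadLasso lam (sampleCov H) (crossMean y H) with hF
  have hcont : Continuous F := by
    rw [hF]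
    unfold quadLasso dotProduct Matrix.mulVec dotProduct
    fun_prop
  set S : ℝ := (n : ℝ)⁻¹ * ∑ i, y i ^ 2
  have hlow : ∀ b, lam * ‖b‖ - S ≤ F b := by
    intro b
    have h := lassoObj_eq_quadLasso hn lam y H hy (-∑ j, colMean H j * b j) b
    have h1 : ∑ j, lam * |b j| ≤ lassoObj lam y H (-∑ j, colMean H j * b j) b := by
      rw [lassoObj]
      have : 0 ≤ (n : ℝ)⁻¹ * ∑ i, (y i - (-∑ j, colMean H j * b j) - ∑ j, H i j * b j) ^ 2 := by
        positivity
      linarith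
    have h2 : lam * ‖b‖ ≤ ∑ j, lam * |b j| := by
      rw [← Finset.mul_sum]
      refine mul_le_mul_of_nonneg_left ?_ hl.le
      refine (pi_norm_le_iff_of_nonneg (by positivity)).2 fun j => ?_
      rw [Real.norm_eq_abs]
      exact Finset.single_le_sum (f := fun j => |b j|) (fun _ _ => abs_nonneg _)
        (Finset.mem_univ j)
    simp only [neg_add_cancel] at h
    simp only [hF]
    linarith
  have htend : Filter.Tendsto F (Filter.cocompact (ι → ℝ)) Filter.atTop := by
    refine Filter.tendsto_atTop_mono hlow ?_
    exact Filter.tendsto_atTop_add_const_right _ _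
      ((tendsto_norm_cocompact_atTop (E := ι → ℝ)).const_mul_atTop hl)
  exact hcont.exists_forall_le htend

/-- An exact expansion whose non-quadratic part separates over coordinates. It serves both for the
first-order conditions, with one coordinate moved, and for uniqueness. -/
theorem quadLasso_add_sub (lam : ℝ) {C : Matrix ι ι ℝ} (hC : C.IsHermitian) (d g v : ι → ℝ) :
    quadLasso lam C d (g + v) - quadLasso lam C d g
      = v ⬝ᵥ C *ᵥ v + ∑ j, (2 * (C *ᵥ g - d) j * v j + lam * (|g j + v j| - |g j|)) := by
  have hsym : g ⬝ᵥ C *ᵥ v = v ⬝ᵥ C *ᵥ g := by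
    have hT : Cᵀ = C := by simpa [Matrix.conjTranspose_eq_transpose_of_trivial] using hC.eq
    rw [Matrix.dotProduct_mulVec, ← Matrix.mulVec_transpose, hT, dotProduct_comm]
  have h2 : ∑ j, 2 * (C *ᵥ g - d) j * v j = 2 * (v ⬝ᵥ C *ᵥ g) - 2 * (d ⬝ᵥ v) := by
    simp only [dotProduct, Finset.mul_sum, ← Finset.sum_sub_distrib, Pi.sub_apply]
    exact Finset.sum_congr rfl fun j _ => by ring
  have h3 : ∑ j, lam * (|g j + v j| - |g j|) = ∑ j, lam * |(g + v) j| - ∑ j, lam * |g j| := by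
    simp only [← Finset.sum_sub_distrib, Pi.add_apply, mul_sub]
  rw [Finset.sum_add_distrib, h2, h3]
  simp only [quadLasso, Matrix.mulVec_add, dotProduct_add, add_dotProduct, hsym]
  ring

/-- Let τ tend to 0. This replaces differentiation at the kink of the absolute value. -/
theorem nonpos_of_forall_le_mul {x a : ℝ} (h : ∀ τ : ℝ, 0 < τ → τ ≤ 1 → x ≤ a * τ) : x ≤ 0 := by
  by_contra! hx
  have ha : 0 < |a| + 1 := by positivity
  have hτ : 0 < min 1 (x / (2 * (|a| + 1))) := by positivity
  have h1 := h _ hτ (min_le_left _ _)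
  have h2 : a * min 1 (x / (2 * (|a| + 1))) ≤ (|a| + 1) * (x / (2 * (|a| + 1))) :=
    mul_le_mul (by linarith [le_abs_self a]) (min_le_right _ _) hτ.le ha.le
  have h3 : (|a| + 1) * (x / (2 * (|a| + 1))) = x / 2 := by field_simp
  linarith

/-- The first-order conditions for a minimiser of `quadLasso`. -/
theorem IsQuadMin.kkt {lam : ℝ} (hl : 0 ≤ lam) {C : Matrix ι ι ℝ} (hC : C.IsHermitian)
    {d g : ι → ℝ} (hg : IsQuadMin lam C d g) (j : ι) :
    |2 * (C *ᵥ g - d) j| ≤ lam ∧ lam * |g j| + 2 * (C *ᵥ g - d) j * g j ≤ 0 := by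
  classical
  set r := (C *ᵥ g - d) j with hr
  have key : ∀ u : ℝ, 0 ≤ C j j * u ^ 2 + 2 * r * u + lam * (|g j + u| - |g j|) := by
    intro u
    have h := quadLasso_add_sub lam hC d g (Pi.single j u)
    have h1 : Pi.single j u ⬝ᵥ C *ᵥ Pi.single j u = C j j * u ^ 2 := by
      simp; ring
    have h2 : ∑ k, (2 * (C *ᵥ g - d) k * (Pi.single j u : ι → ℝ) k
        + lam * (|g k + (Pi.single j u : ι → ℝ) k| - |g k|))
        = 2 * r * u + lam * (|g j + u| - |g j|) := by
      rw [Finset.sum_eq_single j]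
      · simp [hr]
      · intro k _ hk; simp [hk]
      · simp
    rw [h1, h2] at h
    have := hg (g + Pi.single j u)
    linarith
  have habs : ∀ u : ℝ, lam * (|g j + u| - |g j|) ≤ lam * |u| := fun u =>
    mul_le_mul_of_nonneg_left (by linarith [abs_add_le (g j) u]) hl
  refine ⟨abs_le.2 ⟨?_, ?_⟩, ?_⟩
  · have : -(2 * r) - lam ≤ 0 := nonpos_of_forall_le_mul (a := C j j) fun τ hτ _ => by
      have h1 := key τ
      have h2 := habs τ
      rw [abs_of_pos hτ] at h2
      have : 0 ≤ τ * (C j j * τ + 2 * r + lam) := by nlinarith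
      have := nonneg_of_mul_nonneg_right this hτ
      linarith
    linarith
  · have : 2 * r - lam ≤ 0 := nonpos_of_forall_le_mul (a := C j j) fun τ hτ _ => by
      have h1 := key (-τ)
      have h2 := habs (-τ)
      rw [abs_neg, abs_of_pos hτ] at h2
      have : 0 ≤ τ * (C j j * τ - 2 * r + lam) := by nlinarith
      have := nonneg_of_mul_nonneg_right this hτ
      linarith
    linarith
  -- Shrinking the coordinate towards zero by the factor 1 - τ yields complementary slackness in the
  -- form needed later, with no case split on the sign of `g j`.
  · refine nonpos_of_forall_le_mul (a := C j j * g j ^ 2) fun τ hτ hτ1 => ?_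
    have h1 := key (-(τ * g j))
    have h2 : |g j + -(τ * g j)| = (1 - τ) * |g j| := by
      rw [show g j + -(τ * g j) = (1 - τ) * g j by ring, abs_mul, abs_of_nonneg (by linarith)]
    rw [h2] at h1
    have : 0 ≤ τ * (C j j * g j ^ 2 * τ - 2 * r * g j - lam * |g j|) := by nlinarith
    have := nonneg_of_mul_nonneg_right this hτ
    linarith

section Extend

variable [DecidableEq ι] {A : Finset ι}

/-- The principal submatrix indexed by `A`. -/
abbrev principal (A : Finset ι) (C : Matrix ι ι ℝ) : Matrix {j // j ∈ A} {j // j ∈ A} ℝ :=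
  C.submatrix Subtype.val Subtype.val

/-- Extension of a vector indexed by `A` by zero. -/
def extendZero (g : {j // j ∈ A} → ℝ) : ι → ℝ := fun j => if h : j ∈ A then g ⟨j, h⟩ else 0

theorem extendZero_mem (g : {j // j ∈ A} → ℝ) (j : {j // j ∈ A}) : extendZero g j = g j := by
  simp [extendZero]

theorem extendZero_notMem (g : {j // j ∈ A} → ℝ) {j : ι} (hj : j ∉ A) : extendZero g j = 0 := by
  simp [extendZero, hj]

theorem sum_eq_sum_subtype {f : ι → ℝ} (hf : ∀ j ∉ A, f j = 0) :
    ∑ j, f j = ∑ j : {j // j ∈ A}, f j := by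
  rw [Finset.sum_coe_sort A f]
  exact (Finset.sum_subset (Finset.subset_univ A) fun j _ hj => hf j hj).symm

theorem mulVec_eq_sum_subtype {κ : Type} (C : Matrix κ ι ℝ) {v : ι → ℝ} (hv : ∀ j ∉ A, v j = 0)
    (i : κ) : (C *ᵥ v) i = ∑ k : {j // j ∈ A}, C i k * v k := by
  rw [Matrix.mulVec, dotProduct]
  exact sum_eq_sum_subtype fun j hj => by simp [hv j hj]

/-- If the restricted minimiser satisfies the dual constraints off `A` strictly, its extension by
zero is the only minimiser of the full problem. -/
theorem IsQuadMin.extendZero_unique {lam : ℝ} (hl : 0 ≤ lam) {C : Matrix ι ι ℝ}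
    (hC : C.PosSemidef) {d : ι → ℝ} {g : {j // j ∈ A} → ℝ}
    (hg : IsQuadMin lam (principal A C) (fun j : {j // j ∈ A} => d j) g)
    (hdual : ∀ j ∉ A, |2 * (∑ k : {j // j ∈ A}, C j k * g k - d j)| < lam)
    (hinj : ∀ v : {j // j ∈ A} → ℝ, principal A C *ᵥ v = 0 → v = 0)
    {b : ι → ℝ} (hb : IsQuadMin lam C d b) :
    (∀ j : {j // j ∈ A}, b j = g j) ∧ ∀ j ∉ A, b j = 0 := by
  set e := extendZero g with he
  set v := b - e with hv
  have hbev : b = e + v := by simp [hv]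
  have hCe : ∀ j, (C *ᵥ e) j = ∑ k : {j // j ∈ A}, C j k * g k := by
    intro j
    rw [mulVec_eq_sum_subtype (A := A) C (fun k hk => extendZero_notMem g hk)]
    exact Finset.sum_congr rfl fun k _ => by rw [extendZero_mem g k]
  -- On A the subgradient condition makes each term nonnegative: slackness holds at `e j`, and the
  -- bound λ on the gradient handles `e j + v j`.
  have hon : ∀ j ∈ A, 0 ≤ 2 * (C *ᵥ e - d) j * v j + lam * (|e j + v j| - |e j|) := by
    intro j hj
    obtain ⟨h1, h2⟩ := hg.kkt hl (hC.isHermitian.submatrix _) ⟨j, hj⟩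
    have hr : (principal A C *ᵥ g - fun j : {j // j ∈ A} => d j) ⟨j, hj⟩
        = (C *ᵥ e - d) j := by
      simp only [Pi.sub_apply, hCe]
      rfl
    rw [hr] at h1 h2
    have hej : e j = g ⟨j, hj⟩ := extendZero_mem g ⟨j, hj⟩
    rw [← hej] at h2
    have h3 : -(lam * |e j + v j|) ≤ 2 * (C *ᵥ e - d) j * (e j + v j) := by
      have := neg_abs_le (2 * (C *ᵥ e - d) j * (e j + v j))
      rw [abs_mul] at this
      have := mul_le_mul_of_nonneg_right h1 (abs_nonneg (e j + v j))
      linarith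
    nlinarith
  -- Off A the strict dual inequality makes each term grow linearly in `|v j|`, which is what kills
  -- `v j` once the total is zero.
  have hoff : ∀ j ∉ A, (lam - |2 * (C *ᵥ e - d) j|) * |v j|
      ≤ 2 * (C *ᵥ e - d) j * v j + lam * (|e j + v j| - |e j|) := by
    intro j hj
    rw [show e j = 0 from extendZero_notMem g hj]
    have := neg_abs_le (2 * (C *ᵥ e - d) j * v j)
    rw [abs_mul] at this
    simp only [zero_add, abs_zero, sub_zero]
    linarith
  have hoff' : ∀ j ∉ A, 0 < lam - |2 * (C *ᵥ e - d) j| := by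
    intro j hj
    have := hdual j hj
    simp only [Pi.sub_apply, hCe]
    linarith
  have hterm : ∀ j, 0 ≤ 2 * (C *ᵥ e - d) j * v j + lam * (|e j + v j| - |e j|) := by
    intro j
    by_cases hj : j ∈ A
    · exact hon j hj
    · exact (mul_nonneg (hoff' j hj).le (abs_nonneg _)).trans (hoff j hj)
  have hq : 0 ≤ v ⬝ᵥ C *ᵥ v := by simpa using hC.dotProduct_mulVec_nonneg v
  have hsum := Finset.sum_nonneg fun j (_ : j ∈ Finset.univ) => hterm j
  have hdiff := quadLasso_add_sub lam hC.isHermitian d e v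
  rw [← hbev] at hdiff
  have hle := hb e
  have hs0 : ∑ j, (2 * (C *ᵥ e - d) j * v j + lam * (|e j + v j| - |e j|)) = 0 := by linarith
  have hq0 : v ⬝ᵥ C *ᵥ v = 0 := by linarith
  have hvoff : ∀ j ∉ A, v j = 0 := by
    intro j hj
    have h0 := (Finset.sum_eq_zero_iff_of_nonneg fun j _ => hterm j).1 hs0 j (Finset.mem_univ j)
    have h1 := hoff j hj
    rw [h0] at h1
    have h2 : |v j| ≤ 0 := by
      by_contra! h
      exact absurd (mul_pos (hoff' j hj) h) (not_lt.2 h1)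
    simpa using h2
  -- For a positive semidefinite matrix a vanishing quadratic form puts `v` in the kernel; as `v`
  -- lives on A, injectivity of the principal block finishes.
  have hCv : C *ᵥ v = 0 := (hC.dotProduct_mulVec_zero_iff v).1 (by simpa using hq0)
  have hvA : (fun j : {j // j ∈ A} => v j) = 0 := by
    refine hinj _ (funext fun j => ?_)
    have := congrFun hCv j
    rw [mulVec_eq_sum_subtype (A := A) C hvoff] at this
    simpa [Matrix.mulVec, dotProduct] using this
  refine ⟨fun j => ?_, fun j hj => ?_⟩
  · rw [hbev, Pi.add_apply, congrFun hvA j, show e j = g j from extendZero_mem g j]; simp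
  · rw [hbev, Pi.add_apply, hvoff j hj, show e j = 0 from extendZero_notMem g hj]; simp

end Extend

end Lasso

/-! ### Perturbation of linear systems in the maximum norm -/

section Norms

open Matrix

variable {α κ : Type} [Fintype α] [Fintype κ]

theorem row_sum_le_matInfNorm (M : Matrix κ α ℝ) (i : κ) : ∑ j, |M i j| ≤ matInfNorm M :=
  le_ciSup (f := fun i => ∑ j, |M i j|) (Set.finite_range _).bddAbove i

theorem matInfNorm_nonneg (M : Matrix κ α ℝ) : 0 ≤ matInfNorm M :=
  Real.iSup_nonneg fun _ => Finset.sum_nonneg fun _ _ => abs_nonneg _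

theorem abs_le_vecInfNorm (u : α → ℝ) (j : α) : |u j| ≤ vecInfNorm u :=
  le_ciSup (f := fun j => |u j|) (Set.finite_range _).bddAbove j

theorem vecInfNorm_nonneg (u : α → ℝ) : 0 ≤ vecInfNorm u :=
  Real.iSup_nonneg fun _ => abs_nonneg _

theorem vecInfNorm_le {u : α → ℝ} {c : ℝ} (hc : 0 ≤ c) (h : ∀ j, |u j| ≤ c) : vecInfNorm u ≤ c :=
  Real.iSup_le h hc

theorem abs_dotProduct_le {r v : α → ℝ} {a c : ℝ} (hr : ∑ k, |r k| ≤ a) (hc : 0 ≤ c)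
    (hv : ∀ k, |v k| ≤ c) : |r ⬝ᵥ v| ≤ a * c := by
  calc |r ⬝ᵥ v| ≤ ∑ k, |r k * v k| := Finset.abs_sum_le_sum_abs _ _
    _ ≤ ∑ k, |r k| * c := Finset.sum_le_sum fun k _ => by
        rw [abs_mul]; exact mul_le_mul_of_nonneg_left (hv k) (abs_nonneg _)
    _ = (∑ k, |r k|) * c := by rw [Finset.sum_mul]
    _ ≤ a * c := mul_le_mul_of_nonneg_right hr hc

variable [DecidableEq α]

theorem vecInfNorm_le_of_mulVec_eq {P : Matrix α α ℝ} (hP : IsUnit P.det) {u w : α → ℝ}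
    (h : P *ᵥ u = w) {c : ℝ} (hc : 0 ≤ c) (hw : ∀ j, |w j| ≤ c) :
    vecInfNorm u ≤ matInfNorm P⁻¹ * c := by
  have hu : u = P⁻¹ *ᵥ w := by
    rw [← h, Matrix.mulVec_mulVec, Matrix.nonsing_inv_mul _ hP, Matrix.one_mulVec]
  refine vecInfNorm_le (mul_nonneg (matInfNorm_nonneg _) hc) fun j => ?_
  rw [hu]
  exact abs_dotProduct_le (row_sum_le_matInfNorm P⁻¹ j) hc hw

theorem mulVec_eq_of_perturbation (P Q : Matrix α α ℝ) (g : α → ℝ) (j : α) :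
    (P *ᵥ g) j = (Q *ᵥ g) j - (fun k => Q j k - P j k) ⬝ᵥ g := by
  simp [Matrix.mulVec, dotProduct, sub_mul, Finset.sum_sub_distrib]

section Perturbation

variable {P Q : Matrix α α ℝ} {g d δ : α → ℝ} {l e τ : ℝ}

/-- Write Pg = (Qg - d) + (d - δ) + δ - (Q - P)g and apply P⁻¹. The norm of g stays on the right, to
be absorbed once e‖P⁻¹‖ is known to be small. -/
theorem vecInfNorm_le_of_kkt (hP : IsUnit P.det) (hQ : ∀ j, ∑ k, |Q j k - P j k| ≤ e)
    (he : 0 ≤ e) (hl : 0 ≤ l) (hτ : 0 ≤ τ) (hg : ∀ j, |(Q *ᵥ g) j - d j| ≤ l)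
    (hd : ∀ j, |d j - δ j| ≤ τ) :
    vecInfNorm g ≤ matInfNorm P⁻¹ * (l + e * vecInfNorm g + τ + vecInfNorm δ) := by
  have hG := vecInfNorm_nonneg g
  have hδ := vecInfNorm_nonneg δ
  refine vecInfNorm_le_of_mulVec_eq hP rfl (by positivity) fun j => ?_
  rw [mulVec_eq_of_perturbation P Q]
  have h1 := abs_dotProduct_le (hQ j) hG (abs_le_vecInfNorm g)
  have h2 := abs_le_vecInfNorm δ j
  have h3 := hg j
  have h4 := hd j
  rw [abs_le] at *
  constructor <;> linarith

theorem vecInfNorm_sub_le_of_kkt (hP : IsUnit P.det) (hQ : ∀ j, ∑ k, |Q j k - P j k| ≤ e)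
    (he : 0 ≤ e) (hl : 0 ≤ l) (hτ : 0 ≤ τ) (hg : ∀ j, |(Q *ᵥ g) j - d j| ≤ l)
    (hd : ∀ j, |d j - δ j| ≤ τ) {b : α → ℝ} (hb : P *ᵥ b = δ) :
    vecInfNorm (fun j => g j - b j) ≤ matInfNorm P⁻¹ * (l + e * vecInfNorm g + τ) := by
  have hG := vecInfNorm_nonneg g
  refine vecInfNorm_le_of_mulVec_eq hP rfl (by positivity) fun j => ?_
  have : (P *ᵥ fun j => g j - b j) j = (P *ᵥ g) j - δ j := by
    rw [← hb, show (fun j => g j - b j) = g - b from rfl, Matrix.mulVec_sub, Pi.sub_apply]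
  rw [this, mulVec_eq_of_perturbation P Q]
  have h1 := abs_dotProduct_le (hQ j) hG (abs_le_vecInfNorm g)
  have h3 := hg j
  have h4 := hd j
  rw [abs_le] at *
  constructor <;> linarith

/-- The preceding bound with zero data reads ‖g‖ ≤ ‖P⁻¹‖ e ‖g‖, so matrices near P stay injective.
-/
theorem eq_zero_of_perturbation (hP : IsUnit P.det) (hQ : ∀ j, ∑ k, |Q j k - P j k| ≤ e)
    (he : 0 ≤ e) (hsmall : matInfNorm P⁻¹ * e < 1) (hg : Q *ᵥ g = 0) : g = 0 := by
  have h := vecInfNorm_le_of_kkt (l := 0) (τ := 0) (d := 0) (δ := 0) (g := g) hP hQ he le_rfl le_rfl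
    (by simp [hg]) (by simp)
  have hz : vecInfNorm (0 : α → ℝ) ≤ 0 := vecInfNorm_le le_rfl (by simp)
  have hG := vecInfNorm_nonneg g
  have h0 : vecInfNorm g ≤ 0 := by
    have hφ := matInfNorm_nonneg P⁻¹
    have : matInfNorm P⁻¹ * vecInfNorm (0 : α → ℝ) ≤ 0 := mul_nonpos_of_nonneg_of_nonpos hφ hz
    nlinarith
  funext j
  have := (abs_le_vecInfNorm g j).trans h0
  simpa using this

/-- The gradient of the restricted problem in the direction of an excluded predictor. -/
theorem abs_excluded_gradient_le {r r' γ : α → ℝ} {c c' κ : ℝ} (he : 0 ≤ e) (hl : 0 ≤ l)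
    (hτ : 0 ≤ τ) (hκ : ∑ k, |γ k| ≤ κ) (hr : ∑ k, |r' k - r k| ≤ e) (hγ : r = γ ᵥ* P)
    (hc : c = γ ⬝ᵥ δ) (hcc : |c' - c| ≤ τ)
    (hQ : ∀ j, ∑ k, |Q j k - P j k| ≤ e) (hg : ∀ j, |(Q *ᵥ g) j - d j| ≤ l)
    (hd : ∀ j, |d j - δ j| ≤ τ) :
    |r' ⬝ᵥ g - c'| ≤ κ * (l + e * vecInfNorm g + τ) + e * vecInfNorm g + τ := by
  have hG := vecInfNorm_nonneg g
  have h1 : |γ ⬝ᵥ (fun j => (P *ᵥ g) j - δ j)| ≤ κ * (l + e * vecInfNorm g + τ) := by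
    refine abs_dotProduct_le hκ (by positivity) fun j => ?_
    rw [mulVec_eq_of_perturbation P Q]
    have h1 := abs_dotProduct_le (hQ j) hG (abs_le_vecInfNorm g)
    have h3 := hg j
    have h4 := hd j
    rw [abs_le] at *
    constructor <;> linarith
  have h2 := abs_dotProduct_le hr hG (abs_le_vecInfNorm g)
  -- Since r = γP and c = γ·δ, the excluded gradient is γ applied to the active population residual,
  -- plus the errors of r' and c'.
  have h3 : r' ⬝ᵥ g - c' = γ ⬝ᵥ (fun j => (P *ᵥ g) j - δ j)
      + (fun k => r' k - r k) ⬝ᵥ g - (c' - c) := by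
    rw [show (fun j => (P *ᵥ g) j - δ j) = P *ᵥ g - δ from rfl,
      show (fun k => r' k - r k) = r' - r from rfl, dotProduct_sub, sub_dotProduct,
      Matrix.dotProduct_mulVec, ← hγ, ← hc]
    ring
  rw [h3]
  rw [abs_le] at *
  constructor <;> linarith

end Perturbation

end Norms

/-! ### Deterministic consequences of accurate sample moments -/

section Selection

open Matrix

namespace SeLDAModel

variable {p : ℕ} (m : SeLDAModel p)

theorem omega_mulVec_beta (hΩ : m.omega.PosDef) : m.omega *ᵥ m.beta = m.meanDiff := by
  rw [beta, Matrix.mulVec_mulVec, Matrix.mul_nonsing_inv _ ((Matrix.isUnit_iff_isUnit_det _).1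
    hΩ.isUnit), Matrix.one_mulVec]

theorem beta_eq_zero_of_notMem {j : Fin p} (hj : j ∉ m.active) : m.beta j = 0 := by
  simpa [active] using hj

theorem isUnit_det_omegaAA (hΩ : m.omega.PosDef) : IsUnit m.omegaAA.det :=
  (Matrix.isUnit_iff_isUnit_det _).1 (hΩ.submatrix Subtype.val_injective).isUnit

theorem sum_omega_mul_beta (hΩ : m.omega.PosDef) (j : Fin p) :
    ∑ k : {k // k ∈ m.active}, m.omega j k * m.beta k = m.meanDiff j := by
  rw [← m.omega_mulVec_beta hΩ]
  exact (mulVec_eq_sum_subtype _ (fun j hj => m.beta_eq_zero_of_notMem hj) _).symm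

theorem omegaAA_mulVec_beta (hΩ : m.omega.PosDef) :
    m.omegaAA *ᵥ (fun j : {j // j ∈ m.active} => m.beta j)
      = fun j : {j // j ∈ m.active} => m.meanDiff j :=
  funext fun j => m.sum_omega_mul_beta hΩ j

theorem vecInfNorm_beta_le (hΩ : m.omega.PosDef) :
    vecInfNorm (fun j : {j // j ∈ m.active} => m.beta j) ≤ m.phi * m.Delta :=
  vecInfNorm_le_of_mulVec_eq (m.isUnit_det_omegaAA hΩ) (m.omegaAA_mulVec_beta hΩ)
    (vecInfNorm_nonneg _) (abs_le_vecInfNorm fun j : {j // j ∈ m.active} => m.meanDiff j)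

theorem betaMin_le (j : {j // j ∈ m.active}) : m.betaMin ≤ |m.beta j| :=
  ciInf_le (f := fun j : {j // j ∈ m.active} => |m.beta j|) (Set.finite_range _).bddBelow j

theorem s_pos_of_Delta_pos (h : 0 < m.Delta) : 0 < m.s := by
  by_contra h0
  have h1 : m.active = ∅ := by simpa [s] using h0
  have : m.Delta ≤ 0 := by
    refine vecInfNorm_le le_rfl fun j => ?_
    exact absurd j.2 (by simp [h1])
  linarith

/-- The regularisation parameters allowed in the theorem. -/
structure Admissible (lam : ℝ) : Prop where
  pos : 0 < lam
  lt : lam < min (m.betaMin / (2 * m.phi)) m.Delta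

variable {m} {lam : ℝ}

theorem Admissible.lt_Delta (h : m.Admissible lam) : lam < m.Delta := (lt_min_iff.1 h.lt).2

theorem Admissible.Delta_pos (h : m.Admissible lam) : 0 < m.Delta := h.pos.trans h.lt_Delta

theorem Admissible.phi_pos (h : m.Admissible lam) : 0 < m.phi := by
  have h1 : 0 ≤ m.phi := matInfNorm_nonneg _
  rcases h1.eq_or_lt with h0 | h0
  -- If φ were zero, the quotient by 2φ would take the default value 0 and the upper bound on λ
  -- would contradict λ > 0.
  · have := (lt_min_iff.1 h.lt).1
    rw [← h0] at this
    simp only [mul_zero, div_zero] at this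
    linarith [h.pos]
  · exact h0

theorem Admissible.lt_betaMin (h : m.Admissible lam) : 2 * m.phi * lam < m.betaMin := by
  have := (lt_min_iff.1 h.lt).1
  rw [lt_div_iff₀ (by linarith [h.phi_pos])] at this
  linarith

theorem Admissible.s_pos (h : m.Admissible lam) : 0 < m.s := m.s_pos_of_Delta_pos h.Delta_pos

end SeLDAModel

variable {n p : ℕ}

/-- On the predictors in `S` the sample moments are close to the population moments. -/
structure GoodData (m : SeLDAModel p) (D : Fin n → Obs p) (S : Finset (Fin p)) (ε τ : ℝ) :
    Prop where
  size : ∀ y, classSize D y ≠ 0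
  cov : ∀ j ∈ S, ∀ k ∈ m.active,
    |sampleCov (pseudo D) j k - m.omega j k| ≤ ε / m.s / 2
  mean : ∀ j ∈ S, |crossMean (response D) (pseudo D) j - m.meanDiff j| ≤ τ / 2

theorem classSize_eq_sum (D : Fin n → Obs p) (y : Bool) :
    (classSize D y : ℝ) = ∑ i, if (D i).1 = y then (1 : ℝ) else 0 := by
  simp [classSize]

theorem sum_response (D : Fin n → Obs p) (h : ∀ y, classSize D y ≠ 0) :
    ∑ i, response D i = 0 := by
  have h1 : (classSize D true : ℝ) ≠ 0 := by exact_mod_cast h true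
  have h2 : (classSize D false : ℝ) ≠ 0 := by exact_mod_cast h false
  have : ∀ i, response D i = (n : ℝ) / classSize D true * (if (D i).1 = true then (1 : ℝ) else 0)
      - (n : ℝ) / classSize D false * (if (D i).1 = false then (1 : ℝ) else 0) := by
    intro i
    by_cases hi : (D i).1 = true <;> simp [response, hi]
  simp only [this, Finset.sum_sub_distrib, ← Finset.mul_sum, ← classSize_eq_sum]
  field_simp
  simp

namespace GoodData

variable {m : SeLDAModel p} {D : Fin n → Obs p} {S : Finset (Fin p)} {ε τ lam : ℝ}

theorem n_ne_zero (h : GoodData m D S ε τ) : n ≠ 0 := by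
  rintro rfl
  exact h.size true (by simp [classSize])

theorem isHyp_iff (h : GoodData m D S ε τ) (g : {j // j ∈ m.active} → ℝ) :
    IsHyp lam D m.active g ↔ IsQuadMin lam (principal m.active (sampleCov (pseudo D)))
      (fun j : {j // j ∈ m.active} => crossMean (response D) (pseudo D) j) g := by
  have hC : principal m.active (sampleCov (pseudo D))
      = sampleCov (fun i (j : {j // j ∈ m.active}) => pseudo D i j) := by
    ext j k
    simp only [principal, Matrix.submatrix_apply, sampleCov_apply]
    rfl
  rw [IsHyp, isLasso_iff_isQuadMin h.n_ne_zero _ _ _ (sum_response D h.size), hC]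
  rfl

theorem exists_isHyp (h : GoodData m D S ε τ) (hl : 0 < lam) : ∃ g, IsHyp lam D m.active g :=
  exists_isLasso h.n_ne_zero hl _ _ (sum_response D h.size)

theorem exists_isSSDA (h : GoodData m D S ε τ) (hl : 0 < lam) : ∃ b, IsSSDA lam D b :=
  exists_isLasso h.n_ne_zero hl _ _ (sum_response D h.size)

/-- Entrywise errors of at most ε/(2s) are summed over the s active columns; this is where the
argument ε/s of ζ₂ comes from. -/
theorem row_sum_le (h : GoodData m D S ε τ) (hs : 0 < m.s) {j : Fin p} (hj : j ∈ S) :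
    ∑ k : {k // k ∈ m.active}, |sampleCov (pseudo D) j k - m.omega j k| ≤ ε / 2 := by
  calc _ ≤ ∑ k : {k // k ∈ m.active}, ε / m.s / 2 :=
        Finset.sum_le_sum fun k _ => h.cov j hj k k.2
    _ = ε / 2 := by
        have : (m.s : ℝ) ≠ 0 := by exact_mod_cast hs.ne'
        simp only [Finset.sum_const, Finset.card_univ, Fintype.card_coe, nsmul_eq_mul]
        change (m.s : ℝ) * _ = _
        field_simp

theorem kkt (h : GoodData m D S ε τ) (hl : 0 < lam) {g : {j // j ∈ m.active} → ℝ}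
    (hg : IsHyp lam D m.active g) (j : {j // j ∈ m.active}) :
    |(principal m.active (sampleCov (pseudo D)) *ᵥ g) j
      - crossMean (response D) (pseudo D) j| ≤ lam / 2 := by
  have := (((h.isHyp_iff g).1 hg).kkt hl.le
    ((sampleCov_posSemidef (pseudo D)).isHermitian.submatrix _) j).1
  rw [abs_mul, abs_of_pos (zero_lt_two' ℝ)] at this
  simp only [Pi.sub_apply] at this
  linarith

theorem vecInfNorm_hyp_le (h : GoodData m D S ε τ) (hΩ : m.omega.PosDef) (hs : 0 < m.s)
    (hS : m.active ⊆ S) (hl : 0 < lam) (hε : 0 ≤ ε) (hτ : 0 ≤ τ)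
    {g : {j // j ∈ m.active} → ℝ} (hg : IsHyp lam D m.active g) :
    vecInfNorm g ≤ m.phi * (lam / 2 + ε / 2 * vecInfNorm g + τ / 2 + m.Delta) :=
  vecInfNorm_le_of_kkt (P := m.omegaAA) (Q := principal m.active (sampleCov (pseudo D)))
    (m.isUnit_det_omegaAA hΩ) (fun j => h.row_sum_le hs (hS j.2)) (by linarith) (by linarith)
    (by linarith) (h.kkt hl hg) (fun j => h.mean j (hS j.2))

/-- Inserting ‖g‖ ≤ ‖β_A‖ + ‖g - β_A‖ and ‖β_A‖ ≤ φΔ leaves an inequality in the error alone. -/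
theorem vecInfNorm_hyp_sub_beta_le (h : GoodData m D S ε τ) (hΩ : m.omega.PosDef)
    (hs : 0 < m.s) (hS : m.active ⊆ S) (hl : 0 < lam) (hε : 0 ≤ ε) (hτ : 0 ≤ τ)
    {g : {j // j ∈ m.active} → ℝ} (hg : IsHyp lam D m.active g) :
    vecInfNorm (fun j : {j // j ∈ m.active} => g j - m.beta j) ≤ m.phi * (lam / 2
      + ε / 2 * (m.phi * m.Delta + vecInfNorm (fun j : {j // j ∈ m.active} => g j - m.beta j))
      + τ / 2) := by
  have h1 := vecInfNorm_sub_le_of_kkt (P := m.omegaAA)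
    (Q := principal m.active (sampleCov (pseudo D)))
    (m.isUnit_det_omegaAA hΩ) (fun j => h.row_sum_le hs (hS j.2)) (by linarith) (by linarith)
    (by linarith) (h.kkt hl hg) (fun j => h.mean j (hS j.2)) (m.omegaAA_mulVec_beta hΩ)
  have h2 : vecInfNorm g ≤ m.phi * m.Delta
      + vecInfNorm (fun j : {j // j ∈ m.active} => g j - m.beta j) := by
    refine vecInfNorm_le ?_ fun j => ?_
    · exact add_nonneg (mul_nonneg (matInfNorm_nonneg _) (vecInfNorm_nonneg _))
        (vecInfNorm_nonneg _)
    · have e1 := abs_le_vecInfNorm (fun j : {j // j ∈ m.active} => g j - m.beta j) j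
      have e2 := abs_le_vecInfNorm (fun j : {j // j ∈ m.active} => m.beta j) j
      have e3 := m.vecInfNorm_beta_le hΩ
      have e4 : |g j| ≤ |g j - m.beta j| + |m.beta j| := by
        simpa using abs_add_le (g j - m.beta j) (m.beta j)
      linarith
  refine h1.trans (mul_le_mul_of_nonneg_left ?_ (matInfNorm_nonneg _))
  have := mul_le_mul_of_nonneg_left h2 (show 0 ≤ ε / 2 by linarith)
  linarith

/-- Consistent selection: the estimate agrees with the hypothetical one. -/
theorem selection (h : GoodData m D Finset.univ ε
      (lam * (1 - m.kappa - 2 * ε * m.phi) / (4 * (1 + m.kappa))))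
    (hΩ : m.omega.PosDef) (hl : m.Admissible lam) (hκ : m.kappa < 1) (hε : 0 < ε)
    (hε' : ε < lam * (1 - m.kappa) / (4 * m.phi * (lam / 2 + (1 + m.kappa)) * m.Delta))
    {b : Fin p → ℝ} {g : {j // j ∈ m.active} → ℝ}
    (hb : IsSSDA lam D b) (hg : IsHyp lam D m.active g) :
    (∀ j : {j // j ∈ m.active}, b j = g j) ∧ ∀ j ∉ m.active, b j = 0 := by
  have hφ := hl.phi_pos
  have hΔ := hl.Delta_pos
  have hlΔ := hl.lt_Delta
  have hl0 := hl.pos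
  have hκ0 : 0 ≤ m.kappa := matInfNorm_nonneg _
  set φ := m.phi
  set Δ := m.Delta
  set κ := m.kappa with hκdef
  set t := lam * (1 - κ - 2 * ε * φ) / (4 * (1 + κ)) with ht
  rw [lt_div_iff₀ (by positivity)] at hε'
  have h1 : 4 * (ε * φ * Δ) * (1 + κ) < lam * (1 - κ) := by
    have : 0 < ε * φ * Δ * lam := by positivity
    nlinarith
  have h2 : 4 * (ε * φ) * (1 + κ) < 1 - κ := by
    have : lam * (1 - κ) < Δ * (1 - κ) := mul_lt_mul_of_pos_right hlΔ (by linarith)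
    by_contra! hc
    have := mul_le_mul_of_nonneg_left hc hΔ.le
    linarith
  have hεφ : 0 < ε * φ := by positivity
  have h3 : 4 * (ε * φ) < 1 - κ := by nlinarith
  have htm : (1 + κ) * t = lam * (1 - κ - 2 * ε * φ) / 4 := by rw [ht]; field_simp
  have ht0 : 0 ≤ t := by
    rw [ht]
    have : 0 < 1 - κ - 2 * ε * φ := by linarith
    positivity
  have ht1 : (1 + κ) * t ≤ lam * (1 - κ) / 4 := by
    rw [htm]
    have : 0 < lam * (ε * φ) := by positivity
    linarith
  have ht2 : t ≤ lam / 4 := by nlinarith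
  have hG0 := vecInfNorm_nonneg g
  have hG := h.vecInfNorm_hyp_le hΩ hl.s_pos (Finset.subset_univ _) hl0 hε.le ht0 hg
  set G := vecInfNorm g
  -- As εφ < 1/4, the term containing G is at most G/8. With λ < Δ and t ≤ λ/4 the rest is at most
  -- 13φΔ/8, so G ≤ 13φΔ/7.
  have hG2 : G ≤ 2 * (φ * Δ) := by
    have a1 : φ * (ε / 2 * G) ≤ G / 8 := by nlinarith
    have a2 : φ * (lam / 2 + t / 2 + Δ) ≤ φ * (Δ * (13 / 8)) :=
      mul_le_mul_of_nonneg_left (by linarith) hφ.le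
    have a3 : 0 < φ * Δ := by positivity
    linarith
  -- The part with t contributes at most λ(1 - κ)/8 and the part with G less than λ(1 - κ)/4. Twice
  -- the total is below λ(1 - κ), which is exactly the slack left by κλ.
  have hgrad : (1 + κ) * (t / 2 + ε / 2 * G) < 3 / 8 * (lam * (1 - κ)) := by
    have : (1 + κ) * (ε / 2 * G) ≤ (1 + κ) * (ε / 2 * (2 * (φ * Δ))) := by gcongr
    linarith
  have hl1 : 0 < lam * (1 - κ) := mul_pos hl0 (by linarith)
  rw [IsSSDA, isLasso_iff_isQuadMin h.n_ne_zero _ _ _ (sum_response D h.size)] at hb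
  refine ((h.isHyp_iff g).1 hg).extendZero_unique hl0.le (sampleCov_posSemidef _) ?_ ?_ hb
  · intro j hj
    have hjc : j ∈ m.activeᶜ := Finset.mem_compl.2 hj
    set γ : {k // k ∈ m.active} → ℝ := (m.omegaAcA * (m.omegaAA)⁻¹) ⟨j, hjc⟩ with hγ
    have hγP : (fun k : {k // k ∈ m.active} => m.omega j k) = γ ᵥ* m.omegaAA := by
      have : m.omegaAcA = m.omegaAcA * (m.omegaAA)⁻¹ * m.omegaAA := by
        rw [Matrix.mul_assoc, Matrix.nonsing_inv_mul _ (m.isUnit_det_omegaAA hΩ), Matrix.mul_one]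
      exact congrFun this ⟨j, hjc⟩
    -- As β vanishes off A, both sides are the row Ω_{jA} applied to β_A, so the excluded mean
    -- difference is the same γ-combination of the active ones.
    have hc : m.meanDiff j = γ ⬝ᵥ fun k : {k // k ∈ m.active} => m.meanDiff k := by
      rw [← m.omegaAA_mulVec_beta hΩ, Matrix.dotProduct_mulVec, ← hγP, ← m.sum_omega_mul_beta hΩ]
      rfl
    have hmain := abs_excluded_gradient_le (P := m.omegaAA)
      (Q := principal m.active (sampleCov (pseudo D))) (κ := κ) (l := lam / 2)
      (e := ε / 2) (τ := t / 2) (g := g) (γ := γ)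
      (r' := fun k : {k // k ∈ m.active} => sampleCov (pseudo D) j k)
      (by linarith) (by linarith) (by linarith)
      (row_sum_le_matInfNorm (m.omegaAcA * (m.omegaAA)⁻¹) ⟨j, hjc⟩)
      (h.row_sum_le hl.s_pos (Finset.mem_univ j)) hγP hc (h.mean j (Finset.mem_univ j))
      (fun j => h.row_sum_le hl.s_pos (Finset.mem_univ _)) (h.kkt hl0 hg)
      (fun j => h.mean j (Finset.mem_univ _))
    rw [abs_mul, abs_of_pos (zero_lt_two' ℝ)]
    refine (mul_le_mul_of_nonneg_left hmain zero_le_two).trans_lt ?_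
    nlinarith
  · intro v hv
    refine eq_zero_of_perturbation (P := m.omegaAA) (e := ε / 2) (m.isUnit_det_omegaAA hΩ)
      (fun j => h.row_sum_le hl.s_pos (Finset.mem_univ _)) (by linarith) ?_ hv
    change φ * (ε / 2) < 1
    linarith

/-- No coefficient of the hypothetical estimate vanishes. -/
theorem hyp_ne_zero (h : GoodData m D S ε ε) (hS : m.active ⊆ S)
    (hΩ : m.omega.PosDef) (hl : m.Admissible lam) (hε : 0 < ε)
    (hε' : ε < min (m.nu / ((3 + m.nu) * m.phi)) (m.Delta * m.nu / (6 + 2 * m.nu)))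
    {g : {j // j ∈ m.active} → ℝ} (hg : IsHyp lam D m.active g) (j : {j // j ∈ m.active}) :
    g j ≠ 0 := by
  have hφ := hl.phi_pos
  have hΔ := hl.Delta_pos
  have hl0 := hl.pos
  have hlb := hl.lt_betaMin
  have hb0 : 0 < m.betaMin := lt_trans (by positivity) hlb
  have hν : m.nu * (m.Delta * m.phi) = m.betaMin := by
    rw [SeLDAModel.nu]; field_simp
  have hν0 : 0 < m.nu := by rw [SeLDAModel.nu]; positivity
  obtain ⟨h1, h2⟩ := lt_min_iff.1 hε'
  rw [lt_div_iff₀ (by positivity)] at h1 h2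
  have hW := h.vecInfNorm_hyp_sub_beta_le hΩ hl.s_pos hS hl0 hε.le hε.le hg
  have hj := abs_le_vecInfNorm (fun j : {j // j ∈ m.active} => g j - m.beta j) j
  have hbj := m.betaMin_le j
  intro hgj
  simp only [hgj, zero_sub, abs_neg] at hj
  set W := vecInfNorm (fun j : {j // j ∈ m.active} => g j - m.beta j)
  set φ := m.phi
  set Δ := m.Delta
  set ν := m.nu
  set b := m.betaMin
  -- A zero coefficient makes the error at least the smallest |β_j|. The two upper bounds on ε
  -- become `e1` and `e2`; with φλ < b/2 they make the upper bound for W too small.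
  have hbW : b ≤ W := hbj.trans hj
  have hy : 0 < ε * φ := by positivity
  have hF : 0 < φ * Δ := by positivity
  have e1 : ε * φ * (φ * Δ) * 3 + ε * φ * b < b := by
    have := mul_lt_mul_of_pos_right h1 hF
    rw [← hν]
    linarith
  have e2 : ε * φ * 6 < b := by
    have := mul_lt_mul_of_pos_right h2 hφ
    have h3 : 0 < ε * φ * ν := by positivity
    rw [← hν]
    linarith
  have e3 : ε * φ < 1 := by
    have : 0 < ε * φ * (φ * Δ) := by positivity
    by_contra! hc
    nlinarith
  have e4 : b * (1 - ε * φ / 2) ≤ W * (1 - ε * φ / 2) :=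
    mul_le_mul_of_nonneg_right hbW (by linarith)
  have e5 : ε * φ * b < b := by nlinarith
  linarith

/-- The estimation error of the hypothetical estimate. -/
theorem hyp_error (h : GoodData m D S ε ε) (hS : m.active ⊆ S)
    (hΩ : m.omega.PosDef) (hl : m.Admissible lam) (hε : 0 < ε)
    (hε' : ε < min (lam / (2 * m.phi * m.Delta)) lam)
    {g : {j // j ∈ m.active} → ℝ} (hg : IsHyp lam D m.active g) :
    vecInfNorm (fun j : {j // j ∈ m.active} => g j - m.beta j) ≤ 4 * m.phi * lam := by
  have hφ := hl.phi_pos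
  have hΔ := hl.Delta_pos
  have hl0 := hl.pos
  have hlΔ := hl.lt_Delta
  obtain ⟨h1, h2⟩ := lt_min_iff.1 hε'
  rw [lt_div_iff₀ (by positivity)] at h1
  have hW := h.vecInfNorm_hyp_sub_beta_le hΩ hl.s_pos hS hl0 hε.le hε.le hg
  have hW0 := vecInfNorm_nonneg (fun j : {j // j ∈ m.active} => g j - m.beta j)
  set W := vecInfNorm (fun j : {j // j ∈ m.active} => g j - m.beta j)
  set φ := m.phi
  set Δ := m.Delta
  -- Follows from 2εφΔ < λ < Δ. The error then absorbs a quarter of itself, and the remaining terms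
  -- give 5φλ/3, within the stated constant 4.
  have e1 : ε * φ < 1 / 2 := by
    by_contra! hc
    have := mul_le_mul_of_nonneg_right hc hΔ.le
    linarith
  have e2 : φ * (ε / 2 * W) ≤ W / 4 := by nlinarith
  have e3 : φ * (ε / 2 * (φ * Δ)) ≤ φ * (lam / 4) := mul_le_mul_of_nonneg_left (by linarith) hφ.le
  have e4 : φ * (ε / 2) ≤ φ * (lam / 2) := mul_le_mul_of_nonneg_left (by linarith) hφ.le
  have e5 : 0 < φ * lam := by positivity
  linarith

end GoodData

end Selection

/-! ### Normal quantiles, tails, clipping and change of mean -/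

section Gaussian

open Set Filter Topology

/-- The standard normal distribution function. -/
noncomputable def stdCDF (x : ℝ) : ℝ := cdf (gaussianReal 0 1) x

theorem stdCDF_eq (x : ℝ) : stdCDF x = (gaussianReal 0 1).real (Iic x) := cdf_eq_real _ x

theorem stdCDF_strictMono : StrictMono stdCDF := by
  intro x y hxy
  have h1 : (gaussianReal 0 1).real (Iic y)
      = (gaussianReal 0 1).real (Iic x) + (gaussianReal 0 1).real (Ioc x y) := by
    rw [← measureReal_union (by
      rw [Set.disjoint_left]
      intro z hz hz'
      exact absurd hz'.1 (not_lt.2 hz)) measurableSet_Ioc, Iic_union_Ioc_eq_Iic hxy.le]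
  have h2 : gaussianReal 0 1 (Ioc x y) ≠ 0 := by
    intro h
    have := gaussianReal_absolutelyContinuous' 0 one_ne_zero h
    rw [Real.volume_Ioc, ENNReal.ofReal_eq_zero] at this
    linarith
  have h3 : 0 < (gaussianReal 0 1).real (Ioc x y) :=
    ENNReal.toReal_pos h2 (measure_ne_top _ _)
  rw [stdCDF_eq, stdCDF_eq, h1]
  linarith

theorem stdCDF_continuous : Continuous stdCDF := by
  rw [continuous_iff_continuousAt]
  intro a
  have hm : Monotone (cdf (gaussianReal 0 1)) := monotone_cdf _
  change ContinuousAt (cdf (gaussianReal 0 1)) a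
  rw [hm.continuousAt_iff_leftLim_eq_rightLim, StieltjesFunction.rightLim_eq]
  have h := (cdf (gaussianReal 0 1)).measure_singleton a
  have hz : gaussianReal 0 1 {a} = 0 := by
    have := nullSingletonClass_gaussianReal (μ := 0) one_ne_zero
    exact measure_singleton a
  rw [measure_cdf, hz] at h
  have := ENNReal.ofReal_eq_zero.1 h.symm
  exact le_antisymm (hm.leftLim_le le_rfl) (by linarith)

theorem stdCDF_pos (x : ℝ) : 0 < stdCDF x :=
  (cdf_nonneg (gaussianReal 0 1) (x - 1)).trans_lt (stdCDF_strictMono (by linarith))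

theorem stdCDF_lt_one (x : ℝ) : stdCDF x < 1 :=
  (stdCDF_strictMono (show x < x + 1 by linarith)).trans_le (cdf_le_one (gaussianReal 0 1) (x + 1))

theorem exists_stdCDF_eq {u : ℝ} (h0 : 0 < u) (h1 : u < 1) : ∃ r, stdCDF r = u := by
  obtain ⟨a, ha⟩ := ((tendsto_cdf_atBot (gaussianReal 0 1)).eventually (gt_mem_nhds h0)).exists
  obtain ⟨b, hb⟩ := ((tendsto_cdf_atTop (gaussianReal 0 1)).eventually (lt_mem_nhds h1)).exists
  exact mem_range_of_exists_le_of_exists_ge stdCDF_continuous ⟨a, ha.le⟩ ⟨b, hb.le⟩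

theorem stdCDF_probit {u : ℝ} (h0 : 0 < u) (h1 : u < 1) : stdCDF (probit u) = u := by
  obtain ⟨r, hr⟩ := exists_stdCDF_eq h0 h1
  have : {x : ℝ | u ≤ cdf (gaussianReal 0 1) x} = Ici r := by
    ext x
    rw [mem_ofPred_eq, mem_Ici, ← hr]
    exact stdCDF_strictMono.le_iff_le
  rw [probit, this, csInf_Ici, hr]

/-- The probability integral transform. The endpoints are separate because Φ takes neither value 0
nor 1. -/
theorem gaussianReal_stdCDF_le {b : ℝ} (h0 : 0 ≤ b) (h1 : b ≤ 1) :
    (gaussianReal 0 1).real {x | stdCDF x ≤ b} = b := by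
  rcases h0.eq_or_lt with rfl | h0
  · have : {x | stdCDF x ≤ 0} = ∅ := by
      ext x; simpa using stdCDF_pos x
    simp [this]
  rcases h1.eq_or_lt with rfl | h1
  · have : {x | stdCDF x ≤ 1} = univ := by
      ext x; simpa using (stdCDF_lt_one x).le
    simp [this]
  · obtain ⟨r, hr⟩ := exists_stdCDF_eq h0 h1
    have : {x | stdCDF x ≤ b} = Iic r := by
      ext x
      rw [mem_ofPred_eq, mem_Iic, ← hr, stdCDF_strictMono.le_iff_le]
    rw [this, ← stdCDF_eq, hr]

theorem measurableSet_stdCDF_le (b : ℝ) : MeasurableSet {x | stdCDF x ≤ b} :=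
  measurableSet_le stdCDF_continuous.measurable measurable_const

theorem stdCDF_neg_le {M : ℝ} (hM : 0 ≤ M) : stdCDF (-M) ≤ Real.exp (-M ^ 2 / 2) := by
  have h := measure_le_le_exp_mul_mgf (μ := gaussianReal 0 1) (X := id) (t := -M) (-M)
    (by linarith) (integrable_exp_mul_gaussianReal _)
  rw [mgf_id_gaussianReal, ← Real.exp_add] at h
  rw [stdCDF_eq]
  refine h.trans (Real.exp_le_exp.2 ?_)
  simp only [NNReal.coe_one]
  nlinarith

theorem one_sub_stdCDF_le {M : ℝ} (hM : 0 ≤ M) : 1 - stdCDF M ≤ Real.exp (-M ^ 2 / 2) := by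
  have h := measure_ge_le_exp_mul_mgf (μ := gaussianReal 0 1) (X := id) (t := M) M
    hM (integrable_exp_mul_gaussianReal _)
  rw [mgf_id_gaussianReal, ← Real.exp_add] at h
  rw [stdCDF_eq, ← probReal_compl_eq_one_sub measurableSet_Iic]
  refine (measureReal_mono ?_).trans (h.trans (Real.exp_le_exp.2 ?_))
  · intro x hx
    simp only [mem_compl_iff, mem_Iic, not_le] at hx
    exact hx.le
  · simp only [NNReal.coe_one]
    nlinarith

/-- Chernoff bounds put Φ(-M) below a and Φ(M) above 1 - a, so a Winsorized level has its quantile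
in [-M, M]. -/
theorem abs_probit_le {M a u : ℝ} (hM : 0 ≤ M) (hMa : Real.exp (-M ^ 2 / 2) < a)
    (hu : a ≤ u) (hu' : u ≤ 1 - a) : |probit u| ≤ M := by
  have ha : 0 < a := (Real.exp_pos _).trans hMa
  have h := stdCDF_probit (u := u) (by linarith) (by linarith)
  have h1 := stdCDF_neg_le hM
  have h2 := one_sub_stdCDF_le hM
  rw [abs_le]
  constructor
  · rw [← stdCDF_strictMono.le_iff_le, h]; linarith
  · rw [← stdCDF_strictMono.le_iff_le, h]; linarith

/-- An upper bound for the exponential tail moments of `N(μ, 1)`, `|μ| ≤ B`, beyond `M`. -/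
noncomputable def gaussTail (B M : ℝ) : ℝ := 2 * Real.exp (-M ^ 2 / 2 + (B + 1) * M + B + 1 / 2)

theorem gaussTail_pos (B M : ℝ) : 0 < gaussTail B M := by unfold gaussTail; positivity

variable {μ B M : ℝ}

/-- Beyond M one has M(|x| - M) ≥ 0, that is |x| ≤ -M² + (M+1)|x|. The tail moment thus reduces to
moment generating functions at ±(M+1). -/
theorem indicator_exp_abs_le (hM : 0 ≤ M) (x : ℝ) :
    ({x : ℝ | M < |x|}.indicator (fun x => Real.exp |x|) x)
      ≤ Real.exp (-M ^ 2) * (Real.exp ((M + 1) * x) + Real.exp (-(M + 1) * x)) := by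
  by_cases hx : M < |x|
  · rw [indicator_of_mem (show x ∈ {x : ℝ | M < |x|} from hx), mul_add, ← Real.exp_add,
      ← Real.exp_add]
    rcases abs_cases x with ⟨h, _⟩ | ⟨h, _⟩
    · rw [h] at hx ⊢
      have : Real.exp x ≤ Real.exp (-M ^ 2 + (M + 1) * x) := Real.exp_le_exp.2 (by nlinarith)
      have := Real.exp_pos (-M ^ 2 + -(M + 1) * x)
      linarith
    · rw [h] at hx ⊢
      have : Real.exp (-x) ≤ Real.exp (-M ^ 2 + -(M + 1) * x) :=
        Real.exp_le_exp.2 (by nlinarith)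
      have := Real.exp_pos (-M ^ 2 + (M + 1) * x)
      linarith
  · rw [indicator_of_notMem (show x ∉ {x : ℝ | M < |x|} from hx)]
    positivity

theorem measurableSet_lt_abs (M : ℝ) : MeasurableSet {x : ℝ | M < |x|} :=
  measurableSet_lt measurable_const measurable_id.abs

theorem integrable_indicator_exp_abs (μ : ℝ) (hM : 0 ≤ M) :
    Integrable ({x : ℝ | M < |x|}.indicator fun x => Real.exp |x|) (gaussianReal μ 1) := by
  refine (((integrable_exp_mul_gaussianReal (M + 1)).add
    (integrable_exp_mul_gaussianReal (-(M + 1)))).const_mul (Real.exp (-M ^ 2))).mono'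
    ((by fun_prop : Measurable fun x : ℝ => Real.exp |x|).indicator
      (measurableSet_lt_abs M)).aestronglyMeasurable (Eventually.of_forall fun x => ?_)
  rw [Real.norm_of_nonneg (indicator_nonneg (fun _ _ => (Real.exp_pos _).le) _)]
  exact indicator_exp_abs_le hM x

theorem integral_indicator_exp_abs_le (hM : 0 ≤ M) (hμ : |μ| ≤ B) :
    ∫ x, ({x : ℝ | M < |x|}.indicator (fun x => Real.exp |x|) x) ∂gaussianReal μ 1
      ≤ gaussTail B M := by
  have i1 := integrable_exp_mul_gaussianReal (μ := μ) (v := 1) (M + 1)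
  have i2 := integrable_exp_mul_gaussianReal (μ := μ) (v := 1) (-(M + 1))
  have m : ∀ t, ∫ x, Real.exp (t * x) ∂gaussianReal μ 1 = Real.exp (μ * t + t ^ 2 / 2) := by
    intro t
    have := congrFun (mgf_id_gaussianReal (μ := μ) (v := 1)) t
    simpa [mgf] using this
  refine (integral_mono (integrable_indicator_exp_abs μ hM) ((i1.add i2).const_mul _)
    (indicator_exp_abs_le hM)).trans ?_
  simp only [Pi.add_apply]
  rw [integral_const_mul, integral_add i1 i2, m, m, mul_add, ← Real.exp_add, ← Real.exp_add,
    gaussTail, two_mul]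
  rw [abs_le] at hμ
  refine add_le_add (Real.exp_le_exp.2 ?_) (Real.exp_le_exp.2 ?_) <;> nlinarith

theorem tail_integral_bound (hM : 0 ≤ M) (hμ : |μ| ≤ B) {f : ℝ → ℝ} (hf : Measurable f) {c : ℝ}
    (hc : 0 ≤ c) (h : ∀ x, |f x| ≤ c * ({x : ℝ | M < |x|}.indicator (fun x => Real.exp |x|) x)) :
    Integrable f (gaussianReal μ 1) ∧ |∫ x, f x ∂gaussianReal μ 1| ≤ c * gaussTail B M := by
  have hi := (integrable_indicator_exp_abs μ hM).const_mul c
  refine ⟨hi.mono' hf.aestronglyMeasurable (Eventually.of_forall h), ?_⟩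
  have := norm_integral_le_of_norm_le (f := f) hi (Eventually.of_forall h)
  rw [integral_const_mul] at this
  exact this.trans (mul_le_mul_of_nonneg_left (integral_indicator_exp_abs_le hM hμ) hc)

theorem gaussianReal_tail_le (hM : 0 ≤ M) (hμ : |μ| ≤ B) :
    (gaussianReal μ 1).real {x | M < |x|} ≤ gaussTail B M := by
  have h := (tail_integral_bound (f := {x : ℝ | M < |x|}.indicator 1) (c := 1) hM hμ
    (measurable_one.indicator (measurableSet_lt_abs M)) zero_le_one fun x => ?_).2
  · rw [integral_indicator_one (measurableSet_lt_abs M), one_mul] at h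
    exact (le_abs_self _).trans h
  · by_cases hx : x ∈ {x : ℝ | M < |x|}
    · simp [indicator_of_mem hx]
    · simp [indicator_of_notMem hx]

/-- Truncation of a real number to `[-M, M]`. -/
noncomputable def clip (M x : ℝ) : ℝ := max (-M) (min M x)

theorem measurable_clip (M : ℝ) : Measurable (clip M) := by unfold clip; fun_prop

theorem abs_clip_le (hM : 0 ≤ M) (x : ℝ) : |clip M x| ≤ M := by
  rw [clip, abs_le]
  exact ⟨le_max_left _ _, max_le (by linarith) (min_le_left _ _)⟩

theorem abs_clip_sub_le (hM : 0 ≤ M) (x : ℝ) :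
    |clip M x - x| ≤ {x : ℝ | M < |x|}.indicator (fun x => |x|) x := by
  by_cases hx : M < |x|
  · rw [indicator_of_mem (show x ∈ {x : ℝ | M < |x|} from hx), clip]
    rcases abs_cases x with ⟨h, h'⟩ | ⟨h, h'⟩
    · rw [h] at hx ⊢
      rw [min_eq_left hx.le, max_eq_right (by linarith), abs_le]
      constructor <;> linarith
    · rw [h] at hx ⊢
      rw [min_eq_right (by linarith), max_eq_left (by linarith), abs_le]
      constructor <;> linarith
  · rw [indicator_of_notMem (show x ∉ {x : ℝ | M < |x|} from hx), clip]
    rw [not_lt, abs_le] at hx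
    rw [min_eq_right hx.2, max_eq_right hx.1, sub_self, abs_zero]

theorem abs_clip_sub_le_exp (hM : 0 ≤ M) (x : ℝ) :
    |clip M x - x| ≤ {x : ℝ | M < |x|}.indicator (fun x => Real.exp |x|) x :=
  (abs_clip_sub_le hM x).trans (indicator_le_indicator (by linarith [Real.add_one_le_exp |x|]))

theorem integrable_clip (μ : ℝ) (hM : 0 ≤ M) : Integrable (clip M) (gaussianReal μ 1) :=
  (integrable_const M).mono' (measurable_clip M).aestronglyMeasurable
    (Eventually.of_forall (abs_clip_le hM))

theorem abs_integral_clip_sub_le (hM : 0 ≤ M) (hμ : |μ| ≤ B) :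
    |∫ x, clip M x ∂gaussianReal μ 1 - μ| ≤ gaussTail B M := by
  obtain ⟨h1, h2⟩ := tail_integral_bound (f := fun x => clip M x - x) (c := 1) hM hμ
    ((measurable_clip M).sub measurable_id) zero_le_one
    (fun x => by rw [one_mul]; exact abs_clip_sub_le_exp hM x)
  have h3 : ∫ x, (clip M x - (clip M x - x)) ∂gaussianReal μ 1
      = ∫ x, clip M x ∂gaussianReal μ 1 - ∫ x, (clip M x - x) ∂gaussianReal μ 1 :=
    integral_sub (integrable_clip μ hM) h1
  have h4 : ∫ x, (clip M x - (clip M x - x)) ∂gaussianReal μ 1 = μ := by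
    simp only [sub_sub_cancel]
    exact integral_id_gaussianReal
  have h5 : ∫ x, clip M x ∂gaussianReal μ 1 - μ = ∫ x, (clip M x - x) ∂gaussianReal μ 1 := by
    linarith
  rw [h5]
  simpa using h2

/-- The likelihood ratio of N(μ, 1) to N(0, 1) is e^{μx - μ²/2}, at most e^{BM} where |x| ≤ M. -/
theorem gaussianReal_inter_le (hB : 0 ≤ B) (hμ : |μ| ≤ B) {S : Set ℝ}
    (hSM : ∀ x ∈ S, |x| ≤ M) :
    (gaussianReal μ 1).real S ≤ Real.exp (B * M) * (gaussianReal 0 1).real S := by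
  have h : gaussianReal μ 1 S ≤ ENNReal.ofReal (Real.exp (B * M)) * gaussianReal 0 1 S := by
    rw [gaussianReal_apply _ one_ne_zero, gaussianReal_apply _ one_ne_zero,
      ← lintegral_const_mul _ (measurable_gaussianPDF 0 1)]
    refine setLIntegral_mono ((measurable_gaussianPDF 0 1).const_mul _) fun x hx => ?_
    rw [gaussianPDF, gaussianPDF, ← ENNReal.ofReal_mul (Real.exp_pos _).le]
    refine ENNReal.ofReal_le_ofReal ?_
    simp only [gaussianPDFReal, NNReal.coe_one]
    rw [mul_left_comm, ← Real.exp_add]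
    refine mul_le_mul_of_nonneg_left (Real.exp_le_exp.2 ?_) (by positivity)
    have h1 : μ * x ≤ B * M := by
      calc μ * x ≤ |μ * x| := le_abs_self _
        _ = |μ| * |x| := abs_mul _ _
        _ ≤ B * M := mul_le_mul hμ (hSM x hx) (abs_nonneg _) hB
    nlinarith [sq_nonneg μ]
  have h2 := ENNReal.toReal_mono
    (ENNReal.mul_ne_top ENNReal.ofReal_ne_top (measure_ne_top _ _)) h
  rwa [ENNReal.toReal_mul, ENNReal.toReal_ofReal (Real.exp_pos _).le] at h2

/-- The distribution function of `Φ(U)` when `U` is `N(μ, 1)`. -/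
noncomputable def scoreCDF (μ v : ℝ) : ℝ := (gaussianReal μ 1).real {x | stdCDF x ≤ v}

theorem scoreCDF_zero {v : ℝ} (h0 : 0 ≤ v) (h1 : v ≤ 1) : scoreCDF 0 v = v :=
  gaussianReal_stdCDF_le h0 h1

theorem scoreCDF_one (μ : ℝ) : scoreCDF μ 1 = 1 := by
  have : {x | stdCDF x ≤ 1} = univ := by
    ext x; simpa using (stdCDF_lt_one x).le
  simp [scoreCDF, this]

/-- A modulus of continuity for the class with nonzero mean: inside [-M, M] change the mean to 0,
where Φ(U) is uniform; outside use the tail bound. -/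
theorem scoreCDF_sub_le (hM : 0 ≤ M) (hB : 0 ≤ B) (hμ : |μ| ≤ B) {a b : ℝ} (ha : 0 ≤ a)
    (hab : a ≤ b) (hb : b ≤ 1) :
    scoreCDF μ b - scoreCDF μ a ≤ Real.exp (B * M) * (b - a) + gaussTail B M := by
  set S : Set ℝ := {x | stdCDF x ≤ b} \ {x | stdCDF x ≤ a} with hS
  have hsub : {x | stdCDF x ≤ a} ⊆ {x | stdCDF x ≤ b} := fun x hx => le_trans hx hab
  have hdiff : ∀ ν : ℝ, (gaussianReal ν 1).real S = scoreCDF ν b - scoreCDF ν a := fun ν =>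
    measureReal_sdiff hsub (measurableSet_stdCDF_le a)
  rw [← hdiff]
  have h0 : (gaussianReal 0 1).real S = b - a := by
    rw [hdiff, scoreCDF_zero (ha.trans hab) hb, scoreCDF_zero ha (hab.trans hb)]
  have h1 : (gaussianReal μ 1).real (S ∩ {x | |x| ≤ M}) ≤ Real.exp (B * M) * (b - a) := by
    rw [← h0]
    refine (gaussianReal_inter_le hB hμ fun x hx => hx.2).trans ?_
    exact mul_le_mul_of_nonneg_left (measureReal_mono inter_subset_left) (Real.exp_pos _).le
  have h2 : S ⊆ (S ∩ {x | |x| ≤ M}) ∪ {x | M < |x|} := by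
    intro x hx
    rcases le_or_gt |x| M with h | h
    · exact Or.inl ⟨hx, h⟩
    · exact Or.inr h
  calc (gaussianReal μ 1).real S
      ≤ (gaussianReal μ 1).real ((S ∩ {x | |x| ≤ M}) ∪ {x | M < |x|}) := measureReal_mono h2
    _ ≤ _ := measureReal_union_le _ _
    _ ≤ _ := add_le_add h1 (gaussianReal_tail_le hM hμ)

/-- Summed distances between points of `[-M, M]` are controlled by the number of pairs that any
level separates. -/
theorem sum_abs_sub_le_of_separated {ι : Type*} (I : Finset ι) {a b : ι → ℝ} {K : ℝ} (hM : 0 ≤ M)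
    (ha : ∀ i ∈ I, |a i| ≤ M) (hb : ∀ i ∈ I, |b i| ≤ M)
    (hK : ∀ s, -M ≤ s → s < M →
      (∑ i ∈ I, if min (a i) (b i) ≤ s ∧ s < max (a i) (b i) then (1 : ℝ) else 0) ≤ K) :
    ∑ i ∈ I, |a i - b i| ≤ 2 * M * K := by
  have hi : ∀ i ∈ I, IntegrableOn
      ((Ico (min (a i) (b i)) (max (a i) (b i))).indicator (1 : ℝ → ℝ)) (Ico (-M) M) volume :=
    fun i _ => (integrableOn_const (by simp)).integrable.indicator measurableSet_Ico
  -- A distance is the length of the set of levels separating its endpoints. Summing before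
  -- integrating leaves, at each level, the number of separated pairs.
  have h1 : ∀ i ∈ I, |a i - b i| = ∫ s in Ico (-M) M,
      (Ico (min (a i) (b i)) (max (a i) (b i))).indicator (1 : ℝ → ℝ) s := by
    intro i hiI
    have hai := abs_le.1 (ha i hiI)
    have hbi := abs_le.1 (hb i hiI)
    rw [setIntegral_indicator measurableSet_Ico]
    have : Ico (-M) M ∩ Ico (min (a i) (b i)) (max (a i) (b i))
        = Ico (min (a i) (b i)) (max (a i) (b i)) :=
      inter_eq_right.2 (Ico_subset_Ico (le_min hai.1 hbi.1) (max_le hai.2 hbi.2))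
    rw [this]
    simp [max_sub_min_eq_abs']
  rw [Finset.sum_congr rfl h1, ← integral_finsetSum I hi]
  calc _ ≤ ∫ s in Ico (-M) M, K := by
        refine setIntegral_mono_on (integrable_finsetSum I hi) (integrableOn_const (by simp))
          measurableSet_Ico fun s hs => ?_
        refine le_trans (le_of_eq ?_) (hK s hs.1 hs.2)
        exact Finset.sum_congr rfl fun i _ => by simp [indicator, mem_Ico]
    _ = 2 * M * K := by
        rw [setIntegral_const, Real.volume_real_Ico_of_le (by linarith), smul_eq_mul]
        ring

end Gaussian

/-! ### From empirical frequencies on a grid to normal scores -/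

section Empirical

/-- The average of `n` numbers. -/
noncomputable def empMean {n : ℕ} (f : Fin n → ℝ) : ℝ := (n : ℝ)⁻¹ * ∑ i, f i

/-- The probability of the class `y` when that of the class `+1` is `q`. -/
def classProb (q : ℝ) (y : Bool) : ℝ := if y = true then q else 1 - q

theorem empMean_mono {n : ℕ} {f g : Fin n → ℝ} (h : ∀ i, f i ≤ g i) : empMean f ≤ empMean g :=
  mul_le_mul_of_nonneg_left (Finset.sum_le_sum fun i _ => h i) (by positivity)

theorem empMean_sub {n : ℕ} (f g : Fin n → ℝ) :
    empMean (fun i => f i - g i) = empMean f - empMean g := by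
  simp only [empMean, Finset.sum_sub_distrib, mul_sub]

theorem empMean_add {n : ℕ} (f g : Fin n → ℝ) :
    empMean (fun i => f i + g i) = empMean f + empMean g := by
  simp only [empMean, Finset.sum_add_distrib, mul_add]

theorem empMean_mul_left {n : ℕ} (c : ℝ) (f : Fin n → ℝ) :
    empMean (fun i => c * f i) = c * empMean f := by
  simp only [empMean, ← Finset.mul_sum]
  ring

theorem abs_empMean_le {n : ℕ} (f : Fin n → ℝ) : |empMean f| ≤ empMean fun i => |f i| := by
  rw [empMean, abs_mul, abs_of_nonneg (by positivity : (0 : ℝ) ≤ (n : ℝ)⁻¹)]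
  exact mul_le_mul_of_nonneg_left (Finset.abs_sum_le_sum_abs _ _) (by positivity)

theorem empMean_nonneg {n : ℕ} {f : Fin n → ℝ} (h : ∀ i, 0 ≤ f i) : 0 ≤ empMean f :=
  mul_nonneg (by positivity) (Finset.sum_nonneg fun i _ => h i)

/-- Relations between the sample size `n`, the grid size `N`, the truncation level `M` and the
deviation `D`. -/
structure Tuning (n N : ℕ) (q₀ q B M D : ℝ) : Prop where
  q₀_pos : 0 < q₀
  q₀_le : q₀ ≤ q
  q₀_le' : q₀ ≤ 1 - q
  B_nonneg : 0 ≤ B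
  M_nonneg : 0 ≤ M
  D_pos : 0 < D
  D_le : D ≤ q₀ / 4
  n_pos : 0 < n
  N_pos : 0 < N
  N_inv_le : 1 / (N : ℝ) ≤ D
  n_inv_le : 2 / (q₀ * n) ^ 2 ≤ D
  exp_lt : Real.exp (-M ^ 2 / 2) < 1 / (n : ℝ) ^ 2

/-- The empirical frequencies of one coordinate are within `D` of their expectations on a grid, and
the truncated class means are within `M D`. -/
structure CoordGood {n : ℕ} (Y : Fin n → Bool) (U : Fin n → ℝ) (q : ℝ) (μ : Bool → ℝ) (M D : ℝ)
    (N : ℕ) : Prop where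
  grid : ∀ y, ∀ k ≤ N,
    |empMean (fun i => if Y i = y ∧ stdCDF (U i) ≤ (k : ℝ) / N then (1 : ℝ) else 0)
      - classProb q y * scoreCDF (μ y) ((k : ℝ) / N)| ≤ D
  trunc : ∀ y, |empMean (fun i => if Y i = y then clip M (U i) else 0)
    - classProb q y * ∫ x, clip M x ∂gaussianReal (μ y) 1| ≤ M * D

/-- The relative frequency of a class. -/
noncomputable def classFreq {n : ℕ} (Y : Fin n → Bool) (y : Bool) : ℝ :=
  empMean fun i => if Y i = y then (1 : ℝ) else 0

/-- The number of observations in a class. -/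
def classCount {n : ℕ} (Y : Fin n → Bool) (y : Bool) : ℕ :=
  (Finset.univ.filter fun i => Y i = y).card

/-- The empirical distribution function of the class `+1`, evaluated at the sample. -/
noncomputable def rankCDF {n : ℕ} (Y : Fin n → Bool) (U : Fin n → ℝ) (i : Fin n) : ℝ :=
  (∑ k, if Y k = true ∧ U k ≤ U i then (1 : ℝ) else 0) / classCount Y true

/-- The normal scores based on the Winsorized empirical distribution function. -/
noncomputable def normalScore {n : ℕ} (Y : Fin n → Bool) (U : Fin n → ℝ) (i : Fin n) : ℝ :=
  probit (winsorize (1 / (classCount Y true : ℝ) ^ 2) (1 - 1 / (classCount Y true : ℝ) ^ 2)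
    (rankCDF Y U i))

theorem winsorize_spec {a u : ℝ} (ha : 0 ≤ a) (ha' : a ≤ 1 / 2) (hu : 0 ≤ u) (hu' : u ≤ 1) :
    a ≤ winsorize a (1 - a) u ∧ winsorize a (1 - a) u ≤ 1 - a
      ∧ |winsorize a (1 - a) u - u| ≤ a := by
  unfold winsorize
  split_ifs with h1 h2
  · refine ⟨by linarith, le_rfl, abs_le.2 ⟨?_, ?_⟩⟩ <;> linarith
  · refine ⟨le_rfl, by linarith, abs_le.2 ⟨?_, ?_⟩⟩ <;> linarith
  · refine ⟨by linarith, by linarith, by simpa using ha⟩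

theorem classFreq_eq_div {n : ℕ} (Y : Fin n → Bool) (y : Bool) :
    classFreq Y y = classCount Y y / n := by
  simp [classFreq, empMean, classCount, div_eq_inv_mul]

theorem classCount_le {n : ℕ} (Y : Fin n → Bool) (y : Bool) : classCount Y y ≤ n := by
  simpa [classCount] using Finset.card_filter_le (Finset.univ : Finset (Fin n)) fun i => Y i = y

namespace Tuning

variable {n N : ℕ} {q₀ q B M D : ℝ}

theorem q₀_le_half (t : Tuning n N q₀ q B M D) : q₀ ≤ 1 / 2 := by linarith [t.q₀_le, t.q₀_le']

theorem q₀_le_classProb (t : Tuning n N q₀ q B M D) (y : Bool) : q₀ ≤ classProb q y := by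
  cases y
  · simpa [classProb] using t.q₀_le'
  · simpa [classProb] using t.q₀_le

theorem classProb_le_one (t : Tuning n N q₀ q B M D) (y : Bool) : classProb q y ≤ 1 := by
  have := t.q₀_pos
  cases y
  · simp only [classProb, Bool.false_eq_true, if_false]; linarith [t.q₀_le]
  · simp only [classProb, if_true]; linarith [t.q₀_le']

theorem n_ne_zero (t : Tuning n N q₀ q B M D) : (n : ℝ) ≠ 0 := by exact_mod_cast t.n_pos.ne'

end Tuning

namespace CoordGood

variable {n N : ℕ} {q₀ q B M D : ℝ} {Y : Fin n → Bool} {U : Fin n → ℝ} {μ : Bool → ℝ}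

/-- The last grid level is 1, where the condition on Φ(U) is void and only the class label is
counted. -/
theorem abs_classFreq_sub_le (t : Tuning n N q₀ q B M D) (g : CoordGood Y U q μ M D N)
    (y : Bool) : |classFreq Y y - classProb q y| ≤ D := by
  have h := g.grid y N le_rfl
  have hN : (N : ℝ) ≠ 0 := by exact_mod_cast t.N_pos.ne'
  rw [div_self hN, scoreCDF_one, mul_one] at h
  have h1 : (fun i => if Y i = y ∧ stdCDF (U i) ≤ 1 then (1 : ℝ) else 0)
      = fun i => if Y i = y then (1 : ℝ) else 0 := by
    funext i
    simp [(stdCDF_lt_one (U i)).le]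
  rwa [h1] at h

theorem le_classFreq (t : Tuning n N q₀ q B M D) (g : CoordGood Y U q μ M D N) (y : Bool) :
    3 / 4 * q₀ ≤ classFreq Y y := by
  have h1 := abs_le.1 (g.abs_classFreq_sub_le t y)
  linarith [t.q₀_le_classProb y, t.D_le]

theorem classCount_pos (t : Tuning n N q₀ q B M D) (g : CoordGood Y U q μ M D N) (y : Bool) :
    0 < classCount Y y := by
  have h := g.le_classFreq t y
  rw [classFreq_eq_div] at h
  by_contra h0
  have h1 : classCount Y y = 0 := by omega
  rw [h1, Nat.cast_zero, zero_div] at h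
  linarith [t.q₀_pos]

theorem winsorLevel_bounds (t : Tuning n N q₀ q B M D) (g : CoordGood Y U q μ M D N) :
    1 / (n : ℝ) ^ 2 ≤ 1 / (classCount Y true : ℝ) ^ 2
      ∧ 1 / (classCount Y true : ℝ) ^ 2 ≤ D := by
  have hc : (0 : ℝ) < classCount Y true := by exact_mod_cast g.classCount_pos t true
  have hn : (0 : ℝ) < n := by exact_mod_cast t.n_pos
  have hq := t.q₀_pos
  constructor
  · exact one_div_le_one_div_of_le (by positivity)
      (pow_le_pow_left₀ hc.le (by exact_mod_cast classCount_le Y true) 2)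
  · have h := g.le_classFreq t true
    rw [classFreq_eq_div, le_div_iff₀ hn] at h
    refine le_trans ?_ t.n_inv_le
    rw [div_le_div_iff₀ (by positivity) (by positivity)]
    have h2 := pow_le_pow_left₀ (by positivity) h 2
    have h3 : 0 ≤ (q₀ * n) ^ 2 := by positivity
    nlinarith

/-- Monotonicity squeezes the count at U_i between two neighbouring grid levels; Φ(U) is uniform in
the class +1 because its mean is 0. The count is off by 2D and the class frequency by D; dividing 3D
by a frequency of at least 3q₀/4 gives 4D/q₀. -/
theorem abs_rankCDF_sub_le (t : Tuning n N q₀ q B M D) (g : CoordGood Y U q μ M D N)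
    (hμ : μ true = 0) (i : Fin n) :
    |rankCDF Y U i - stdCDF (U i)| ≤ 4 * D / q₀ ∧ 0 ≤ rankCDF Y U i ∧ rankCDF Y U i ≤ 1 := by
  have hn : (0 : ℝ) < n := by exact_mod_cast t.n_pos
  have hN : (0 : ℝ) < N := by exact_mod_cast t.N_pos
  have hf := g.le_classFreq t true
  have hfq := abs_le.1 (g.abs_classFreq_sub_le t true)
  have hf0 : 0 < classFreq Y true := by linarith [t.q₀_pos]
  have hp : classProb q true = q := by simp [classProb]
  rw [hp] at hfq
  set V := stdCDF (U i) with hV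
  have hV0 := stdCDF_pos (U i)
  have hV1 := stdCDF_lt_one (U i)
  set c := empMean (fun k => if Y k = true ∧ U k ≤ U i then (1 : ℝ) else 0) with hc
  have hr : rankCDF Y U i = c / classFreq Y true := by
    rw [classFreq_eq_div, hc, empMean, rankCDF]
    field_simp
  set k := ⌊V * N⌋₊ with hk
  have hk1 : (k : ℝ) ≤ V * N := Nat.floor_le (by positivity)
  have hk2 : V * N < k + 1 := Nat.lt_floor_add_one _
  have hkN : k + 1 ≤ N := by
    have : (k : ℝ) < N := by nlinarith
    have : k < N := by exact_mod_cast this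
    omega
  have hkN' : (k : ℝ) + 1 ≤ N := by exact_mod_cast hkN
  have hlow := abs_le.1 (g.grid true k (by omega))
  have hupp := abs_le.1 (g.grid true (k + 1) hkN)
  rw [hμ, hp] at hlow hupp
  rw [scoreCDF_zero (by positivity) (by rw [div_le_one hN]; linarith)] at hlow
  rw [scoreCDF_zero (by positivity) (by rw [div_le_one hN]; push_cast; exact hkN')] at hupp
  have hkV : (k : ℝ) / N ≤ V := by rw [div_le_iff₀ hN]; exact hk1
  have hkV' : V < ((k + 1 : ℕ) : ℝ) / N := by rw [lt_div_iff₀ hN]; push_cast; exact hk2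
  have hkk : ((k + 1 : ℕ) : ℝ) / N = k / N + 1 / N := by push_cast; ring
  have hND := t.N_inv_le
  have hc1 : empMean (fun l => if Y l = true ∧ stdCDF (U l) ≤ (k : ℝ) / N then (1 : ℝ) else 0)
      ≤ c := by
    refine empMean_mono fun l => ?_
    by_cases h : Y l = true ∧ stdCDF (U l) ≤ (k : ℝ) / N
    · rw [if_pos h, if_pos ⟨h.1, stdCDF_strictMono.le_iff_le.1 (h.2.trans hkV)⟩]
    · rw [if_neg h]; split_ifs <;> norm_num
  have hc2 : c ≤ empMean (fun l => if Y l = true ∧ stdCDF (U l) ≤ ((k + 1 : ℕ) : ℝ) / N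
      then (1 : ℝ) else 0) := by
    refine empMean_mono fun l => ?_
    by_cases h : Y l = true ∧ U l ≤ U i
    · rw [if_pos h, if_pos ⟨h.1, (stdCDF_strictMono.le_iff_le.2 h.2).trans hkV'.le⟩]
    · rw [if_neg h]; split_ifs <;> norm_num
  have hcf : c ≤ classFreq Y true := by
    refine empMean_mono fun l => ?_
    by_cases h : Y l = true ∧ U l ≤ U i
    · rw [if_pos h, if_pos h.1]
    · rw [if_neg h]; split_ifs <;> norm_num
  have hc0 : 0 ≤ c := empMean_nonneg fun l => by split_ifs <;> norm_num
  have hq0 := t.q₀_pos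
  have hq1 : 0 < q := hq0.trans_le t.q₀_le
  have hq2 : q < 1 := by linarith [t.q₀_le']
  have hD := t.D_pos
  have hx1 : c ≤ q * V + 2 * D := by
    have h1 : q * (((k + 1 : ℕ) : ℝ) / N) ≤ q * V + D := by
      have : q * (((k + 1 : ℕ) : ℝ) / N) ≤ q * (V + D) :=
        mul_le_mul_of_nonneg_left (by linarith) hq1.le
      have : q * D ≤ 1 * D := mul_le_mul_of_nonneg_right hq2.le hD.le
      linarith
    linarith [hupp.2]
  have hx2 : q * V - 2 * D ≤ c := by
    have h1 : q * V - D ≤ q * ((k : ℝ) / N) := by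
      have : q * (V - D) ≤ q * ((k : ℝ) / N) :=
        mul_le_mul_of_nonneg_left (by linarith) hq1.le
      have : q * D ≤ 1 * D := mul_le_mul_of_nonneg_right hq2.le hD.le
      linarith
    linarith [hlow.1]
  refine ⟨?_, ?_, ?_⟩
  · have hnum : |c - V * classFreq Y true| ≤ 3 * D := by
      rw [abs_le]
      constructor <;> nlinarith
    have he : rankCDF Y U i - V = (c - V * classFreq Y true) / classFreq Y true := by
      rw [hr]; field_simp
    rw [he, abs_div, abs_of_pos hf0, div_le_div_iff₀ hf0 hq0]
    calc |c - V * classFreq Y true| * q₀ ≤ 3 * D * q₀ :=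
          mul_le_mul_of_nonneg_right hnum hq0.le
      _ = 4 * D * (3 / 4 * q₀) := by ring
      _ ≤ 4 * D * classFreq Y true := mul_le_mul_of_nonneg_left hf (by positivity)
  · rw [hr]; positivity
  · rw [hr, div_le_one hf0]; exact hcf

/-- The Winsor level 1/n₊² is at least 1/n² > e^{-M²/2}, which confines the scores; it is also at
most D, which turns 4D/q₀ into 5D/q₀. -/
theorem normalScore_bounds (t : Tuning n N q₀ q B M D) (g : CoordGood Y U q μ M D N)
    (hμ : μ true = 0) (i : Fin n) :
    |normalScore Y U i| ≤ M ∧ |stdCDF (normalScore Y U i) - stdCDF (U i)| ≤ 5 * D / q₀ := by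
  obtain ⟨ha1, ha2⟩ := g.winsorLevel_bounds t
  obtain ⟨hr, hr0, hr1⟩ := g.abs_rankCDF_sub_le t hμ i
  set a := 1 / (classCount Y true : ℝ) ^ 2 with ha
  have ha3 : Real.exp (-M ^ 2 / 2) < a := t.exp_lt.trans_le ha1
  have ha0 : 0 < a := (Real.exp_pos _).trans ha3
  obtain ⟨h1, h2, h3⟩ := winsorize_spec ha0.le
    (by linarith [t.D_le, t.q₀_le_half]) hr0 hr1
  refine ⟨abs_probit_le t.M_nonneg ha3 h1 h2, ?_⟩
  rw [normalScore, stdCDF_probit (by linarith) (by linarith)]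
  have hD : D ≤ D / q₀ := by
    rw [le_div_iff₀ t.q₀_pos]
    nlinarith [t.D_pos, t.q₀_le_half]
  have e : 5 * D / q₀ = 4 * D / q₀ + D / q₀ := by ring
  rw [abs_le] at *
  constructor <;> linarith

/-- Enclose the window between two grid levels, at a cost of 2D in width, and apply the modulus of
continuity of the class distribution. It is valid in both classes. -/
theorem window_le (t : Tuning n N q₀ q B M D) (g : CoordGood Y U q μ M D N)
    (hμB : ∀ y, |μ y| ≤ B) (y : Bool) {w v : ℝ} (hw : 0 ≤ w) (hv0 : 0 < v) (hv1 : v < 1) :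
    empMean (fun i => if Y i = y ∧ |stdCDF (U i) - v| ≤ w then (1 : ℝ) else 0)
      ≤ Real.exp (B * M) * (2 * w + 2 * D) + gaussTail B M + 2 * D := by
  have hN : (0 : ℝ) < N := by exact_mod_cast t.N_pos
  set k₂ := min N ⌈(v + w) * N⌉₊ with hk₂
  -- Going one step below the ceiling puts the grid level strictly under the window. Natural-number
  -- subtraction gives level 0 when the window reaches 0, and Φ(U) > 0 then supplies strictness.
  set k₁ := ⌈(v - w) * N⌉₊ - 1 with hk₁
  have hk₁N : k₁ ≤ N := by
    have : ⌈(v - w) * N⌉₊ ≤ N := Nat.ceil_le.2 (by nlinarith)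
    omega
  have hk₂N : k₂ ≤ N := min_le_left _ _
  have hk12 : k₁ ≤ k₂ := by
    have : ⌈(v - w) * N⌉₊ ≤ ⌈(v + w) * N⌉₊ := Nat.ceil_le_ceil (by nlinarith)
    omega
  have hk12' : (k₁ : ℝ) / N ≤ (k₂ : ℝ) / N := by gcongr
  have hk₂1 : (k₂ : ℝ) / N ≤ 1 := by rw [div_le_one hN]; exact_mod_cast hk₂N
  have hwid : (k₂ : ℝ) / N - (k₁ : ℝ) / N ≤ 2 * w + 2 * D := by
    have h1 : (k₂ : ℝ) ≤ (v + w) * N + 1 := by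
      have := (Nat.ceil_lt_add_one (show 0 ≤ (v + w) * N by positivity)).le
      have h' : (k₂ : ℝ) ≤ ⌈(v + w) * N⌉₊ := by exact_mod_cast min_le_right _ _
      linarith
    have h2 : (v - w) * N - 1 ≤ k₁ := by
      have h3 := Nat.le_ceil ((v - w) * N)
      have h4 : (⌈(v - w) * N⌉₊ : ℝ) ≤ k₁ + 1 := by
        have : ⌈(v - w) * N⌉₊ ≤ k₁ + 1 := by omega
        exact_mod_cast this
      linarith
    have h3 := t.N_inv_le
    have h4 : ((k₂ : ℝ) - k₁) / N ≤ (2 * w * N + 2) / N := by gcongr; linarith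
    have h5 : (2 * w * N + 2) / N = 2 * w + 2 * (1 / N) := by field_simp
    rw [← sub_div]
    linarith
  have hind : ∀ i, (if Y i = y ∧ |stdCDF (U i) - v| ≤ w then (1 : ℝ) else 0)
      ≤ (if Y i = y ∧ stdCDF (U i) ≤ (k₂ : ℝ) / N then (1 : ℝ) else 0)
        - (if Y i = y ∧ stdCDF (U i) ≤ (k₁ : ℝ) / N then (1 : ℝ) else 0) := by
    intro i
    by_cases hi : Y i = y ∧ |stdCDF (U i) - v| ≤ w
    · obtain ⟨hy, habs⟩ := hi
      rw [abs_le] at habs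
      have hp := stdCDF_pos (U i)
      have hlt := stdCDF_lt_one (U i)
      have h2 : stdCDF (U i) ≤ (k₂ : ℝ) / N := by
        rw [le_div_iff₀ hN, hk₂]
        push_cast
        refine le_min (by nlinarith) ?_
        refine le_trans ?_ (Nat.le_ceil _)
        nlinarith
      have h1 : ¬ stdCDF (U i) ≤ (k₁ : ℝ) / N := by
        rw [not_le, div_lt_iff₀ hN]
        rcases Nat.eq_zero_or_pos k₁ with h0 | h0
        · rw [h0]; push_cast; positivity
        · have : k₁ < ⌈(v - w) * N⌉₊ := by omega
          have := Nat.lt_ceil.1 this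
          nlinarith
      rw [if_pos ⟨hy, by rw [abs_le]; exact habs⟩, if_pos ⟨hy, h2⟩, if_neg fun h => h1 h.2]
      norm_num
    · rw [if_neg hi]
      by_cases h1 : Y i = y ∧ stdCDF (U i) ≤ (k₁ : ℝ) / N
      · rw [if_pos h1, if_pos ⟨h1.1, h1.2.trans hk12'⟩]; norm_num
      · rw [if_neg h1]; split_ifs <;> norm_num
  have hup := (abs_le.1 (g.grid y k₂ hk₂N)).2
  have hlo := (abs_le.1 (g.grid y k₁ hk₁N)).1
  have hs := scoreCDF_sub_le t.M_nonneg t.B_nonneg (hμB y) (show 0 ≤ (k₁ : ℝ) / N by positivity)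
    hk12' hk₂1
  have hs2 : Real.exp (B * M) * ((k₂ : ℝ) / N - (k₁ : ℝ) / N)
      ≤ Real.exp (B * M) * (2 * w + 2 * D) :=
    mul_le_mul_of_nonneg_left hwid (Real.exp_pos _).le
  have hp0 : 0 ≤ classProb q y := t.q₀_pos.le.trans (t.q₀_le_classProb y)
  have hp1 := t.classProb_le_one y
  have hX : 0 ≤ Real.exp (B * M) * (2 * w + 2 * D) + gaussTail B M := by
    have := gaussTail_pos B M
    have := t.D_pos
    positivity
  have h3 : classProb q y * (scoreCDF (μ y) ((k₂ : ℝ) / N) - scoreCDF (μ y) ((k₁ : ℝ) / N))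
      ≤ Real.exp (B * M) * (2 * w + 2 * D) + gaussTail B M :=
    calc _ ≤ classProb q y * (Real.exp (B * M) * (2 * w + 2 * D) + gaussTail B M) :=
          mul_le_mul_of_nonneg_left (by linarith) hp0
      _ ≤ 1 * _ := mul_le_mul_of_nonneg_right hp1 hX
      _ = _ := one_mul _
  refine (empMean_mono hind).trans ?_
  rw [empMean_sub]
  linarith

theorem clip_lt_or (M x s : ℝ) (hs : -M ≤ s) (hs' : s < M) : s < clip M x ↔ s < x := by
  simp only [clip, lt_max_iff, lt_min_iff]
  constructor
  · rintro (h | h)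
    · linarith
    · exact h.2
  · intro h; exact Or.inr ⟨hs', h⟩

/-- If a level s in [-M, M) separates the score from the clipped value, it separates the score from
U itself, so Φ(s) lies between two numbers at distance at most 5D/q₀. Hence the separated
observations lie in a window around Φ(s), and the bound is uniform in s. -/
theorem mean_abs_score_sub_clip_le (t : Tuning n N q₀ q B M D) (g : CoordGood Y U q μ M D N)
    (hμ : μ true = 0) (hμB : ∀ y, |μ y| ≤ B) (y : Bool) :
    empMean (fun i => if Y i = y then |normalScore Y U i - clip M (U i)| else 0)
      ≤ 2 * M * (Real.exp (B * M) * (2 * (5 * D / q₀) + 2 * D) + gaussTail B M + 2 * D) := by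
  set K := Real.exp (B * M) * (2 * (5 * D / q₀) + 2 * D) + gaussTail B M + 2 * D with hK
  have hn : (0 : ℝ) < n := by exact_mod_cast t.n_pos
  have hq := t.q₀_pos
  have hD := t.D_pos
  have key := sum_abs_sub_le_of_separated (Finset.univ.filter fun i => Y i = y)
    (a := normalScore Y U) (b := fun i => clip M (U i)) (K := n * K) t.M_nonneg
    (fun i _ => (g.normalScore_bounds t hμ i).1) (fun i _ => abs_clip_le t.M_nonneg _) ?_
  · rw [empMean, ← Finset.sum_filter]
    calc (n : ℝ)⁻¹ * _ ≤ (n : ℝ)⁻¹ * (2 * M * (n * K)) :=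
          mul_le_mul_of_nonneg_left key (by positivity)
      _ = 2 * M * K := by field_simp
  · intro s hs hs'
    have hw := g.window_le t hμB y (w := 5 * D / q₀) (v := stdCDF s) (by positivity)
      (stdCDF_pos s) (stdCDF_lt_one s)
    rw [empMean, inv_mul_le_iff₀ hn] at hw
    refine le_trans ?_ hw
    rw [Finset.sum_filter]
    refine Finset.sum_le_sum fun i _ => ?_
    by_cases hy : Y i = y
    · rw [if_pos hy]
      by_cases hsep : min (normalScore Y U i) (clip M (U i)) ≤ s
          ∧ s < max (normalScore Y U i) (clip M (U i))
      · have hwin : |stdCDF (U i) - stdCDF s| ≤ 5 * D / q₀ := by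
          have hb := abs_le.1 (g.normalScore_bounds t hμ i).2
          obtain ⟨h1, h2⟩ := hsep
          rcases lt_max_iff.1 h2 with h2 | h2
          · have h3 : clip M (U i) ≤ s := by
              rcases min_le_iff.1 h1 with h | h
              · linarith
              · exact h
            have h4 : U i ≤ s := by
              by_contra! h
              exact absurd ((clip_lt_or M (U i) s hs hs').2 h) (not_lt.2 h3)
            have h5 := stdCDF_strictMono.le_iff_le.2 h4
            have h6 := stdCDF_strictMono h2
            rw [abs_le]
            constructor <;> linarith
          · have h3 : normalScore Y U i ≤ s := by
              rcases min_le_iff.1 h1 with h | h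
              · exact h
              · linarith
            have h4 : s < U i := (clip_lt_or M (U i) s hs hs').1 h2
            have h5 := stdCDF_strictMono.le_iff_le.2 h3
            have h6 := stdCDF_strictMono h4
            rw [abs_le]
            constructor <;> linarith
        rw [if_pos hsep, if_pos ⟨hy, hwin⟩]
      · rw [if_neg hsep]; split_ifs <;> norm_num
    · rw [if_neg hy, if_neg fun h => hy h.1]

/-- The constant in the bounds for the normal scores. -/
noncomputable def scoreConst (q₀ B : ℝ) : ℝ := 2 * (10 / q₀ + 4 + 2 * Real.exp (B + 1 / 2))

theorem scoreConst_pos {q₀ B : ℝ} (hq : 0 < q₀) : 0 < scoreConst q₀ B := by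
  unfold scoreConst; positivity

theorem _root_.SSDA.Tuning.gaussTail_le (t : Tuning n N q₀ q B M D) :
    gaussTail B M ≤ 2 * Real.exp (B + 1 / 2) * (Real.exp ((B + 1) * M) * D) := by
  have hn : (0 : ℝ) < n := by exact_mod_cast t.n_pos
  have hq := t.q₀_pos
  have h1 : Real.exp (-M ^ 2 / 2) ≤ D := by
    refine t.exp_lt.le.trans (le_trans ?_ t.n_inv_le)
    rw [div_le_div_iff₀ (by positivity) (by positivity), mul_pow]
    have : q₀ ^ 2 ≤ 1 := by nlinarith [t.q₀_le_half]
    nlinarith [sq_nonneg (n : ℝ)]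
  have h2 : gaussTail B M = 2 * Real.exp (B + 1 / 2)
      * (Real.exp ((B + 1) * M) * Real.exp (-M ^ 2 / 2)) := by
    rw [gaussTail, ← Real.exp_add, mul_assoc, ← Real.exp_add]
    ring_nf
  rw [h2]
  gcongr

/-- Factors of M are absorbed by raising the exponent from B + 1 to B + 2, so that every error has
the single scale e^{(B+2)M} D. -/
theorem _root_.SSDA.Tuning.exp_bounds (t : Tuning n N q₀ q B M D) :
    1 ≤ Real.exp ((B + 1) * M) ∧ Real.exp (B * M) ≤ Real.exp ((B + 1) * M)
      ∧ Real.exp ((B + 1) * M) ≤ Real.exp ((B + 2) * M)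
      ∧ M * Real.exp ((B + 1) * M) ≤ Real.exp ((B + 2) * M) ∧ M ≤ Real.exp ((B + 2) * M) := by
  have hM := t.M_nonneg
  have hB := t.B_nonneg
  have h1 : 1 ≤ Real.exp ((B + 1) * M) := Real.one_le_exp (by positivity)
  have h4 : M * Real.exp ((B + 1) * M) ≤ Real.exp ((B + 2) * M) := by
    have : (B + 2) * M = M + (B + 1) * M := by ring
    rw [this, Real.exp_add]
    exact mul_le_mul_of_nonneg_right (by linarith [Real.add_one_le_exp M]) (Real.exp_pos _).le
  refine ⟨h1, Real.exp_le_exp.2 (by nlinarith), Real.exp_le_exp.2 (by nlinarith), h4, ?_⟩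
  nlinarith

theorem mean_abs_score_sub_clip_le_const (t : Tuning n N q₀ q B M D)
    (g : CoordGood Y U q μ M D N) (hμ : μ true = 0) (hμB : ∀ y, |μ y| ≤ B) (y : Bool) :
    empMean (fun i => if Y i = y then |normalScore Y U i - clip M (U i)| else 0)
      ≤ scoreConst q₀ B * (Real.exp ((B + 2) * M) * D) := by
  refine (g.mean_abs_score_sub_clip_le t hμ hμB y).trans ?_
  obtain ⟨h1, h2, h3, h4, h5⟩ := t.exp_bounds
  have hT := t.gaussTail_le
  have hq := t.q₀_pos
  have hD := t.D_pos
  have hM := t.M_nonneg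
  set E := Real.exp ((B + 1) * M)
  have e1 : Real.exp (B * M) * (2 * (5 * D / q₀) + 2 * D) ≤ (10 / q₀ + 2) * (E * D) := by
    have : 2 * (5 * D / q₀) + 2 * D = (10 / q₀ + 2) * D := by ring
    rw [this]
    calc _ ≤ E * ((10 / q₀ + 2) * D) := mul_le_mul_of_nonneg_right h2 (by positivity)
      _ = _ := by ring
  have e2 : 2 * D ≤ 2 * (E * D) := by nlinarith
  have e3 : Real.exp (B * M) * (2 * (5 * D / q₀) + 2 * D) + gaussTail B M + 2 * D
      ≤ (10 / q₀ + 4 + 2 * Real.exp (B + 1 / 2)) * (E * D) := by linarith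
  calc _ ≤ 2 * M * ((10 / q₀ + 4 + 2 * Real.exp (B + 1 / 2)) * (E * D)) :=
        mul_le_mul_of_nonneg_left e3 (by positivity)
    _ = scoreConst q₀ B * (M * E * D) := by rw [scoreConst]; ring
    _ ≤ _ := by
      have := (scoreConst_pos (B := B) hq).le
      gcongr

/-- Three errors add up: scores against clipped values, sampling fluctuation of the clipped values,
and the bias of clipping. -/
theorem abs_class_score_sub_le (t : Tuning n N q₀ q B M D) (g : CoordGood Y U q μ M D N)
    (hμ : μ true = 0) (hμB : ∀ y, |μ y| ≤ B) (y : Bool) :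
    |empMean (fun i => if Y i = y then normalScore Y U i else 0) - classProb q y * μ y|
      ≤ 2 * scoreConst q₀ B * (Real.exp ((B + 2) * M) * D) := by
  have h1 := g.mean_abs_score_sub_clip_le_const t hμ hμB y
  have h2 := g.trunc y
  have h3 := abs_integral_clip_sub_le t.M_nonneg (hμB y)
  have h4 : |empMean (fun i => if Y i = y then normalScore Y U i else 0)
      - empMean (fun i => if Y i = y then clip M (U i) else 0)|
      ≤ empMean (fun i => if Y i = y then |normalScore Y U i - clip M (U i)| else 0) := by
    rw [← empMean_sub]
    refine (abs_empMean_le _).trans (le_of_eq ?_)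
    congr 1
    funext i
    split_ifs <;> simp
  obtain ⟨e1, e2, e3, e4, e5⟩ := t.exp_bounds
  have hT := t.gaussTail_le
  have hp0 : 0 ≤ classProb q y := t.q₀_pos.le.trans (t.q₀_le_classProb y)
  have hp1 := t.classProb_le_one y
  have h5 : |classProb q y * ∫ x, clip M x ∂gaussianReal (μ y) 1 - classProb q y * μ y|
      ≤ gaussTail B M := by
    rw [← mul_sub, abs_mul, abs_of_nonneg hp0]
    calc _ ≤ 1 * gaussTail B M := mul_le_mul hp1 h3 (abs_nonneg _) zero_le_one
      _ = _ := one_mul _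
  have hD := t.D_pos
  have hq := t.q₀_pos
  have f1 : M * D ≤ Real.exp ((B + 2) * M) * D := mul_le_mul_of_nonneg_right e5 hD.le
  have f2 : Real.exp ((B + 1) * M) * D ≤ Real.exp ((B + 2) * M) * D :=
    mul_le_mul_of_nonneg_right e3 hD.le
  have f3 : gaussTail B M ≤ 2 * Real.exp (B + 1 / 2) * (Real.exp ((B + 2) * M) * D) :=
    hT.trans (mul_le_mul_of_nonneg_left f2 (by positivity))
  have f4 : (1 + 2 * Real.exp (B + 1 / 2)) * (Real.exp ((B + 2) * M) * D)
      ≤ scoreConst q₀ B * (Real.exp ((B + 2) * M) * D) := by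
    refine mul_le_mul_of_nonneg_right ?_ (by positivity)
    have : 0 < 10 / q₀ := by positivity
    have := Real.exp_pos (B + 1 / 2)
    rw [scoreConst]
    linarith
  rw [abs_le] at *
  constructor <;> linarith

theorem abs_class_mean_sub_le (t : Tuning n N q₀ q B M D) (g : CoordGood Y U q μ M D N)
    (hμ : μ true = 0) (hμB : ∀ y, |μ y| ≤ B) (y : Bool) :
    |empMean (fun i => if Y i = y then normalScore Y U i else 0) / classFreq Y y - μ y|
      ≤ 4 / (3 * q₀) * (2 * scoreConst q₀ B + B) * (Real.exp ((B + 2) * M) * D) := by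
  have h1 := g.abs_class_score_sub_le t hμ hμB y
  have h2 := g.abs_classFreq_sub_le t y
  have h3 := g.le_classFreq t y
  have hq := t.q₀_pos
  have hD := t.D_pos
  have hB := t.B_nonneg
  have hf0 : 0 < classFreq Y y := by linarith
  obtain ⟨e1, e2, e3, e4, e5⟩ := t.exp_bounds
  set S := empMean (fun i => if Y i = y then normalScore Y U i else 0)
  have hR : D ≤ Real.exp ((B + 2) * M) * D := by
    have : 1 ≤ Real.exp ((B + 2) * M) := e1.trans e3
    nlinarith
  have h4 : |(classFreq Y y - classProb q y) * μ y| ≤ Real.exp ((B + 2) * M) * D * B := by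
    rw [abs_mul]
    exact mul_le_mul (h2.trans hR) (hμB y) (abs_nonneg _) (by positivity)
  have h5 : |S - classFreq Y y * μ y|
      ≤ (2 * scoreConst q₀ B + B) * (Real.exp ((B + 2) * M) * D) := by
    have : S - classFreq Y y * μ y = (S - classProb q y * μ y)
        - (classFreq Y y - classProb q y) * μ y := by ring
    rw [this]
    refine (abs_sub _ _).trans ?_
    linarith
  have h6 : S / classFreq Y y - μ y = (S - classFreq Y y * μ y) / classFreq Y y := by field_simp
  rw [h6, abs_div, abs_of_pos hf0, div_le_iff₀ hf0]
  refine h5.trans ?_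
  have hC := scoreConst_pos (B := B) hq
  calc (2 * scoreConst q₀ B + B) * (Real.exp ((B + 2) * M) * D)
      = 4 / (3 * q₀) * (2 * scoreConst q₀ B + B) * (Real.exp ((B + 2) * M) * D)
        * (3 / 4 * q₀) := by field_simp
    _ ≤ _ := mul_le_mul_of_nonneg_left h3 (by positivity)

end CoordGood

end Empirical

/-! ### Moments of the transformed predictors; positive definiteness of Ω -/

namespace SeLDAModel

variable {p : ℕ} (m : SeLDAModel p)

instance : IsProbabilityMeasure m.law := m.isProb

/-- The transformed predictor `h_j(X_j)`. -/
def transformed (j : Fin p) (z : Obs p) : ℝ := m.h j (z.2 j)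

/-- The mean of `h_j(X_j)` in the class `y`. -/
def classMean (j : Fin p) (y : Bool) : ℝ := if y = true then 0 else m.muNeg j

theorem measurable_transformed (j : Fin p) : Measurable (m.transformed j) :=
  (m.h_measurable j).comp ((measurable_pi_apply j).comp measurable_snd)

theorem measurableSet_label (y : Bool) : MeasurableSet {z : Obs p | z.1 = y} :=
  measurable_fst (measurableSet_singleton y)

theorem law_real_label (y : Bool) : m.law.real {z | z.1 = y} = classProb m.posProb y := by
  cases y
  · have h : {z : Obs p | z.1 = false} = {z : Obs p | z.1 = true}ᶜ := by
      ext z; simp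
    rw [h, probReal_compl_eq_one_sub (measurableSet_label true), m.law_pos]
    simp [classProb]
  · simpa [classProb] using m.law_pos

theorem classProb_pos (y : Bool) : 0 < classProb m.posProb y := by
  cases y
  · simpa [classProb] using m.posProb_lt_one
  · simpa [classProb] using m.posProb_pos

theorem law_label (y : Bool) :
    m.law {z | z.1 = y} = ENNReal.ofReal (classProb m.posProb y) := by
  rw [← m.law_real_label, ofReal_measureReal]

theorem map_cond_vector (y : Bool) :
    (ProbabilityTheory.cond m.law {z | z.1 = y}).map
      (fun z => WithLp.toLp 2 (fun j => m.transformed j z))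
      = multivariateGaussian (WithLp.toLp 2 fun j => m.classMean j y) m.sigma := by
  cases y
  · exact m.law_h_neg
  · have h := m.law_h_pos
    have h0 : (WithLp.toLp 2 fun j => m.classMean j true : EuclideanSpace ℝ (Fin p)) = 0 := by
      ext j; simp [classMean]
    rw [h0]
    exact h

theorem measurable_transformed_vector :
    Measurable fun z => (WithLp.toLp 2 fun j => m.transformed j z : EuclideanSpace ℝ (Fin p)) :=
  (WithLp.measurable_toLp 2 _).comp (measurable_pi_lambda _ fun j => m.measurable_transformed j)

theorem map_cond_transformed (j : Fin p) (y : Bool) :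
    (ProbabilityTheory.cond m.law {z | z.1 = y}).map (m.transformed j)
      = gaussianReal (m.classMean j y) 1 := by
  have h := (measurePreserving_eval_multivariateGaussian
    (μ := WithLp.toLp 2 fun j => m.classMean j y) m.sigma_posDef.posSemidef (i := j)).map_eq
  rw [← m.map_cond_vector y, Measure.map_map (by fun_prop) m.measurable_transformed_vector] at h
  rw [m.sigma_diag, Real.toNNReal_one] at h
  exact h

theorem restrict_label (y : Bool) :
    m.law.restrict {z | z.1 = y} = ENNReal.ofReal (classProb m.posProb y)
      • ProbabilityTheory.cond m.law {z | z.1 = y} := by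
  rw [ProbabilityTheory.cond, ← m.law_label, smul_smul, ENNReal.mul_inv_cancel, one_smul]
  · rw [m.law_label]
    simpa using m.classProb_pos y
  · exact measure_ne_top _ _

theorem map_restrict_transformed (j : Fin p) (y : Bool) :
    (m.law.restrict {z | z.1 = y}).map (m.transformed j)
      = ENNReal.ofReal (classProb m.posProb y) • gaussianReal (m.classMean j y) 1 := by
  rw [restrict_label, Measure.map_smul, map_cond_transformed]

theorem setIntegral_label (j : Fin p) (y : Bool) {f : ℝ → ℝ} (hf : Measurable f) :
    ∫ z in {z | z.1 = y}, f (m.transformed j z) ∂m.law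
      = classProb m.posProb y * ∫ x, f x ∂gaussianReal (m.classMean j y) 1 := by
  rw [← integral_map (m.measurable_transformed j).aemeasurable hf.aestronglyMeasurable,
    map_restrict_transformed, integral_smul_measure, ENNReal.toReal_ofReal (m.classProb_pos y).le,
    smul_eq_mul]

theorem integral_ite_label (j : Fin p) (y : Bool) {f : ℝ → ℝ} (hf : Measurable f) :
    ∫ z, (if z.1 = y then f (m.transformed j z) else 0) ∂m.law
      = classProb m.posProb y * ∫ x, f x ∂gaussianReal (m.classMean j y) 1 := by
  rw [← m.setIntegral_label j y hf, ← integral_indicator (measurableSet_label y)]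
  congr 1
  funext z
  by_cases hz : z.1 = y <;> simp [Set.indicator, hz]

theorem integrable_comp_transformed (j : Fin p) {f : ℝ → ℝ} (hf : Measurable f)
    (h : ∀ y, Integrable f (gaussianReal (m.classMean j y) 1)) :
    Integrable (fun z => f (m.transformed j z)) m.law := by
  have hy : ∀ y, IntegrableOn (fun z => f (m.transformed j z)) {z | z.1 = y} m.law := by
    intro y
    have := (h y).smul_measure (c := ENNReal.ofReal (classProb m.posProb y)) ENNReal.ofReal_ne_top
    rw [← map_restrict_transformed] at this
    exact (integrable_map_measure hf.aestronglyMeasurable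
      (m.measurable_transformed j).aemeasurable).1 this
  have hu := (hy true).union (hy false)
  have : ({z : Obs p | z.1 = true} ∪ {z | z.1 = false}) = Set.univ := by
    ext z; simp
  rwa [this, integrableOn_univ] at hu

theorem integral_comp_transformed (j : Fin p) {f : ℝ → ℝ} (hf : Measurable f)
    (h : ∀ y, Integrable f (gaussianReal (m.classMean j y) 1)) :
    ∫ z, f (m.transformed j z) ∂m.law
      = classProb m.posProb true * ∫ x, f x ∂gaussianReal (m.classMean j true) 1
        + classProb m.posProb false * ∫ x, f x ∂gaussianReal (m.classMean j false) 1 := by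
  rw [← m.setIntegral_label j true hf, ← m.setIntegral_label j false hf]
  have hc : {z : Obs p | z.1 = false} = {z : Obs p | z.1 = true}ᶜ := by
    ext z; simp
  rw [hc]
  exact (integral_add_compl (measurableSet_label true)
    (m.integrable_comp_transformed j hf h)).symm

theorem classProb_add : classProb m.posProb true + classProb m.posProb false = 1 := by
  simp [classProb]

theorem integral_comp_transformed_le (j : Fin p) {f : ℝ → ℝ} (hf : Measurable f)
    (h : ∀ y, Integrable f (gaussianReal (m.classMean j y) 1)) {c : ℝ}
    (hc : ∀ y, ∫ x, f x ∂gaussianReal (m.classMean j y) 1 ≤ c) :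
    ∫ z, f (m.transformed j z) ∂m.law ≤ c := by
  rw [m.integral_comp_transformed j hf h]
  have h1 := mul_le_mul_of_nonneg_left (hc true) (m.classProb_pos true).le
  have h2 := mul_le_mul_of_nonneg_left (hc false) (m.classProb_pos false).le
  have h3 := m.classProb_add
  calc _ ≤ classProb m.posProb true * c + classProb m.posProb false * c := add_le_add h1 h2
    _ = c := by rw [← add_mul, h3, one_mul]

theorem integrable_sq_gaussianReal (μ : ℝ) : Integrable (fun x : ℝ => x ^ 2) (gaussianReal μ 1) :=
  (memLp_id_gaussianReal 2).integrable_sq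

theorem memLp_transformed (j : Fin p) : MemLp (m.transformed j) 2 m.law :=
  (memLp_two_iff_integrable_sq (m.measurable_transformed j).aestronglyMeasurable).2
    (m.integrable_comp_transformed j (f := fun x => x ^ 2) (by fun_prop)
      fun _ => integrable_sq_gaussianReal _)

theorem omega_eq (j k : Fin p) : m.omega j k = ∫ z, m.transformed j z * m.transformed k z ∂m.law
    - (∫ z, m.transformed j z ∂m.law) * ∫ z, m.transformed k z ∂m.law :=
  covariance_eq_sub (m.memLp_transformed j) (m.memLp_transformed k)

theorem memLp_cond_transformed (y : Bool) (j : Fin p) :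
    MemLp (m.transformed j) 2 (ProbabilityTheory.cond m.law {z | z.1 = y}) := by
  have h : MemLp id 2 ((ProbabilityTheory.cond m.law {z | z.1 = y}).map (m.transformed j)) := by
    rw [map_cond_transformed]
    exact memLp_id_gaussianReal 2
  exact (memLp_map_measure_iff aestronglyMeasurable_id
    (m.measurable_transformed j).aemeasurable).1 h

theorem cond_covariance (y : Bool) (j k : Fin p) :
    covariance (m.transformed j) (m.transformed k)
      (ProbabilityTheory.cond m.law {z | z.1 = y}) = m.sigma j k := by
  have h := covariance_eval_multivariateGaussian
    (μ := WithLp.toLp 2 fun j => m.classMean j y) m.sigma_posDef.posSemidef j k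
  rw [← m.map_cond_vector y, covariance_map (by fun_prop) (by fun_prop)
    m.measurable_transformed_vector.aemeasurable] at h
  exact h

theorem variance_linear_eq {ν : Measure (Obs p)} [IsProbabilityMeasure ν]
    (hν : ∀ j, MemLp (m.transformed j) 2 ν) {C : Matrix (Fin p) (Fin p) ℝ}
    (hC : ∀ j k, covariance (m.transformed j) (m.transformed k) ν = C j k) (x : Fin p → ℝ) :
    variance (fun z => ∑ j, x j * m.transformed j z) ν = dotProduct x (C.mulVec x) := by
  have hX : ∀ j, MemLp (fun z => x j * m.transformed j z) 2 ν := fun j => (hν j).const_mul (x j)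
  rw [← covariance_self (memLp_finsetSum _ fun j _ => hX j).aemeasurable,
    covariance_fun_sum_fun_sum hX hX]
  simp only [dotProduct, Matrix.mulVec, Finset.mul_sum]
  refine Finset.sum_congr rfl fun j _ => Finset.sum_congr rfl fun k _ => ?_
  rw [covariance_const_mul_left, covariance_const_mul_right, hC]
  ring

/-- If x'h(X) had variance 0 it would be almost surely constant, hence constant also given Y = +1,
where its variance is x'Σx > 0. No decomposition into within- and between-class parts is needed. -/
theorem omega_posDef : m.omega.PosDef := by
  refine Matrix.PosDef.of_dotProduct_mulVec_pos ?_ fun x hx => ?_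
  · ext j k
    simp only [Matrix.conjTranspose_apply, star_trivial, omega, Matrix.of_apply]
    exact covariance_comm _ _
  · have h1 := m.variance_linear_eq m.memLp_transformed (C := m.omega) (fun j k => rfl) x
    have hcp : IsProbabilityMeasure (ProbabilityTheory.cond m.law {z | z.1 = true}) :=
      cond_isProbabilityMeasure (by rw [m.law_label]; simpa using m.classProb_pos true)
    have h2 := m.variance_linear_eq (m.memLp_cond_transformed true) (m.cond_covariance true) x
    have h3 : 0 < dotProduct x (m.sigma.mulVec x) := by
      simpa using m.sigma_posDef.dotProduct_mulVec_pos hx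
    simp only [star_trivial]
    rw [← h1]
    refine lt_of_le_of_ne (variance_nonneg _ _) fun h0 => ?_
    have hL : MemLp (fun z => ∑ j, x j * m.transformed j z) 2 m.law :=
      memLp_finsetSum _ fun j _ => (m.memLp_transformed j).const_mul (x j)
    have hae := ae_eq_integral_of_variance_eq_zero hL h0.symm
    have hae' := (cond_absolutelyContinuous (μ := m.law) (s := {z | z.1 = true})).ae_eq hae
    rw [variance_congr hae', variance_eq_integral aemeasurable_const] at h2
    simp at h2
    linarith

end SeLDAModel

/-! ### Hoeffding bounds and accuracy of the pseudo-data moments -/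

section Sample

variable {p n : ℕ} {m : SeLDAModel p} {Ω : Type*} [MeasurableSpace Ω] {Pr : Measure Ω}
  [IsProbabilityMeasure Pr] {Z : Fin n → Ω → Obs p}

theorem IsSample.integral_comp (hZ : IsSample m Pr Z) {f : Obs p → ℝ} (hf : Measurable f)
    (i : Fin n) : ∫ ω, f (Z i ω) ∂Pr = ∫ z, f z ∂m.law :=
  (hZ.2 i).integral_comp hf.aestronglyMeasurable

theorem IsSample.hoeffding_upper (hn : 0 < n) (hZ : IsSample m Pr Z) {f : Obs p → ℝ}
    (hf : Measurable f) (hb : ∀ z, |f z| ≤ 1) {D : ℝ} (hD : 0 ≤ D) :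
    Pr.real {ω | D ≤ empMean (fun i => f (Z i ω)) - ∫ z, f z ∂m.law}
      ≤ Real.exp (-(n * D ^ 2 / 2)) := by
  have hn' : (0 : ℝ) < n := by exact_mod_cast hn
  have hind : iIndepFun (fun i ω => f (Z i ω) - ∫ z, f z ∂m.law) Pr :=
    hZ.1.comp (fun _ z => f z - ∫ z, f z ∂m.law) fun _ => hf.sub_const _
  have hsub : ∀ i ∈ (Finset.univ : Finset (Fin n)),
      HasSubgaussianMGF (fun ω => f (Z i ω) - ∫ z, f z ∂m.law)
        ((‖(1 : ℝ) - (-1)‖₊ / 2) ^ 2) Pr := by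
    intro i _
    have h := hasSubgaussianMGF_of_mem_Icc (μ := Pr) (X := fun ω => f (Z i ω)) (a := -1) (b := 1)
      (hf.comp_aemeasurable (hZ.2 i).aemeasurable)
      (Filter.Eventually.of_forall fun ω => abs_le.1 (hb _))
    rwa [hZ.integral_comp hf i] at h
  have h := HasSubgaussianMGF.measure_sum_ge_le_of_iIndepFun hind hsub (ε := n * D) (by positivity)
  have hc : (‖(1 : ℝ) - (-1)‖₊ / 2) ^ 2 = 1 := by
    have : ‖(1 : ℝ) - (-1)‖₊ = 2 := by
      rw [← NNReal.coe_inj, coe_nnnorm]; norm_num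
    rw [this]; norm_num
  rw [hc] at h
  refine le_trans (measureReal_mono ?_) (h.trans (le_of_eq ?_))
  · intro ω hω
    simp only [Set.mem_ofPred_eq, empMean, Finset.sum_sub_distrib, Finset.sum_const,
      Finset.card_univ, Fintype.card_fin, nsmul_eq_mul] at hω ⊢
    have := mul_le_mul_of_nonneg_left hω hn'.le
    have e : (n : ℝ) * ((n : ℝ)⁻¹ * ∑ i, f (Z i ω) - ∫ z, f z ∂m.law)
        = ∑ i, f (Z i ω) - n * ∫ z, f z ∂m.law := by field_simp
    linarith
  · simp only [Finset.sum_const, Finset.card_univ, Fintype.card_fin, nsmul_eq_mul, mul_one,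
      NNReal.coe_natCast]
    congr 1
    field_simp

/-- Hoeffding's inequality for the average of a bounded function of the sample. -/
theorem IsSample.hoeffding (hn : 0 < n) (hZ : IsSample m Pr Z) {f : Obs p → ℝ}
    (hf : Measurable f) {b : ℝ} (hb0 : 0 < b) (hb : ∀ z, |f z| ≤ b) {D : ℝ} (hD : 0 ≤ D) :
    Pr.real {ω | ¬ |empMean (fun i => f (Z i ω)) - ∫ z, f z ∂m.law| ≤ b * D}
      ≤ 2 * Real.exp (-(n * D ^ 2 / 2)) := by
  have hg : ∀ c : ℝ, |c| = b⁻¹ → Pr.real {ω | D ≤ empMean (fun i => c * f (Z i ω))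
      - ∫ z, c * f z ∂m.law} ≤ Real.exp (-(n * D ^ 2 / 2)) := fun c hc =>
    hZ.hoeffding_upper hn (hf.const_mul c) (fun z => by
      rw [abs_mul, hc, inv_mul_le_iff₀ hb0, mul_one]; exact hb z) hD
  have h1 := hg b⁻¹ (abs_of_pos (by positivity))
  have h2 := hg (-b⁻¹) (by rw [abs_neg]; exact abs_of_pos (by positivity))
  have hsub : {ω | ¬ |empMean (fun i => f (Z i ω)) - ∫ z, f z ∂m.law| ≤ b * D}
      ⊆ {ω | D ≤ empMean (fun i => b⁻¹ * f (Z i ω)) - ∫ z, b⁻¹ * f z ∂m.law}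
        ∪ {ω | D ≤ empMean (fun i => -b⁻¹ * f (Z i ω)) - ∫ z, -b⁻¹ * f z ∂m.law} := by
    intro ω hω
    simp only [Set.mem_ofPred_eq, Set.mem_union, empMean_mul_left, integral_const_mul, ← mul_sub]
      at hω ⊢
    rw [not_le, lt_abs] at hω
    rw [le_inv_mul_iff₀ hb0, neg_mul, ← mul_neg, le_inv_mul_iff₀ hb0]
    exact hω.imp le_of_lt le_of_lt
  refine (measureReal_mono hsub).trans ((measureReal_union_le _ _).trans ?_)
  linarith

/-- A union of 2(N + 1) grid events and 2 truncation events, each of probability at most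
2e^{-nD²/2}. The clipped variables are bounded by M, which explains their tolerance M D. -/
theorem IsSample.coordGood_prob (hn : 0 < n) (hZ : IsSample m Pr Z) (j : Fin p) {M D : ℝ}
    (hM : 0 < M) (hD : 0 ≤ D) (N : ℕ) :
    Pr.real {ω | ¬ CoordGood (fun i => (Z i ω).1) (fun i => m.transformed j (Z i ω)) m.posProb
      (m.classMean j) M D N} ≤ (4 * N + 8) * Real.exp (-(n * D ^ 2 / 2)) := by
  set e := Real.exp (-(n * D ^ 2 / 2))
  let G : Bool × Fin (N + 1) → Set Ω := fun a => {ω | ¬ |empMean (fun i =>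
    if (Z i ω).1 = a.1 ∧ stdCDF (m.transformed j (Z i ω)) ≤ ((a.2 : ℕ) : ℝ) / N then (1 : ℝ) else 0)
      - classProb m.posProb a.1 * scoreCDF (m.classMean j a.1) (((a.2 : ℕ) : ℝ) / N)| ≤ D}
  let T : Bool → Set Ω := fun y => {ω | ¬ |empMean (fun i =>
    if (Z i ω).1 = y then clip M (m.transformed j (Z i ω)) else 0)
      - classProb m.posProb y * ∫ x, clip M x ∂gaussianReal (m.classMean j y) 1| ≤ M * D}
  have hG : ∀ a, Pr.real (G a) ≤ 2 * e := by
    rintro ⟨y, k⟩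
    have hms := measurableSet_stdCDF_le (((k : ℕ) : ℝ) / N)
    have hfm : Measurable ({x | stdCDF x ≤ ((k : ℕ) : ℝ) / N}.indicator (1 : ℝ → ℝ)) :=
      measurable_one.indicator hms
    have hI := m.integral_ite_label j y hfm
    rw [integral_indicator_one hms] at hI
    have hfun : ∀ z : Obs p, (if z.1 = y ∧ stdCDF (m.transformed j z) ≤ ((k : ℕ) : ℝ) / N
        then (1 : ℝ) else 0) = if z.1 = y then ({x | stdCDF x ≤ ((k : ℕ) : ℝ) / N}.indicator
          (1 : ℝ → ℝ)) (m.transformed j z) else 0 := by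
      intro z
      by_cases h1 : z.1 = y <;> by_cases h2 : stdCDF (m.transformed j z) ≤ ((k : ℕ) : ℝ) / N <;>
        simp [h1, h2]
    have h := hZ.hoeffding hn (f := fun z => if z.1 = y then
      ({x | stdCDF x ≤ ((k : ℕ) : ℝ) / N}.indicator (1 : ℝ → ℝ)) (m.transformed j z) else 0)
      (Measurable.ite (SeLDAModel.measurableSet_label y) (hfm.comp (m.measurable_transformed j))
        measurable_const) one_pos (fun z => by
          rw [← hfun]; split_ifs <;> simp) hD
    simp only [G, hfun]
    rw [hI, one_mul] at h
    exact h
  have hT : ∀ y, Pr.real (T y) ≤ 2 * e := by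
    intro y
    have h := hZ.hoeffding hn (f := fun z => if z.1 = y then clip M (m.transformed j z) else 0)
      (Measurable.ite (SeLDAModel.measurableSet_label y)
        ((measurable_clip M).comp (m.measurable_transformed j)) measurable_const) hM (fun z => by
          split_ifs
          · exact abs_clip_le hM.le _
          · simpa using hM.le) hD
    rw [m.integral_ite_label j y (measurable_clip M)] at h
    exact h
  have hsub : {ω | ¬ CoordGood (fun i => (Z i ω).1) (fun i => m.transformed j (Z i ω)) m.posProb
      (m.classMean j) M D N} ⊆ (⋃ a, G a) ∪ ⋃ y, T y := by
    intro ω hω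
    by_contra hc
    simp only [Set.mem_union, Set.mem_iUnion, not_or, not_exists] at hc
    refine hω ⟨fun y k hk => ?_, fun y => ?_⟩
    · by_contra h
      exact hc.1 (y, ⟨k, Nat.lt_succ_of_le hk⟩) h
    · by_contra h
      exact hc.2 y h
  calc _ ≤ Pr.real ((⋃ a, G a) ∪ ⋃ y, T y) := measureReal_mono hsub
    _ ≤ Pr.real (⋃ a, G a) + Pr.real (⋃ y, T y) := measureReal_union_le _ _
    _ ≤ ∑ a, Pr.real (G a) + ∑ y, Pr.real (T y) :=
        add_le_add (measureReal_iUnion_fintype_le _) (measureReal_iUnion_fintype_le _)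
    _ ≤ ∑ _a : Bool × Fin (N + 1), 2 * e + ∑ _y : Bool, 2 * e :=
        add_le_add (Finset.sum_le_sum fun a _ => hG a) (Finset.sum_le_sum fun y _ => hT y)
    _ = (4 * N + 8) * e := by
        simp only [Finset.sum_const, Finset.card_univ, Fintype.card_prod, Fintype.card_bool,
          Fintype.card_fin, nsmul_eq_mul]
        push_cast
        ring

/-- The order of the raw predictors agrees with that of the transformed predictors. -/
def OrderCompatible (m : SeLDAModel p) (D : Fin n → Obs p) : Prop :=
  ∀ j i k, (D k).2 j ≤ (D i).2 j ↔ m.transformed j (D k) ≤ m.transformed j (D i)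

theorem IsSample.ae_orderCompatible (hZ : IsSample m Pr Z) :
    ∀ᵐ ω ∂Pr, OrderCompatible m fun i => Z i ω := by
  choose S hS hS' using m.h_strictMono
  have h : ∀ᵐ ω ∂Pr, ∀ j i, (Z i ω).2 j ∈ S j := by
    rw [ae_all_iff]; intro j
    rw [ae_all_iff]; intro i
    refine ae_of_ae_map (hZ.2 i).aemeasurable (p := fun z : Obs p => z.2 j ∈ S j) ?_
    rw [(hZ.2 i).map_eq]
    exact hS' j
  filter_upwards [h] with ω hω j i k
  exact ((hS j).le_iff_le (hω j k) (hω j i)).symm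

/-- At sample points the empirical distribution function uses only order comparisons, so the unknown
transformations drop out. -/
theorem pseudo_eq_normalScore {D : Fin n → Obs p} (h : OrderCompatible m D) (i : Fin n)
    (j : Fin p) : pseudo D i j
      = normalScore (fun i => (D i).1) (fun i => m.transformed j (D i)) i := by
  have : empCDF D j ((D i).2 j)
      = rankCDF (fun i => (D i).1) (fun i => m.transformed j (D i)) i := by
    simp only [empCDF, rankCDF, h j i]
    rfl
  rw [pseudo, hHat, winCDF, this]
  rfl

theorem crossMean_response (D : Fin n → Obs p) (j : Fin p) (hn : n ≠ 0) :
    crossMean (response D) (pseudo D) j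
      = empMean (fun i => if (D i).1 = true then pseudo D i j else 0)
          / classFreq (fun i => (D i).1) true
        - empMean (fun i => if (D i).1 = false then pseudo D i j else 0)
          / classFreq (fun i => (D i).1) false := by
  have hn' : (n : ℝ) ≠ 0 := by exact_mod_cast hn
  have : ∀ i, response D i * pseudo D i j
      = (n : ℝ) / classSize D true * (if (D i).1 = true then pseudo D i j else 0)
      - (n : ℝ) / classSize D false * (if (D i).1 = false then pseudo D i j else 0) := by
    intro i
    by_cases hi : (D i).1 = true <;> simp [response, hi]
  rw [crossMean]
  simp only [this, Finset.sum_sub_distrib, ← Finset.mul_sum, classFreq_eq_div, empMean]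
  change _ = _ / ((classSize D true : ℝ) / n) - _ / ((classSize D false : ℝ) / n)
  simp only [div_eq_mul_inv, mul_inv_rev, inv_inv]
  ring

/-- The good event for the coordinate `j` of a data set. -/
def DataGood (m : SeLDAModel p) (D : Fin n → Obs p) (M δ : ℝ) (N : ℕ) (j : Fin p) : Prop :=
  CoordGood (fun i => (D i).1) (fun i => m.transformed j (D i)) m.posProb (m.classMean j) M δ N

variable {D : Fin n → Obs p} {N : ℕ} {q₀ B M δ : ℝ}

theorem _root_.SSDA.SeLDAModel.abs_classMean_le {B : ℝ} (hB : ∀ j, |m.muNeg j| ≤ B)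
    (j : Fin p) (y : Bool) : |m.classMean j y| ≤ B := by
  cases y
  · simpa [SeLDAModel.classMean] using hB j
  · simpa [SeLDAModel.classMean] using (abs_nonneg _).trans (hB j)

theorem DataGood.abs_crossMean_sub_le (t : Tuning n N q₀ m.posProb B M δ)
    (hB : ∀ j, |m.muNeg j| ≤ B) (hc : OrderCompatible m D) {j : Fin p}
    (g : DataGood m D M δ N j) :
    |crossMean (response D) (pseudo D) j - m.meanDiff j|
      ≤ 8 / (3 * q₀) * (2 * CoordGood.scoreConst q₀ B + B) * (Real.exp ((B + 2) * M) * δ) := by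
  have h1 := CoordGood.abs_class_mean_sub_le t g rfl (m.abs_classMean_le hB j) true
  have h2 := CoordGood.abs_class_mean_sub_le t g rfl (m.abs_classMean_le hB j) false
  rw [crossMean_response D j t.n_pos.ne']
  simp only [pseudo_eq_normalScore hc]
  have e1 : m.classMean j true = 0 := rfl
  have e2 : m.classMean j false = m.muNeg j := rfl
  rw [e1] at h1
  rw [e2] at h2
  have e3 : m.meanDiff j = 0 - m.muNeg j := rfl
  rw [e3]
  have e4 : 8 / (3 * q₀) * (2 * CoordGood.scoreConst q₀ B + B) * (Real.exp ((B + 2) * M) * δ)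
      = 2 * (4 / (3 * q₀) * (2 * CoordGood.scoreConst q₀ B + B)
        * (Real.exp ((B + 2) * M) * δ)) := by ring
  rw [e4]
  rw [abs_le] at *
  constructor <;> linarith

theorem DataGood.classSize_ne_zero (t : Tuning n N q₀ m.posProb B M δ) {j : Fin p}
    (g : DataGood m D M δ N j) (y : Bool) : classSize D y ≠ 0 :=
  (CoordGood.classCount_pos t g y).ne'

theorem empMean_eq_sum_class (Y : Fin n → Bool) (f : Fin n → ℝ) :
    empMean f = empMean (fun i => if Y i = true then f i else 0)
      + empMean (fun i => if Y i = false then f i else 0) := by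
  rw [← empMean_add]
  congr 1
  funext i
  cases Y i <;> simp

theorem DataGood.mean_abs_sub_clip_le (t : Tuning n N q₀ m.posProb B M δ)
    (hB : ∀ j, |m.muNeg j| ≤ B) (hc : OrderCompatible m D) {j : Fin p}
    (g : DataGood m D M δ N j) :
    empMean (fun i => |pseudo D i j - clip M (m.transformed j (D i))|)
      ≤ 2 * CoordGood.scoreConst q₀ B * (Real.exp ((B + 2) * M) * δ) := by
  have h1 := CoordGood.mean_abs_score_sub_clip_le_const t g rfl (m.abs_classMean_le hB j) true
  have h2 := CoordGood.mean_abs_score_sub_clip_le_const t g rfl (m.abs_classMean_le hB j) false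
  rw [empMean_eq_sum_class fun i => (D i).1]
  simp only [pseudo_eq_normalScore hc]
  linarith

theorem _root_.SSDA.SeLDAModel.integral_transformed (m : SeLDAModel p) (j : Fin p) :
    ∫ z, m.transformed j z ∂m.law = classProb m.posProb true * m.classMean j true
      + classProb m.posProb false * m.classMean j false := by
  have h := m.integral_comp_transformed j (f := fun x => x) measurable_id
    fun y => (memLp_id_gaussianReal 1).integrable le_rfl
  simpa only [integral_id_gaussianReal] using h

theorem DataGood.abs_colMean_sub_le (t : Tuning n N q₀ m.posProb B M δ)
    (hB : ∀ j, |m.muNeg j| ≤ B) (hc : OrderCompatible m D) {j : Fin p}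
    (g : DataGood m D M δ N j) :
    |colMean (pseudo D) j - ∫ z, m.transformed j z ∂m.law|
      ≤ 4 * CoordGood.scoreConst q₀ B * (Real.exp ((B + 2) * M) * δ) := by
  have h1 := CoordGood.abs_class_score_sub_le t g rfl (m.abs_classMean_le hB j) true
  have h2 := CoordGood.abs_class_score_sub_le t g rfl (m.abs_classMean_le hB j) false
  rw [m.integral_transformed]
  change |empMean (fun i => pseudo D i j) - _| ≤ _
  rw [empMean_eq_sum_class fun i => (D i).1]
  simp only [pseudo_eq_normalScore hc]
  rw [abs_le] at *
  constructor <;> linarith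

theorem DataGood.abs_pseudo_le (t : Tuning n N q₀ m.posProb B M δ)
    (hc : OrderCompatible m D) {j : Fin p} (g : DataGood m D M δ N j) (i : Fin n) :
    |pseudo D i j| ≤ M := by
  rw [pseudo_eq_normalScore hc]
  exact (CoordGood.normalScore_bounds t g rfl i).1

theorem abs_mul_sub_mul_le {a b a' b' M : ℝ} (hb : |b| ≤ M) (ha' : |a'| ≤ M) :
    |a * b - a' * b'| ≤ M * |a - a'| + M * |b - b'| := by
  have e : a * b - a' * b' = (a - a') * b + a' * (b - b') := by ring
  rw [e]
  refine (abs_add_le _ _).trans (add_le_add ?_ ?_)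
  · rw [abs_mul, mul_comm]; exact mul_le_mul_of_nonneg_right hb (abs_nonneg _)
  · rw [abs_mul]; exact mul_le_mul_of_nonneg_right ha' (abs_nonneg _)

theorem _root_.SSDA.SeLDAModel.integral_sq_transformed_le
    (hB : ∀ j, |m.muNeg j| ≤ B) (j : Fin p) :
    ∫ z, (m.transformed j z) ^ 2 ∂m.law ≤ 1 + B ^ 2 := by
  refine m.integral_comp_transformed_le j (f := fun x => x ^ 2) (by fun_prop)
    (fun _ => SeLDAModel.integrable_sq_gaussianReal _) fun y => ?_
  have h1 := variance_eq_sub (memLp_id_gaussianReal (μ := m.classMean j y) (v := 1) 2)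
  rw [variance_id_gaussianReal] at h1
  simp only [Pi.pow_apply, id, integral_id_gaussianReal, NNReal.coe_one] at h1
  have h2 := sq_le_sq' (by linarith [(abs_le.1 (m.abs_classMean_le hB j y)).1])
    (abs_le.1 (m.abs_classMean_le hB j y)).2
  linarith

/-- Truncation changes the mixed second moments by little. -/
theorem _root_.SSDA.SeLDAModel.abs_integral_clip_mul_clip_sub_le (hM : 0 ≤ M)
    (hB : ∀ j, |m.muNeg j| ≤ B) (j k : Fin p) {a : ℝ} (ha : 0 < a) :
    |∫ z, clip M (m.transformed j z) * clip M (m.transformed k z) ∂m.law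
      - ∫ z, m.transformed j z * m.transformed k z ∂m.law|
      ≤ M * gaussTail B M + a * gaussTail B M + (1 + B ^ 2) / (2 * a) := by
  set I : ℝ → ℝ := {x : ℝ | M < |x|}.indicator fun x => Real.exp |x| with hI
  have hIm : Measurable I :=
    (by fun_prop : Measurable fun x : ℝ => Real.exp |x|).indicator (measurableSet_lt_abs M)
  have hIi : ∀ l, Integrable (fun z => I (m.transformed l z)) m.law := fun l =>
    m.integrable_comp_transformed l hIm fun y => integrable_indicator_exp_abs _ hM
  have hII : ∀ l, ∫ z, I (m.transformed l z) ∂m.law ≤ gaussTail B M := fun l =>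
    m.integral_comp_transformed_le l hIm (fun y => integrable_indicator_exp_abs _ hM)
      fun y => integral_indicator_exp_abs_le hM (m.abs_classMean_le hB l y)
  have hsq : Integrable (fun z => (m.transformed j z) ^ 2) m.law :=
    (m.memLp_transformed j).integrable_sq
  have hpt : ∀ x y : ℝ, |clip M x * clip M y - x * y|
      ≤ M * I x + a * I y + x ^ 2 / (2 * a) := by
    intro x y
    have e : clip M x * clip M y - x * y = (clip M x - x) * clip M y + x * (clip M y - y) := by
      ring
    have h1 : |(clip M x - x) * clip M y| ≤ M * I x := by
      rw [abs_mul, mul_comm]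
      exact mul_le_mul (abs_clip_le hM y) (abs_clip_sub_le_exp hM x) (abs_nonneg _) hM
    have h2 : |x * (clip M y - y)| ≤ a * I y + x ^ 2 / (2 * a) := by
      rw [abs_mul]
      set u := |clip M y - y| with hu
      have hu2 : u ^ 2 ≤ 2 * I y := by
        by_cases hy : y ∈ {x : ℝ | M < |x|}
        · have h3 : u ≤ |y| := by
            have := abs_clip_sub_le hM y
            rwa [Set.indicator_of_mem hy] at this
          have h4 := Real.quadratic_le_exp_of_nonneg (abs_nonneg y)
          rw [hI, Set.indicator_of_mem hy]
          have h5 : u ^ 2 ≤ |y| ^ 2 := pow_le_pow_left₀ (abs_nonneg _) h3 2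
          nlinarith [abs_nonneg y]
        · have h3 := abs_clip_sub_le hM y
          rw [Set.indicator_of_notMem hy] at h3
          rw [hI, Set.indicator_of_notMem hy]
          have : u = 0 := le_antisymm h3 (abs_nonneg _)
          rw [this]; norm_num
      -- Young's inequality: the factor x is unbounded, so the product is split with a free weight,
      -- and the clipping error u² is paid by the exponential tail.
      have h6 : |x| * u ≤ a * u ^ 2 / 2 + x ^ 2 / (2 * a) := by
        have h7 : a * u ^ 2 / 2 + x ^ 2 / (2 * a) - |x| * u = (a * u - |x|) ^ 2 / (2 * a) := by
          rw [← sq_abs x]; field_simp; ring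
        have : 0 ≤ (a * u - |x|) ^ 2 / (2 * a) := by positivity
        linarith
      nlinarith
    rw [e]
    exact (abs_add_le _ _).trans (by linarith)
  have hprod : Integrable (fun z => m.transformed j z * m.transformed k z) m.law :=
    (m.memLp_transformed j).integrable_mul (m.memLp_transformed k)
  have hclip : Integrable (fun z => clip M (m.transformed j z) * clip M (m.transformed k z))
      m.law := by
    refine (integrable_const (M * M)).mono'
      (((measurable_clip M).comp (m.measurable_transformed j)).mul
        ((measurable_clip M).comp (m.measurable_transformed k))).aestronglyMeasurable
      (Filter.Eventually.of_forall fun z => ?_)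
    rw [Real.norm_eq_abs, abs_mul]
    exact mul_le_mul (abs_clip_le hM _) (abs_clip_le hM _) (abs_nonneg _) hM
  rw [← integral_sub hclip hprod]
  have hab : Integrable (fun z => M * I (m.transformed j z) + a * I (m.transformed k z)) m.law :=
    ((hIi j).const_mul M).add ((hIi k).const_mul a)
  have hbi : Integrable (fun z => M * I (m.transformed j z) + a * I (m.transformed k z)
      + (m.transformed j z) ^ 2 / (2 * a)) m.law :=
    hab.add (hsq.div_const _)
  refine (norm_integral_le_of_norm_le (f := fun z => clip M (m.transformed j z)
    * clip M (m.transformed k z) - m.transformed j z * m.transformed k z) hbi (Filter.Eventually.of_forall fun z =>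
    hpt (m.transformed j z) (m.transformed k z))).trans ?_
  rw [integral_add hab (hsq.div_const _),
    integral_add ((hIi j).const_mul M) ((hIi k).const_mul a), integral_const_mul,
    integral_const_mul, integral_div]
  have h1 := mul_le_mul_of_nonneg_left (hII j) hM
  have h2 := mul_le_mul_of_nonneg_left (hII k) ha.le
  have h3 : (∫ z, (m.transformed j z) ^ 2 ∂m.law) / (2 * a) ≤ (1 + B ^ 2) / (2 * a) := by
    have := m.integral_sq_transformed_le hB j
    gcongr
  linarith

/-- The averages of the truncated products are close to their expectations. -/
def PairGood (m : SeLDAModel p) (D : Fin n → Obs p) (M δ : ℝ) (j k : Fin p) : Prop :=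
  |empMean (fun i => clip M (m.transformed j (D i)) * clip M (m.transformed k (D i)))
    - ∫ z, clip M (m.transformed j z) * clip M (m.transformed k z) ∂m.law| ≤ M * M * δ

theorem IsSample.pairGood_prob (hn : 0 < n) (hZ : IsSample m Pr Z) (j k : Fin p)
    (hM : 0 < M) (hδ : 0 ≤ δ) :
    Pr.real {ω | ¬ PairGood m (fun i => Z i ω) M δ j k} ≤ 2 * Real.exp (-(n * δ ^ 2 / 2)) :=
  hZ.hoeffding hn (f := fun z => clip M (m.transformed j z) * clip M (m.transformed k z))
    (((measurable_clip M).comp (m.measurable_transformed j)).mul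
        ((measurable_clip M).comp (m.measurable_transformed k))) (by positivity) (fun z => by
      rw [abs_mul]
      exact mul_le_mul (abs_clip_le hM.le _) (abs_clip_le hM.le _) (abs_nonneg _) hM.le) hδ

/-- The constant in the bound for the sample covariances. -/
noncomputable def covConst (q₀ B : ℝ) : ℝ :=
  4 * CoordGood.scoreConst q₀ B + (1 + 4 * Real.exp (B + 1 / 2) + (1 + B ^ 2))
    + (1 + B) * (4 * CoordGood.scoreConst q₀ B)

/-- Pass from products of scores to products of clipped variables, then to their expectation, then
to the untruncated moment; the product of column means is treated apart. Each exchange in a product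
costs a factor of order M, hence the square of e^{(B+2)M}. -/
theorem abs_sampleCov_sub_le (t : Tuning n N q₀ m.posProb B M δ) (hB : ∀ j, |m.muNeg j| ≤ B)
    (hnδ : 1 / (n : ℝ) ≤ δ) (hM1 : 1 ≤ M)
    (hc : OrderCompatible m D) {j k : Fin p} (gj : DataGood m D M δ N j)
    (gk : DataGood m D M δ N k) (gjk : PairGood m D M δ j k) :
    |sampleCov (pseudo D) j k - m.omega j k|
      ≤ covConst q₀ B * (Real.exp ((B + 2) * M) ^ 2 * δ) := by
  set C := CoordGood.scoreConst q₀ B with hC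
  set R := Real.exp ((B + 2) * M) with hR
  have hq := t.q₀_pos
  have hδ := t.D_pos
  have hM := t.M_nonneg
  have hB0 := t.B_nonneg
  have hn : (0 : ℝ) < n := by exact_mod_cast t.n_pos
  have hCp : 0 < C := CoordGood.scoreConst_pos hq
  obtain ⟨e1, e2, e3, e4, e5⟩ := t.exp_bounds
  rw [← hR] at e3 e4 e5
  have hR1 : 1 ≤ R := e1.trans e3
  rw [sampleCov_eq_mean_mul_sub t.n_pos.ne', m.omega_eq]
  change |empMean (fun i => pseudo D i j * pseudo D i k) - _ - _| ≤ _
  have s1 : |empMean (fun i => pseudo D i j * pseudo D i k)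
      - empMean (fun i => clip M (m.transformed j (D i)) * clip M (m.transformed k (D i)))|
      ≤ 4 * C * (R ^ 2 * δ) := by
    rw [← empMean_sub]
    refine (abs_empMean_le _).trans ((empMean_mono fun i => abs_mul_sub_mul_le
      (gk.abs_pseudo_le t hc i) (abs_clip_le hM (m.transformed j (D i)))).trans ?_)
    rw [empMean_add, empMean_mul_left, empMean_mul_left]
    have h1 := mul_le_mul_of_nonneg_left (gj.mean_abs_sub_clip_le t hB hc) hM
    have h2 := mul_le_mul_of_nonneg_left (gk.mean_abs_sub_clip_le t hB hc) hM
    have h3 : M * (2 * C * (R * δ)) ≤ R * (2 * C * (R * δ)) :=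
      mul_le_mul_of_nonneg_right e5 (by positivity)
    have h4 : R * (2 * C * (R * δ)) = 2 * C * (R ^ 2 * δ) := by ring
    linarith
  have s2 : |∫ z, clip M (m.transformed j z) * clip M (m.transformed k z) ∂m.law
      - ∫ z, m.transformed j z * m.transformed k z ∂m.law|
      ≤ (4 * Real.exp (B + 1 / 2) + (1 + B ^ 2)) * (R ^ 2 * δ) := by
    -- The weight is a = n: the tail term remains small because n e^{-M²/2} < 1/n ≤ δ, and the
    -- second moment is divided by 2n.
    refine (m.abs_integral_clip_mul_clip_sub_le hM hB j k hn).trans ?_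
    have hg : gaussTail B M ≤ 2 * Real.exp (B + 1 / 2) * (R * δ) :=
      t.gaussTail_le.trans (by gcongr)
    have hgn : (n : ℝ) * gaussTail B M ≤ 2 * Real.exp (B + 1 / 2) * (R * δ) := by
      have h2 : gaussTail B M = 2 * Real.exp (B + 1 / 2)
          * (Real.exp ((B + 1) * M) * Real.exp (-M ^ 2 / 2)) := by
        rw [gaussTail, ← Real.exp_add, mul_assoc, ← Real.exp_add]
        ring_nf
      have h3 : (n : ℝ) * Real.exp (-M ^ 2 / 2) ≤ δ := by
        refine le_trans ?_ hnδ
        calc (n : ℝ) * Real.exp (-M ^ 2 / 2) ≤ n * (1 / (n : ℝ) ^ 2) :=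
              mul_le_mul_of_nonneg_left t.exp_lt.le hn.le
          _ = 1 / n := by field_simp
      calc (n : ℝ) * gaussTail B M = 2 * Real.exp (B + 1 / 2)
            * (Real.exp ((B + 1) * M) * (n * Real.exp (-M ^ 2 / 2))) := by rw [h2]; ring
        _ ≤ _ := by gcongr
    have h1 : M * gaussTail B M ≤ 2 * Real.exp (B + 1 / 2) * (R ^ 2 * δ) := by
      calc M * gaussTail B M ≤ R * (2 * Real.exp (B + 1 / 2) * (R * δ)) :=
            mul_le_mul e5 hg (gaussTail_pos B M).le (by positivity)
        _ = _ := by ring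
    have hRR : R * δ ≤ R ^ 2 * δ := by
      have : R ≤ R ^ 2 := by nlinarith
      gcongr
    have hδR : δ ≤ R ^ 2 * δ := by
      have : 1 ≤ R ^ 2 := one_le_pow₀ hR1
      nlinarith
    have h4 : (n : ℝ) * gaussTail B M ≤ 2 * Real.exp (B + 1 / 2) * (R ^ 2 * δ) :=
      hgn.trans (by gcongr)
    have h5 : (1 + B ^ 2) / (2 * n) ≤ (1 + B ^ 2) * (R ^ 2 * δ) := by
      calc (1 + B ^ 2) / (2 * n) ≤ (1 + B ^ 2) / n := by gcongr; linarith
        _ = (1 + B ^ 2) * (1 / n) := by ring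
        _ ≤ (1 + B ^ 2) * (R ^ 2 * δ) := by gcongr; exact hnδ.trans hδR
    linarith
  have s3 : M * M * δ ≤ R ^ 2 * δ := by
    have : M * M ≤ R ^ 2 := by rw [sq]; gcongr
    gcongr
  have hEU : |∫ z, m.transformed j z ∂m.law| ≤ B := by
    rw [m.integral_transformed, show m.classMean j true = 0 from rfl, mul_zero, zero_add, abs_mul,
      abs_of_pos (m.classProb_pos false)]
    calc _ ≤ 1 * B := mul_le_mul (t.classProb_le_one false) (m.abs_classMean_le hB j false)
          (abs_nonneg _) zero_le_one
      _ = B := one_mul B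
  have hcol : |colMean (pseudo D) k| ≤ M := by
    refine (abs_empMean_le fun i => pseudo D i k).trans
      ((empMean_mono fun i => gk.abs_pseudo_le t hc i).trans (le_of_eq ?_))
    simp [empMean, t.n_ne_zero]
  have s4 : |colMean (pseudo D) j * colMean (pseudo D) k
      - (∫ z, m.transformed j z ∂m.law) * ∫ z, m.transformed k z ∂m.law|
      ≤ (1 + B) * (4 * C) * (R ^ 2 * δ) := by
    refine (abs_mul_sub_mul_le (M := max M B) (hcol.trans (le_max_left _ _))
      (hEU.trans (le_max_right _ _))).trans ?_
    have h1 := gj.abs_colMean_sub_le t hB hc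
    have h2 := gk.abs_colMean_sub_le t hB hc
    have hmax : 2 * max M B ≤ (1 + B) * R := by
      have hR2 : 2 * M + 1 ≤ R := by
        have h3 := Real.add_one_le_exp ((B + 2) * M)
        have h4 : 0 ≤ B * M := by positivity
        linarith
      rw [mul_max_of_nonneg _ _ zero_le_two]
      refine max_le ?_ ?_ <;> nlinarith
    have hm0 : 0 ≤ max M B := hM.trans (le_max_left _ _)
    calc _ ≤ max M B * (4 * C * (R * δ)) + max M B * (4 * C * (R * δ)) :=
          add_le_add (mul_le_mul_of_nonneg_left h1 hm0) (mul_le_mul_of_nonneg_left h2 hm0)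
      _ = 2 * max M B * (4 * C * (R * δ)) := by ring
      _ ≤ (1 + B) * R * (4 * C * (R * δ)) := mul_le_mul_of_nonneg_right hmax (by positivity)
      _ = _ := by ring
  have hpg : |_ - _| ≤ _ := gjk
  have hfin : covConst q₀ B * (R ^ 2 * δ) = 4 * C * (R ^ 2 * δ) + R ^ 2 * δ
      + (4 * Real.exp (B + 1 / 2) + (1 + B ^ 2)) * (R ^ 2 * δ)
      + (1 + B) * (4 * C) * (R ^ 2 * δ) := by rw [covConst]; ring
  rw [hfin]
  rw [abs_le] at s1 s2 s4 hpg ⊢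
  constructor <;> linarith

end Sample

/-! ### Choice of truncation and deviation; comparison with ζ₁ and ζ₂ -/

section Rates

open Filter Topology

/-- The truncation level used for samples of size `n`. -/
noncomputable def truncLevel (n : ℕ) : ℝ := √(4 * Real.log n + 1)

theorem one_le_truncLevel (n : ℕ) : 1 ≤ truncLevel n := by
  have : 0 ≤ Real.log n := Real.log_natCast_nonneg n
  rw [truncLevel, Real.one_le_sqrt]
  linarith

theorem exp_neg_truncLevel_lt {n : ℕ} (hn : 0 < n) :
    Real.exp (-(truncLevel n) ^ 2 / 2) < 1 / (n : ℝ) ^ 2 := by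
  have h0 : 0 ≤ Real.log n := Real.log_natCast_nonneg n
  have hn' : (0 : ℝ) < n := by exact_mod_cast hn
  have h1 : 1 / (n : ℝ) ^ 2 = Real.exp (-(2 * Real.log n)) := by
    rw [Real.exp_neg, two_mul, Real.exp_add, Real.exp_log hn', one_div, sq]
  rw [h1, Real.exp_lt_exp, truncLevel, Real.sq_sqrt (by linarith)]
  linarith

/-- The truncation level grows like √(log n), slower than any multiple of log n. For log n ≥ 1 one
has b²(4 log n + 1) ≤ 5b² log n, whence the constant 5. -/
theorem eventually_exp_truncLevel_le (b : ℝ) {η : ℝ} (hη : 0 < η) :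
    ∀ᶠ n : ℕ in atTop, Real.exp (b * truncLevel n) ≤ (n : ℝ) ^ η := by
  have hlog : Tendsto (fun n : ℕ => Real.log n) atTop atTop :=
    Real.tendsto_log_atTop.comp tendsto_natCast_atTop_atTop
  filter_upwards [hlog.eventually_ge_atTop 1, hlog.eventually_ge_atTop (5 * b ^ 2 / η ^ 2),
    eventually_gt_atTop 0] with n h1 h2 hn
  have hn' : (0 : ℝ) < n := by exact_mod_cast hn
  rw [Real.rpow_def_of_pos hn', Real.exp_le_exp]
  have h3 : 5 * b ^ 2 ≤ Real.log n * η ^ 2 := by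
    rwa [div_le_iff₀ (by positivity)] at h2
  refine abs_le_of_sq_le_sq' ?_ (by positivity) |>.2
  rw [mul_pow, truncLevel, Real.sq_sqrt (by linarith)]
  nlinarith [sq_nonneg b]

theorem eventually_log_le_rpow (a : ℝ) {r : ℝ} (hr : 0 < r) :
    ∀ᶠ n : ℕ in atTop, a * (1 + Real.log (26 * n)) ≤ (n : ℝ) ^ r := by
  have hl : (fun x : ℝ => a * (1 + Real.log 26 + Real.log x)) =o[atTop] fun x : ℝ => x ^ r := by
    refine Asymptotics.IsLittleO.const_mul_left (Asymptotics.IsLittleO.add ?_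
      (isLittleO_log_rpow_atTop hr)) a
    refine Asymptotics.isLittleO_const_left.2 (Or.inr ?_)
    exact tendsto_norm_atTop_atTop.comp (tendsto_rpow_atTop hr)
  have h := (hl.bound one_pos).and (eventually_gt_atTop 0)
  filter_upwards [tendsto_natCast_atTop_atTop.eventually h] with n hn
  rw [Real.log_mul (by norm_num) hn.2.ne', ← add_assoc]
  have h1 := hn.1
  rw [one_mul, Real.norm_of_nonneg (Real.rpow_nonneg hn.2.le r)] at h1
  exact (le_abs_self _).trans h1

theorem eventually_natCast_rpow_ge (a : ℝ) {r : ℝ} (hr : 0 < r) :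
    ∀ᶠ n : ℕ in atTop, a ≤ (n : ℝ) ^ r :=
  ((tendsto_rpow_atTop hr).comp tendsto_natCast_atTop_atTop).eventually_ge_atTop a

/-- Only the middle term of the class +1 part is kept; c ≤ ρ and q < 1 make its exponent at most
n^{1-2ρ}t²/4 in size. -/
theorem exp_le_zeta1 {c ρ q t : ℝ} (hc : 0 < c) (hcρ : c ≤ ρ) (hq : 0 < q) (hq' : q < 1) (n : ℕ) :
    4 * Real.exp (-((n : ℝ) ^ (1 - 2 * ρ) * t ^ 2 / 4)) ≤ zeta1 c ρ q n t := by
  have hρ : 0 < ρ := hc.trans_le hcρ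
  have h1 : 4 * Real.exp (-((n : ℝ) ^ (1 - 2 * ρ) * t ^ 2 / 4))
      ≤ 4 * Real.exp (-c * (n : ℝ) ^ (1 - 2 * ρ) * (√q * t / 2) ^ 2 / ρ) := by
    refine mul_le_mul_of_nonneg_left (Real.exp_le_exp.2 ?_) (by norm_num)
    have hX : 0 ≤ (n : ℝ) ^ (1 - 2 * ρ) * t ^ 2 := by positivity
    have e : -c * (n : ℝ) ^ (1 - 2 * ρ) * (√q * t / 2) ^ 2 / ρ
        = -(c / ρ * q * ((n : ℝ) ^ (1 - 2 * ρ) * t ^ 2 / 4)) := by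
      rw [div_pow, mul_pow, Real.sq_sqrt hq.le]; ring
    rw [e]
    have h2 : c / ρ * q ≤ 1 := by
      have : c / ρ ≤ 1 := (div_le_one hρ).2 hcρ
      have : 0 < c / ρ := by positivity
      nlinarith
    nlinarith
  unfold zeta1 zeta1Star
  have p1 := Real.exp_pos (-c * n * (√q * t / 2) ^ 2)
  have p2 := Real.exp_pos (-c * (n : ℝ) ^ (1 / 2 - ρ))
  have p3 := Real.exp_pos (-c * n * (√(1 - q) * t / 2) ^ 2)
  have p4 := Real.exp_pos (-c * (n : ℝ) ^ (1 - 2 * ρ) * (√(1 - q) * t / 2) ^ 2 / ρ)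
  have p5 := Real.exp_pos (-c * (n : ℝ))
  linarith

theorem zeta1_nonneg (c ρ q : ℝ) (n : ℕ) (t : ℝ) : 0 ≤ zeta1 c ρ q n t := by
  unfold zeta1 zeta1Star; positivity

theorem exp_le_zeta2 {c C ρ q t : ℝ} (hC : 0 < C) (n : ℕ) :
    C * Real.exp (-c * (n : ℝ) ^ (1 / 3 - ρ)) ≤ zeta2 c C ρ q n t := by
  have hz := zeta1_nonneg c ρ q n t
  unfold zeta2 zeta2Star
  have p1 := mul_pos hC (Real.exp_pos (-c * n * (√q * t / 2) ^ 2))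
  have p2 := mul_pos hC (Real.exp_pos (-c * (n : ℝ) ^ (1 - ρ)))
  have p3 := mul_pos hC (Real.exp_pos (-c * (Real.log n) ^ 2 * (n : ℝ) ^ (1 - 2 * ρ)
    * (√q * t / 2) ^ 2 / ρ ^ 2))
  have p4 : 0 < C * Real.exp (-c * n * (√(1 - q) * t / 2) ^ 2)
    + C * Real.exp (-c * (n : ℝ) ^ (1 / 3 - ρ))
    + C * Real.exp (-c * (n : ℝ) ^ (1 - ρ))
    + C * Real.exp (-c * (Real.log n) ^ 2 * (n : ℝ) ^ (1 - 2 * ρ)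
      * (√(1 - q) * t / 2) ^ 2 / ρ ^ 2) := by positivity
  have p5 := Real.exp_pos (-c * (n : ℝ))
  linarith

theorem zeta2_nonneg {c C ρ q t : ℝ} (hC : 0 < C) (n : ℕ) : 0 ≤ zeta2 c C ρ q n t :=
  (mul_pos hC (Real.exp_pos _)).le.trans (exp_le_zeta2 hC n)

/-- The tuning parameters are admissible as soon as `D` lies between `1 / n` and `q₀ / 4`. -/
theorem tuning_of_le {n : ℕ} {q₀ q B D : ℝ} (hq₀ : 0 < q₀) (h1 : q₀ ≤ q) (h2 : q₀ ≤ 1 - q)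
    (hB : 0 ≤ B) (hn : 0 < n) (hn2 : 2 / q₀ ^ 2 ≤ n) (hD : 1 / (n : ℝ) ≤ D) (hD' : D ≤ q₀ / 4) :
    Tuning n n q₀ q B (truncLevel n) D where
  q₀_pos := hq₀
  q₀_le := h1
  q₀_le' := h2
  B_nonneg := hB
  M_nonneg := zero_le_one.trans (one_le_truncLevel n)
  D_pos := lt_of_lt_of_le (by positivity) hD
  D_le := hD'
  n_pos := hn
  N_pos := hn
  N_inv_le := hD
  n_inv_le := by
    have hn' : (0 : ℝ) < n := by exact_mod_cast hn
    refine le_trans ?_ hD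
    rw [div_le_iff₀ (by positivity)] at hn2
    rw [div_le_div_iff₀ (by positivity) hn', mul_pow]
    nlinarith
  exp_lt := exp_neg_truncLevel_lt hn

variable {ρ q B : ℝ}

theorem coord_factor_le {n : ℕ} (hn : 0 < n) : (4 * n + 8 : ℝ) ≤ Real.exp (Real.log (26 * n)) := by
  have hn' : (1 : ℝ) ≤ n := by exact_mod_cast hn
  rw [Real.exp_log (by positivity)]
  linarith

/-- Concentration of the estimated mean differences. -/
theorem eventually_mean_prob (hρ : 0 < ρ) (hq : 0 < q) (hq' : q < 1) (hB : 0 ≤ B) (T : ℝ) {c : ℝ}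
    (hc : 0 < c) (hcρ : c ≤ ρ) :
    ∀ᶠ n : ℕ in atTop, ∀ (p : ℕ) (m : SeLDAModel p), m.posProb = q → (∀ j, |m.muNeg j| ≤ B) →
      ∀ (Ω : Type*) [MeasurableSpace Ω] (Pr : Measure Ω) [IsProbabilityMeasure Pr]
        (Z : Fin n → Ω → Obs p), IsSample m Pr Z → ∀ (j : Fin p) (t : ℝ), 0 < t → t ≤ T →
        Pr.real {ω | ¬ ((∀ y, classSize (fun i => Z i ω) y ≠ 0) ∧
          |crossMean (response fun i => Z i ω) (pseudo fun i => Z i ω) j - m.meanDiff j| ≤ t / 2)}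
          ≤ zeta1 c ρ q n t := by
  set q₀ := min q (1 - q) with hq₀def
  have hq₀ : 0 < q₀ := lt_min hq (by linarith)
  set A := 8 / (3 * q₀) * (2 * CoordGood.scoreConst q₀ B + B) with hA
  have hA0 : 0 < A := by
    have := CoordGood.scoreConst_pos (B := B) hq₀
    positivity
  have hρ2 : 0 < ρ / 2 := by positivity
  filter_upwards [eventually_exp_truncLevel_le (B + 2) hρ2,
    eventually_natCast_rpow_ge (2 * T / (A * q₀)) hρ2, eventually_natCast_rpow_ge (2 * A) hρ2,
    tendsto_natCast_atTop_atTop.eventually_ge_atTop (2 / q₀ ^ 2),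
    eventually_log_le_rpow (8 * A ^ 2) hρ, eventually_gt_atTop 0]
    with n hR hT hA2 hn2 hlog hn p m hmq hmB Ω _ Pr _ Z hZ j t ht htT
  have hn' : (0 : ℝ) < n := by exact_mod_cast hn
  have hn1 : (1 : ℝ) ≤ n := by exact_mod_cast hn
  set X := (n : ℝ) ^ (1 - 2 * ρ) * t ^ 2 with hX
  have hX0 : 0 < X := by positivity
  refine le_trans ?_ (exp_le_zeta1 hc hcρ hq hq' n)
  rw [← hX]
  -- For X < 1 the bound 4e^{-X/4} exceeds 1 and nothing has to be proved.
  rcases lt_or_ge X 1 with hX1 | hX1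
  · refine measureReal_le_one.trans ?_
    have := Real.add_one_le_exp (-(X / 4))
    linarith
  set r := (n : ℝ) ^ (ρ / 2) with hr
  have hr0 : 0 < r := by positivity
  -- Chosen so that A r δ = t/2, where r = n^{ρ/2} dominates e^{(B+2)M}.
  set δ := t / (2 * A * r) with hδ
  have hδ0 : 0 < δ := by positivity
  have hnδ2 : (n : ℝ) * δ ^ 2 = (n : ℝ) ^ ρ * X / (4 * A ^ 2) := by
    have e1 : (n : ℝ) = (n : ℝ) ^ ρ * (n : ℝ) ^ (1 - 2 * ρ) * r ^ 2 := by
      rw [hr, ← Real.rpow_natCast ((n : ℝ) ^ (ρ / 2)) 2, ← Real.rpow_mul hn'.le,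
        ← Real.rpow_add hn', ← Real.rpow_add hn']
      have : ρ + (1 - 2 * ρ) + ρ / 2 * (2 : ℕ) = 1 := by push_cast; ring
      rw [this, Real.rpow_one]
    have e2 : (n : ℝ) * δ ^ 2 = ((n : ℝ) ^ ρ * (n : ℝ) ^ (1 - 2 * ρ) * r ^ 2) * δ ^ 2 := by
      rw [← e1]
    rw [e2, hδ, hX]
    field_simp
    ring
  -- The case X ≥ 1 enters here: nδ² = n^ρ X/(4A²) ≥ 1, so δ ≥ n^{-1/2} ≥ 1/n, as required for a
  -- grid of n points.
  have hnδ : 1 / (n : ℝ) ≤ δ := by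
    have h1 : 1 ≤ (n : ℝ) * δ ^ 2 := by
      rw [hnδ2, le_div_iff₀ (by positivity)]
      have h2 : (n : ℝ) ^ ρ = r ^ 2 := by
        rw [hr, ← Real.rpow_natCast ((n : ℝ) ^ (ρ / 2)) 2, ← Real.rpow_mul hn'.le]
        congr 1; push_cast; ring
      have h3 : (2 * A) ^ 2 ≤ r ^ 2 := pow_le_pow_left₀ (by positivity) hA2 2
      rw [h2]
      nlinarith
    have h2 : (1 / (n : ℝ)) ^ 2 ≤ δ ^ 2 := by
      have : (1 / (n : ℝ)) ^ 2 ≤ 1 / n := by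
        rw [div_pow, one_pow]
        exact one_div_le_one_div_of_le hn' (by nlinarith)
      refine this.trans ?_
      rw [div_le_iff₀ hn']
      linarith
    exact abs_le_of_sq_le_sq' h2 hδ0.le |>.2
  have hδq : δ ≤ q₀ / 4 := by
    rw [hδ, div_le_iff₀ (by positivity)]
    rw [div_le_iff₀ (by positivity)] at hT
    linarith
  have tun : Tuning n n q₀ m.posProb B (truncLevel n) δ := by
    rw [hmq]
    exact tuning_of_le hq₀ (min_le_left _ _) (min_le_right _ _) hB hn hn2 hnδ hδq
  have hM0 : 0 < truncLevel n := zero_lt_one.trans_le (one_le_truncLevel n)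
  have hsub : {ω | ¬ ((∀ y, classSize (fun i => Z i ω) y ≠ 0) ∧
      |crossMean (response fun i => Z i ω) (pseudo fun i => Z i ω) j - m.meanDiff j| ≤ t / 2)}
      ≤ᵐ[Pr] {ω | ¬ DataGood m (fun i => Z i ω) (truncLevel n) δ n j} := by
    filter_upwards [hZ.ae_orderCompatible] with ω hω hbad hgood
    refine hbad ⟨hgood.classSize_ne_zero tun, ?_⟩
    refine (hgood.abs_crossMean_sub_le tun hmB hω).trans ?_
    calc A * (Real.exp ((B + 2) * truncLevel n) * δ) ≤ A * (r * δ) := by gcongr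
      _ = t / 2 := by rw [hδ]; field_simp
  have h1 : Pr.real {ω | ¬ ((∀ y, classSize (fun i => Z i ω) y ≠ 0) ∧
      |crossMean (response fun i => Z i ω) (pseudo fun i => Z i ω) j - m.meanDiff j| ≤ t / 2)}
      ≤ Pr.real {ω | ¬ DataGood m (fun i => Z i ω) (truncLevel n) δ n j} :=
    ENNReal.toReal_mono (measure_ne_top _ _) (measure_mono_ae hsub)
  refine h1.trans ((hZ.coordGood_prob hn j hM0 hδ0.le n).trans ?_)
  calc (4 * n + 8 : ℝ) * Real.exp (-(n * δ ^ 2 / 2))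
      ≤ Real.exp (Real.log (26 * n)) * Real.exp (-(n * δ ^ 2 / 2)) :=
        mul_le_mul_of_nonneg_right (coord_factor_le hn) (Real.exp_pos _).le
    _ ≤ Real.exp (-X) := by
        rw [← Real.exp_add, Real.exp_le_exp, hnδ2]
        have h2 : 0 ≤ Real.log (26 * n) := Real.log_nonneg (by linarith)
        -- The spare power n^ρ beats the logarithm of the union-bound factor; since X ≥ 1, that
        -- logarithm is at most its product with X, leaving e^{-X}.
        have h3 : (1 + Real.log (26 * n)) * X ≤ (n : ℝ) ^ ρ * X / (4 * A ^ 2) / 2 := by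
          rw [div_div, le_div_iff₀ (by positivity)]
          calc _ = 8 * A ^ 2 * (1 + Real.log (26 * n)) * X := by ring
            _ ≤ _ := mul_le_mul_of_nonneg_right hlog hX0.le
        nlinarith
    _ ≤ 4 * Real.exp (-(X / 4)) := by
        have : Real.exp (-X) ≤ Real.exp (-(X / 4)) := Real.exp_le_exp.2 (by linarith)
        have := Real.exp_pos (-(X / 4))
        linarith

/-- Concentration of the estimated covariances. -/
theorem eventually_cov_prob (hρ : 0 < ρ) (hρ' : ρ < 1 / 3) (hq : 0 < q) (hq' : q < 1) (hB : 0 ≤ B)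
    {c : ℝ} (hc : c ≤ 1 / 4) :
    ∃ K : ℝ, 0 < K ∧ ∀ᶠ n : ℕ in atTop, ∀ (p : ℕ) (m : SeLDAModel p), m.posProb = q →
      (∀ j, |m.muNeg j| ≤ B) →
      ∀ (Ω : Type*) [MeasurableSpace Ω] (Pr : Measure Ω) [IsProbabilityMeasure Pr]
        (Z : Fin n → Ω → Obs p), IsSample m Pr Z → ∀ (j k : Fin p) (t : ℝ),
        K * (n : ℝ) ^ (-ρ / 2) ≤ t →
        Pr.real {ω | ¬ |sampleCov (pseudo fun i => Z i ω) j k - m.omega j k| ≤ t / 2}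
          ≤ zeta2 c 1 ρ q n t := by
  set q₀ := min q (1 - q) with hq₀def
  have hq₀ : 0 < q₀ := lt_min hq (by linarith)
  have hC0 : 0 < covConst q₀ B := by
    have := CoordGood.scoreConst_pos (B := B) hq₀
    unfold covConst
    positivity
  refine ⟨2 * covConst q₀ B, by positivity, ?_⟩
  filter_upwards [eventually_exp_truncLevel_le (B + 2)
      (show (0 : ℝ) < 1 / 12 by norm_num),
    eventually_natCast_rpow_ge (4 / q₀) (show (0 : ℝ) < 1 / 3 by norm_num),
    tendsto_natCast_atTop_atTop.eventually_ge_atTop (2 / q₀ ^ 2),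
    eventually_log_le_rpow 4 (show (0 : ℝ) < 1 / 3 by norm_num), eventually_gt_atTop 0]
    with n hR hn3 hn2 hlog hn p m hmq hmB Ω _ Pr _ Z hZ j k t ht
  have hn' : (0 : ℝ) < n := by exact_mod_cast hn
  have hn1 : (1 : ℝ) ≤ n := by exact_mod_cast hn
  -- The exponent 1/3 serves twice. The losses e^{2(B+2)M} ≤ n^{1/6} leave an error n^{-1/6} ≤
  -- n^{-ρ/2}, since ρ < 1/3, and nδ² = n^{1/3} exceeds n^{1/3-ρ} with room for the union bound.
  set δ := (n : ℝ) ^ (-(1 / 3) : ℝ) with hδ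
  have hδ0 : 0 < δ := by positivity
  have hnδ : 1 / (n : ℝ) ≤ δ := by
    rw [one_div, ← Real.rpow_neg_one]
    exact Real.rpow_le_rpow_of_exponent_le hn1 (by norm_num)
  have hδq : δ ≤ q₀ / 4 := by
    rw [hδ, Real.rpow_neg hn'.le, inv_le_comm₀ (by positivity) (by positivity), inv_div]
    exact hn3
  have tun : Tuning n n q₀ m.posProb B (truncLevel n) δ := by
    rw [hmq]
    exact tuning_of_le hq₀ (min_le_left _ _) (min_le_right _ _) hB hn hn2 hnδ hδq
  have hM1 := one_le_truncLevel n
  have hM0 : 0 < truncLevel n := zero_lt_one.trans_le hM1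
  have hR2 : Real.exp ((B + 2) * truncLevel n) ^ 2 * δ ≤ (n : ℝ) ^ (-ρ / 2) := by
    calc _ ≤ ((n : ℝ) ^ (1 / 12 : ℝ)) ^ 2 * δ := by gcongr
      _ = (n : ℝ) ^ (-(1 / 6) : ℝ) := by
          rw [hδ, ← Real.rpow_natCast ((n : ℝ) ^ (1 / 12 : ℝ)) 2, ← Real.rpow_mul hn'.le,
            ← Real.rpow_add hn']
          congr 1; norm_num
      _ ≤ _ := Real.rpow_le_rpow_of_exponent_le hn1 (by linarith)
  set bj := {ω | ¬ DataGood m (fun i => Z i ω) (truncLevel n) δ n j} with hbj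
  set bk := {ω | ¬ DataGood m (fun i => Z i ω) (truncLevel n) δ n k} with hbk
  set bjk := {ω | ¬ PairGood m (fun i => Z i ω) (truncLevel n) δ j k} with hbjk
  have hsub : {ω | ¬ |sampleCov (pseudo fun i => Z i ω) j k - m.omega j k| ≤ t / 2}
      ≤ᵐ[Pr] (bj ∪ bk ∪ bjk : Set Ω) := by
    filter_upwards [hZ.ae_orderCompatible] with ω hω hbad
    by_contra hgood
    have hgood' : ω ∉ bj ∪ bk ∪ bjk := hgood
    simp only [hbj, hbk, hbjk, Set.mem_union, Set.mem_ofPred_eq, not_or, not_not] at hgood'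
    refine hbad ((abs_sampleCov_sub_le tun hmB hnδ hM1 hω hgood'.1.1 hgood'.1.2
      hgood'.2).trans ?_)
    have := mul_le_mul_of_nonneg_left hR2 hC0.le
    linarith
  have h1 : Pr.real {ω | ¬ |sampleCov (pseudo fun i => Z i ω) j k - m.omega j k| ≤ t / 2}
      ≤ Pr.real (bj ∪ bk ∪ bjk) :=
    ENNReal.toReal_mono (measure_ne_top _ _) (measure_mono_ae hsub)
  have h2 : Pr.real (bj ∪ bk ∪ bjk) ≤ Pr.real bj + Pr.real bk + Pr.real bjk :=
    (measureReal_union_le _ _).trans (by linarith [measureReal_union_le (μ := Pr) bj bk])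
  have h3 : Pr.real bj ≤ _ := hZ.coordGood_prob hn j hM0 hδ0.le n
  have h4 : Pr.real bk ≤ _ := hZ.coordGood_prob hn k hM0 hδ0.le n
  have h5 : Pr.real bjk ≤ _ := hZ.pairGood_prob hn j k hM0 hδ0.le
  have hnδ2 : (n : ℝ) * δ ^ 2 = (n : ℝ) ^ (1 / 3 : ℝ) := by
    rw [hδ, ← Real.rpow_natCast ((n : ℝ) ^ (-(1 / 3) : ℝ)) 2, ← Real.rpow_mul hn'.le]
    nth_rewrite 1 [← Real.rpow_one (n : ℝ)]
    rw [← Real.rpow_add hn']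
    congr 1; norm_num
  rw [hnδ2] at h3 h4 h5
  set W := (n : ℝ) ^ (1 / 3 : ℝ) with hW
  refine le_trans ?_ (exp_le_zeta2 one_pos n)
  have h6 : (n : ℝ) ^ (1 / 3 - ρ) ≤ W := Real.rpow_le_rpow_of_exponent_le hn1 (by linarith)
  -- Two coordinate events cost 2(4n + 8) and the pair event 2; the total is at most 26n for n ≥ 1.
  have h7 : (8 * n + 18 : ℝ) ≤ Real.exp (Real.log (26 * n)) := by
    rw [Real.exp_log (by positivity)]; linarith
  calc _ ≤ (8 * n + 18 : ℝ) * Real.exp (-(W / 2)) := by linarith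
    _ ≤ Real.exp (Real.log (26 * n)) * Real.exp (-(W / 2)) :=
        mul_le_mul_of_nonneg_right h7 (Real.exp_pos _).le
    _ ≤ 1 * Real.exp (-c * (n : ℝ) ^ (1 / 3 - ρ)) := by
        rw [← Real.exp_add, one_mul, Real.exp_le_exp]
        have h8 : c * (n : ℝ) ^ (1 / 3 - ρ) ≤ 1 / 4 * W :=
          mul_le_mul hc h6 (by positivity) (by norm_num)
        linarith

end Rates

/-! ### Union bounds and assembly -/

section Main

open Filter

theorem withProbAtLeast_of_real_compl_le {Ω : Type*} [MeasurableSpace Ω] {Pr : Measure Ω}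
    [IsProbabilityMeasure Pr] {E : Ω → Prop} {δ : ℝ} (h : Pr.real {ω | ¬ E ω} ≤ δ) :
    WithProbAtLeast Pr (1 - δ) E := by
  refine ⟨(toMeasurable Pr {ω | ¬ E ω})ᶜ, (measurableSet_toMeasurable _ _).compl, ?_, ?_⟩
  · rw [probReal_compl_eq_one_sub (measurableSet_toMeasurable _ _), measureReal_def,
      measure_toMeasurable, ← measureReal_def]
    linarith
  · intro ω hω
    by_contra hE
    exact hω (subset_toMeasurable _ _ hE)

theorem WithProbAtLeast.and {Ω : Type*} [MeasurableSpace Ω] {Pr : Measure Ω}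
    [IsProbabilityMeasure Pr] {E F : Ω → Prop} {δ δ' : ℝ} (hE : WithProbAtLeast Pr (1 - δ) E)
    (hF : WithProbAtLeast Pr (1 - δ') F) :
    WithProbAtLeast Pr (1 - δ - δ') fun ω => E ω ∧ F ω := by
  obtain ⟨G, hG, hGδ, hGE⟩ := hE
  obtain ⟨G', hG', hGδ', hGF⟩ := hF
  refine ⟨G ∩ G', hG.inter hG', ?_, fun ω hω => ⟨hGE ω hω.1, hGF ω hω.2⟩⟩
  have h1 := measureReal_union_add_inter (μ := Pr) (s := G) hG'
  have h2 := measureReal_le_one (μ := Pr) (s := G ∪ G')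
  linarith

theorem WithProbAtLeast.mono {Ω : Type*} [MeasurableSpace Ω] {Pr : Measure Ω} {E F : Ω → Prop}
    {r : ℝ} (h : WithProbAtLeast Pr r E) (hEF : ∀ ω, E ω → F ω) : WithProbAtLeast Pr r F := by
  obtain ⟨G, hG, hGr, hGE⟩ := h
  exact ⟨G, hG, hGr, fun ω hω => hEF ω (hGE ω hω)⟩

/-- A union bound over entries. That both classes occur is read off the event for a single
coordinate, so `S` must be nonempty. -/
theorem real_not_goodData_le {p n : ℕ} {m : SeLDAModel p} {Ω : Type*} [MeasurableSpace Ω]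
    {Pr : Measure Ω} [IsProbabilityMeasure Pr] {Z : Fin n → Ω → Obs p} {S : Finset (Fin p)}
    (hS : S.Nonempty) {ε τ a b : ℝ}
    (hcov : ∀ j k, Pr.real
      {ω | ¬ |sampleCov (pseudo fun i => Z i ω) j k - m.omega j k| ≤ ε / m.s / 2} ≤ a)
    (hmean : ∀ j, Pr.real {ω | ¬ ((∀ y, classSize (fun i => Z i ω) y ≠ 0) ∧
      |crossMean (response fun i => Z i ω) (pseudo fun i => Z i ω) j - m.meanDiff j| ≤ τ / 2)}
      ≤ b) :
    Pr.real {ω | ¬ GoodData m (fun i => Z i ω) S ε τ} ≤ S.card * m.s * a + S.card * b := by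
  have hsub : {ω | ¬ GoodData m (fun i => Z i ω) S ε τ} ⊆
      (⋃ j ∈ S, ⋃ k ∈ m.active,
        {ω | ¬ |sampleCov (pseudo fun i => Z i ω) j k - m.omega j k| ≤ ε / m.s / 2}) ∪
      ⋃ j ∈ S, {ω | ¬ ((∀ y, classSize (fun i => Z i ω) y ≠ 0) ∧
        |crossMean (response fun i => Z i ω) (pseudo fun i => Z i ω) j - m.meanDiff j|
          ≤ τ / 2)} := by
    intro ω hω
    by_contra hc
    simp only [Set.mem_union, Set.mem_iUnion, Set.mem_ofPred_eq, not_or, not_exists, not_not] at hc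
    obtain ⟨j₀, hj₀⟩ := hS
    exact hω ⟨(hc.2 j₀ hj₀).1, hc.1, fun j hj => (hc.2 j hj).2⟩
  refine (measureReal_mono hsub).trans ((measureReal_union_le _ _).trans (add_le_add ?_ ?_))
  · refine (measureReal_biUnion_finset_le _ _).trans ?_
    calc _ ≤ ∑ j ∈ S, (m.s : ℝ) * a := Finset.sum_le_sum fun j _ => by
          refine (measureReal_biUnion_finset_le _ _).trans ?_
          refine (Finset.sum_le_sum fun k _ => hcov j k).trans_eq ?_
          simp [SeLDAModel.s]
      _ = S.card * m.s * a := by simp [mul_assoc]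
  · refine (measureReal_biUnion_finset_le _ _).trans ?_
    refine (Finset.sum_le_sum fun j _ => hmean j).trans_eq ?_
    simp

theorem exists_goodData_prob {ρ q B : ℝ} (hρ : 0 < ρ) (hρ' : ρ < 1 / 3) (hq : 0 < q) (hq' : q < 1)
    (hB : 0 ≤ B) (T : ℝ) {c : ℝ} (hc : 0 < c) (hcρ : c ≤ ρ) (hc4 : c ≤ 1 / 4) :
    ∃ K : ℝ, 0 < K ∧ ∀ (p n : ℕ) (m : SeLDAModel p), m.posProb = q → (∀ j, |m.muNeg j| ≤ B) →
      1 ≤ n → ∀ (Ω : Type*) [MeasurableSpace Ω] (Pr : Measure Ω) [IsProbabilityMeasure Pr]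
        (Z : Fin n → Ω → Obs p), IsSample m Pr Z → 0 < m.s →
      ∀ (S : Finset (Fin p)) (ε τ : ℝ), S.Nonempty → K * m.s * (n : ℝ) ^ (-ρ / 2) < ε → ε < 1 →
        0 < τ → τ ≤ T → Pr.real {ω | ¬ GoodData m (fun i => Z i ω) S ε τ} ≤
          S.card * m.s * zeta2 c 1 ρ m.posProb n (ε / m.s) + S.card * zeta1 c ρ m.posProb n τ := by
  obtain ⟨K, hK, hcov⟩ := eventually_cov_prob hρ hρ' hq hq' hB hc4
  obtain ⟨N, hN⟩ := eventually_atTop.1 (hcov.and (eventually_mean_prob hρ hq hq' hB T hc hcρ))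
  -- The second entry makes the claim vacuous for n < N: with s ≥ 1 and ε < 1 the lower bound on ε
  -- forces N^{ρ/2} ≤ n^{ρ/2}.
  refine ⟨max K ((N : ℝ) ^ (ρ / 2)), lt_max_of_lt_left hK, ?_⟩
  intro p n m hmq hmB hn Ω _ Pr _ Z hZ hs S ε τ hS hε hε1 hτ hτT
  have hs1 : (1 : ℝ) ≤ m.s := by exact_mod_cast hs
  have hn0 : (0 : ℝ) < n := by exact_mod_cast hn
  have hr : 0 < (n : ℝ) ^ (-ρ / 2) := Real.rpow_pos_of_pos hn0 _
  have hKε : max K ((N : ℝ) ^ (ρ / 2)) * (n : ℝ) ^ (-ρ / 2) ≤ ε / m.s := by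
    rw [le_div_iff₀ (by linarith)]
    linarith
  have hNn : N ≤ n := by
    have h1 : (N : ℝ) ^ (ρ / 2) * (n : ℝ) ^ (-ρ / 2) ≤ 1 := by
      refine (mul_le_mul_of_nonneg_right (le_max_right K _) hr.le).trans (hKε.trans ?_)
      rw [div_le_one (by linarith)]
      linarith
    rw [neg_div, Real.rpow_neg hn0.le, ← div_eq_mul_inv, div_le_one (by positivity)] at h1
    exact_mod_cast (Real.rpow_le_rpow_iff (by positivity) hn0.le (by positivity)).1 h1
  obtain ⟨h1, h2⟩ := hN n hNn
  rw [hmq]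
  refine real_not_goodData_le hS (fun j k => ?_) fun j => h2 p m hmq hmB Ω Pr Z hZ j τ hτ hτT
  exact h1 p m hmq hmB Ω Pr Z hZ j k _
    ((mul_le_mul_of_nonneg_right (le_max_left _ _) hr.le).trans hKε)

namespace SeLDAModel

variable {p : ℕ} {m : SeLDAModel p} {lam ε B : ℝ}

theorem Delta_le (hB : 0 ≤ B) (h : ∀ j, |m.muNeg j| ≤ B) : m.Delta ≤ B :=
  vecInfNorm_le hB fun j => by simpa [meanDiff] using h j

/-- The mean concentration is uniform only for tolerances in a bounded interval; here the tolerance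
is placed in (0, λ], and λ < Δ is bounded through the class means. -/
theorem Admissible.selection_tolerance_bounds (hl : m.Admissible lam) (hκ : m.kappa < 1)
    (hε : 0 < ε)
    (hε' : ε < lam * (1 - m.kappa) / (4 * m.phi * (lam / 2 + (1 + m.kappa)) * m.Delta)) :
    0 < lam * (1 - m.kappa - 2 * ε * m.phi) / (4 * (1 + m.kappa)) ∧
      lam * (1 - m.kappa - 2 * ε * m.phi) / (4 * (1 + m.kappa)) ≤ lam := by
  have hφ := hl.phi_pos
  have hΔ := hl.Delta_pos
  have hlΔ := hl.lt_Delta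
  have hl0 := hl.pos
  have hκ0 : 0 ≤ m.kappa := matInfNorm_nonneg _
  set φ := m.phi
  set Δ := m.Delta
  set κ := m.kappa
  rw [lt_div_iff₀ (by positivity)] at hε'
  have hεφ : 0 < ε * φ := by positivity
  have h1 : 4 * (ε * φ) < 1 - κ := by
    have h2 : 0 < ε * φ * Δ * lam := by positivity
    have h3 : 0 < ε * φ * Δ * κ + ε * φ * Δ := by positivity
    have h4 : lam * (1 - κ) < Δ * (1 - κ) := mul_lt_mul_of_pos_right hlΔ (by linarith)
    have h5 : 0 ≤ ε * φ * Δ * κ := by positivity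
    refine lt_of_mul_lt_mul_left ?_ hΔ.le
    linarith
  constructor
  · have : 0 < 1 - κ - 2 * ε * φ := by linarith
    positivity
  · rw [div_le_iff₀ (by positivity)]
    refine mul_le_mul_of_nonneg_left ?_ hl0.le
    linarith

end SeLDAModel

theorem card_mul_add_le_psi1 {p : ℕ} (m : SeLDAModel p) (c ρ : ℝ) (n : ℕ) (lam ε : ℝ) :
    ((Finset.univ : Finset (Fin p)).card : ℝ) * m.s * zeta2 c 1 ρ m.posProb n (ε / m.s)
      + (Finset.univ : Finset (Fin p)).card * zeta1 c ρ m.posProb n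
        (lam * (1 - m.kappa - 2 * ε * m.phi) / (4 * (1 + m.kappa)))
      ≤ psi1 m c 1 ρ n lam ε := by
  rw [Finset.card_univ, Fintype.card_fin, psi1]
  have h1 := mul_nonneg (by positivity : (0 : ℝ) ≤ p * m.s)
    (zeta2_nonneg (c := c) (ρ := ρ) (q := m.posProb) (t := ε / m.s) one_pos n)
  have h2 := mul_nonneg (Nat.cast_nonneg (α := ℝ) p) (zeta1_nonneg c ρ m.posProb n
    (lam * (1 - m.kappa - 2 * ε * m.phi) / (4 * (1 + m.kappa))))
  linarith

theorem card_mul_add_le_psi2 {p : ℕ} (m : SeLDAModel p) (c ρ : ℝ) (n : ℕ) (ε : ℝ) :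
    (m.active.card : ℝ) * m.s * zeta2 c 1 ρ m.posProb n (ε / m.s)
      + m.active.card * zeta1 c ρ m.posProb n ε ≤ psi2 m c 1 ρ n ε := by
  change (m.s : ℝ) * m.s * _ + m.s * _ ≤ _
  rw [psi2]
  have h1 := mul_nonneg (by positivity : (0 : ℝ) ≤ m.s * m.s)
    (zeta2_nonneg (c := c) (ρ := ρ) (q := m.posProb) (t := ε / m.s) one_pos n)
  have h2 := mul_nonneg (Nat.cast_nonneg (α := ℝ) m.s) (zeta1_nonneg c ρ m.posProb n ε)
  linarith

end Main

end SSDA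

open SSDA MeasureTheory in
theorem theorem2 (ρ q B : ℝ) (hρ : 0 < ρ) (hρ' : ρ < 1 / 3) (hq : 0 < q) (hq' : q < 1) :
    ∃ c C K ε₀ : ℝ, 0 < c ∧ 0 < C ∧ 0 < K ∧ 0 < ε₀ ∧
      ∀ (p n : ℕ) (m : SeLDAModel p), m.posProb = q → (∀ j, |m.muNeg j| ≤ B) → 1 ≤ n →
      ∀ (Ω : Type*) [MeasurableSpace Ω] (Pr : Measure Ω) [IsProbabilityMeasure Pr]
        (Z : Fin n → Ω → Obs p), IsSample m Pr Z →
      ∀ lam : ℝ, 0 < lam → lam < min (m.betaMin / (2 * m.phi)) m.Delta →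
      -- 1. the estimate equals the hypothetical one on `A` and vanishes off `A`
      (m.kappa < 1 → ∀ ε : ℝ, 0 < ε → K * m.s * (n : ℝ) ^ (-ρ / 2) < ε →
        ε < min ε₀ (lam * (1 - m.kappa) /
          (4 * m.phi * (lam / 2 + (1 + m.kappa)) * m.Delta)) →
        WithProbAtLeast Pr (1 - psi1 m c C ρ n lam ε) fun ω =>
          (∃ b, IsSSDA lam (fun i => Z i ω) b) ∧
          (∃ g, IsHyp lam (fun i => Z i ω) m.active g) ∧
          ∀ b g, IsSSDA lam (fun i => Z i ω) b → IsHyp lam (fun i => Z i ω) m.active g →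
            (∀ j : {j // j ∈ m.active}, b j = g j) ∧ ∀ j ∉ m.active, b j = 0) ∧
      -- 2. no coefficient in `A` is zero
      (∀ ε : ℝ, 0 < ε → K * m.s * (n : ℝ) ^ (-ρ / 2) < ε →
        ε < min ε₀ (min (m.nu / ((3 + m.nu) * m.phi)) (m.Delta * m.nu / (6 + 2 * m.nu))) →
        WithProbAtLeast Pr (1 - psi2 m c C ρ n ε) (fun ω =>
          (∃ g, IsHyp lam (fun i => Z i ω) m.active g) ∧
          ∀ g, IsHyp lam (fun i => Z i ω) m.active g → ∀ j, g j ≠ 0) ∧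
        (m.kappa < 1 → ∀ ε₁ : ℝ, 0 < ε₁ → K * m.s * (n : ℝ) ^ (-ρ / 2) < ε₁ →
          ε₁ < min ε₀ (lam * (1 - m.kappa) /
            (4 * m.phi * (lam / 2 + (1 + m.kappa)) * m.Delta)) →
          WithProbAtLeast Pr (1 - psi1 m c C ρ n lam ε₁ - psi2 m c C ρ n ε) fun ω =>
            (∃ b, IsSSDA lam (fun i => Z i ω) b) ∧
            ∀ b, IsSSDA lam (fun i => Z i ω) b → ∀ j ∈ m.active, b j ≠ 0)) ∧
      -- 3. estimation error on `A`
      (∀ ε : ℝ, 0 < ε → K * m.s * (n : ℝ) ^ (-ρ / 2) < ε →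
        ε < min ε₀ (min (lam / (2 * m.phi * m.Delta)) lam) →
        WithProbAtLeast Pr (1 - psi2 m c C ρ n ε) (fun ω =>
          (∃ g, IsHyp lam (fun i => Z i ω) m.active g) ∧
          ∀ g, IsHyp lam (fun i => Z i ω) m.active g →
            vecInfNorm (fun j : {j // j ∈ m.active} => g j - m.beta j) ≤ 4 * m.phi * lam) ∧
        (m.kappa < 1 → ∀ ε₁ : ℝ, 0 < ε₁ → K * m.s * (n : ℝ) ^ (-ρ / 2) < ε₁ →
          ε₁ < min ε₀ (lam * (1 - m.kappa) /
            (4 * m.phi * (lam / 2 + (1 + m.kappa)) * m.Delta)) →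
          WithProbAtLeast Pr (1 - psi1 m c C ρ n lam ε₁ - psi2 m c C ρ n ε) fun ω =>
            (∃ b, IsSSDA lam (fun i => Z i ω) b) ∧
            ∀ b, IsSSDA lam (fun i => Z i ω) b →
              vecInfNorm (fun j : {j // j ∈ m.active} => b j - m.beta j) ≤
                4 * m.phi * lam)) := by
  -- The sign of B is not assumed, whereas the Gaussian bounds need a nonnegative one.
  set B' := max B 0 with hB'
  have hB0 : 0 ≤ B' := le_max_right _ _
  -- The cap covers both uses of the mean tolerance: ε < 1, and the selection tolerance, at most λ <
  -- Δ ≤ B'. The value of c meets c ≤ ρ for ζ₁ and c ≤ 1/4 for ζ₂.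
  obtain ⟨K, hK, hmain⟩ := exists_goodData_prob hρ hρ' hq hq' hB0 (max 1 B')
    (c := min ρ (1 / 4)) (lt_min hρ (by norm_num)) (min_le_left _ _) (min_le_right _ _)
  refine ⟨min ρ (1 / 4), 1, K, 1, lt_min hρ (by norm_num), one_pos, hK, one_pos, ?_⟩
  intro p n m hmq hmB hn Ω _ Pr _ Z hZ lam hlam hlam'
  have hmB' : ∀ j, |m.muNeg j| ≤ B' := fun j => (hmB j).trans (le_max_left _ _)
  have hl : m.Admissible lam := ⟨hlam, hlam'⟩
  have hΩ := m.omega_posDef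
  have hA : m.active.Nonempty := Finset.card_pos.1 hl.s_pos
  have hgood := hmain p n m hmq hmB' hn Ω Pr Z hZ hl.s_pos
  have hfull : ∀ ε : ℝ, 0 < ε → K * m.s * (n : ℝ) ^ (-ρ / 2) < ε →
      ε < min 1 (lam * (1 - m.kappa) / (4 * m.phi * (lam / 2 + (1 + m.kappa)) * m.Delta)) →
      m.kappa < 1 → WithProbAtLeast Pr (1 - psi1 m (min ρ (1 / 4)) 1 ρ n lam ε) fun ω =>
        GoodData m (fun i => Z i ω) Finset.univ ε
          (lam * (1 - m.kappa - 2 * ε * m.phi) / (4 * (1 + m.kappa))) := by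
    intro ε hε hεK hε' hκ
    obtain ⟨hε1, hε2⟩ := lt_min_iff.1 hε'
    obtain ⟨ht0, ht⟩ := hl.selection_tolerance_bounds hκ hε hε2
    exact withProbAtLeast_of_real_compl_le ((hgood _ _ _ (hA.mono (Finset.subset_univ _)) hεK hε1
      ht0 (ht.trans (hl.lt_Delta.le.trans ((SeLDAModel.Delta_le hB0 hmB').trans
        (le_max_right _ _))))).trans (card_mul_add_le_psi1 m _ ρ n lam ε))
  have hactive : ∀ ε : ℝ, 0 < ε → K * m.s * (n : ℝ) ^ (-ρ / 2) < ε → ε < 1 →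
      WithProbAtLeast Pr (1 - psi2 m (min ρ (1 / 4)) 1 ρ n ε) fun ω =>
        GoodData m (fun i => Z i ω) m.active ε ε := fun ε hε hεK hε1 =>
    withProbAtLeast_of_real_compl_le ((hgood _ _ _ hA hεK hε1 hε
      (hε1.le.trans (le_max_left _ _))).trans (card_mul_add_le_psi2 m _ ρ n ε))
  refine ⟨fun hκ ε hε hεK hε' => ?_, fun ε hε hεK hε' => ?_, fun ε hε hεK hε' => ?_⟩
  · exact (hfull ε hε hεK hε' hκ).mono fun ω h => ⟨h.exists_isSSDA hlam, h.exists_isHyp hlam,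
      fun b g hb hg => h.selection hΩ hl hκ hε (lt_min_iff.1 hε').2 hb hg⟩
  · obtain ⟨hε1, hε2⟩ := lt_min_iff.1 hε'
    have hpart := hactive ε hε hεK hε1
    refine ⟨hpart.mono fun ω h => ⟨h.exists_isHyp hlam, fun g hg j =>
      h.hyp_ne_zero subset_rfl hΩ hl hε hε2 hg j⟩, fun hκ ε₁ hε₁ hεK₁ hε₁' => ?_⟩
    refine ((hfull ε₁ hε₁ hεK₁ hε₁' hκ).and hpart).mono fun ω ⟨h₁, h⟩ =>
      ⟨h₁.exists_isSSDA hlam, fun b hb j hj => ?_⟩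
    obtain ⟨g, hg⟩ := h₁.exists_isHyp hlam
    rw [(h₁.selection hΩ hl hκ hε₁ (lt_min_iff.1 hε₁').2 hb hg).1 ⟨j, hj⟩]
    exact h.hyp_ne_zero subset_rfl hΩ hl hε hε2 hg ⟨j, hj⟩
  · obtain ⟨hε1, hε2⟩ := lt_min_iff.1 hε'
    have hpart := hactive ε hε hεK hε1
    refine ⟨hpart.mono fun ω h => ⟨h.exists_isHyp hlam, fun g hg =>
      h.hyp_error subset_rfl hΩ hl hε hε2 hg⟩, fun hκ ε₁ hε₁ hεK₁ hε₁' => ?_⟩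
    refine ((hfull ε₁ hε₁ hεK₁ hε₁' hκ).and hpart).mono fun ω ⟨h₁, h⟩ =>
      ⟨h₁.exists_isSSDA hlam, fun b hb => ?_⟩
    obtain ⟨g, hg⟩ := h₁.exists_isHyp hlam
    simp only [(h₁.selection hΩ hl hκ hε₁ (lt_min_iff.1 hε₁').2 hb hg).1]
    exact h.hyp_error subset_rfl hΩ hl hε hε2 hg
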